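/- **Tapers.** Let $h:\mathbb R\to[0,\infty)$ be of bounded variation, zero outside $[0,1]$, continuous on $[0,1]$, with $H_k:=\int_0^1h(t)^k\,dt\ne0$ for all $k\ge1$, and put $h_T(t):=h(t/T)$. **Operators.** Let $\Lambda=[-\pi,\pi]$ (discrete time) or $\Lambda=\mathbb R$ (continuous time). Let $m\ge1$ and let $\psi_1,\dots,\psi_m\in L^1(\Lambda)$ be real-valued and even; for $\Lambda=[-\pi,\pi]$ they are extended $2\pi$-periodically to $\mathbb R$. Write $\widehat\psi(t)=\int_\Lambda e^{i\lambda t}\psi(\lambda)\,d\lambda$. In discrete time, for $T\in\mathbb N$, define the $T\times T$ tapered Toeplitz matrices $$A_T^h(\psi)=\bigl(\widehat\psi(t-s)\,h_T(s)\bigr)_{t,s=1}^T,\qquad B_T^h(\psi)=\bigl(\widehat\psi(t-s)\,h_T(t)\,h_T(s)\bigr)_{t,s=1}^T .$$ In continuous time, for real $T>0$, let $A_T^h(\psi)$ be the tapered Wiener–Hopf operator on the complex space $L^2([0,T];h_T(t)\,dt)$, $$[A_T^h(\psi)u](t)=\int_0^T\widehat\psi(t-s)\,u(s)\,h_T(s)\,ds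 .$$ **Conditions.** Assume that one of the following holds. * (C1) There are $p_1,\dots,p_m\in(1,\infty]$ with $\psi_i\in L^1(\Lambda)\cap L^{p_i}(\Lambda)$ and $\sum_{i=1}^m1/p_i\le1$. * (C2) The function $$\varphi(u_1,\dots,u_{m-1})=\int_\Lambda\psi_1(\lambda)\psi_2(\lambda-u_1)\cdots\psi_m(\lambda-u_{m-1})\,d\lambda$$ belongs to $L^{\max(m-2,0)}(\Lambda^{m-1})$, where $L^0$ is the space of all measurable functions, and is continuous at $\mathbf 0$: the integral $\varphi(\mathbf 0)$ converges absolutely, and $\varphi(\mathbf u)\to\varphi(\mathbf 0)$ as $\mathbf u\to\mathbf 0$ among those $\mathbf u$ for which the integral converges absolutely. **Conclusion.** The product $\prod_{i=1}^m\psi_i$ is integrable on $\Lambda$. In continuous time the operator $\prod_{i=1}^mA_T^h(\psi_i)$ is of trace class for every $T>0$. In both cases $$\lim_{T\to\infty}\frac1T\operatorname{tr}\Bigl[\prod_{i=1}^mA_T^h(\psi_i)\Bigr]=(2\pi)^{m-1}H_m\int_\Lambda\prod_{i=1}^m\psi_i(\lambda)\,d\lambda .$$ In discrete time, moreover, $$\lim_{T\to\infty}\frac1T\operatorname{tr}\Bigl[\prod_{i=1}^mB_T^h(\psi_i)\Bigr]=(2\pi)^{m-1}H_{2m}\int_\Lambda\prod_{i=1}^m\psi_i(\lambda)\,d\lambda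 .$$ -/

import Mathlib

open MeasureTheory Set Filter Topology
open scoped ENNReal

universe u

noncomputable section

namespace TaperedToeplitz

/-- `H_k = ∫₀¹ h(t)^k dt`. -/
def moment (h : ℝ → ℝ) (k : ℕ) : ℝ := ∫ t in (0 : ℝ)..1, h t ^ k

/-- Taper functions: nonnegative, of bounded variation, vanishing outside `[0, 1]`, continuous on
`[0, 1]`, with non-vanishing moments. Continuity is required on `[0, 1]` only, so that the
indicator of `[0, 1]` and `t ↦ (1 - t) 𝟙_{[0, 1]}(t)` are tapers. -/
structure IsTaper (h : ℝ → ℝ) : Prop where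
  continuousOn : ContinuousOn h (Icc 0 1)
  nonneg : ∀ t, 0 ≤ h t
  boundedVariation : BoundedVariationOn h univ
  eq_zero : ∀ t, t ∉ Icc (0 : ℝ) 1 → h t = 0
  moment_ne_zero : ∀ k : ℕ, 1 ≤ k → moment h k ≠ 0

/-- The frequency domain in discrete time. -/
def freqDT : Set ℝ := Icc (-Real.pi) Real.pi

/-- The frequency domain in continuous time. -/
def freqCT : Set ℝ := univ

/-- `ψ̂(t) = ∫_Λ e^{ixt} ψ(x) dx`, without normalizing factor. -/
def fourierHat (Λ : Set ℝ) (ψ : ℝ → ℝ) (t : ℝ) : ℂ :=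
  ∫ x in Λ, Complex.exp (Complex.I * x * t) * (ψ x : ℂ)

/-- The function `x ↦ ψ₁(x) ψ₂(x - u₁) ⋯ ψₘ(x - uₘ₋₁)`, where `m = n + 1`. -/
def shiftedProduct {n : ℕ} (ψ : Fin (n + 1) → ℝ → ℝ) (u : Fin n → ℝ) (x : ℝ) : ℝ :=
  ψ 0 x * ∏ j : Fin n, ψ j.succ (x - u j)

/-- The points `u` at which the integral defining `φ(u)` converges absolutely. -/
def convDomain {n : ℕ} (Λ : Set ℝ) (ψ : Fin (n + 1) → ℝ → ℝ) : Set (Fin n → ℝ) :=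
  {u | IntegrableOn (shiftedProduct ψ u) Λ}

/-- `φ(u) = ∫_Λ ψ₁(x) ψ₂(x - u₁) ⋯ ψₘ(x - uₘ₋₁) dx`. -/
def convFun {n : ℕ} (Λ : Set ℝ) (ψ : Fin (n + 1) → ℝ → ℝ) (u : Fin n → ℝ) : ℝ :=
  ∫ x in Λ, shiftedProduct ψ u x

/-- `ψ_i ∈ L^{p_i}(Λ)` with `1 < p_i ≤ ∞` and `∑ 1 / p_i ≤ 1`. -/
def HolderCondition {n : ℕ} (Λ : Set ℝ) (ψ : Fin (n + 1) → ℝ → ℝ) : Prop :=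
  ∃ p : Fin (n + 1) → ℝ≥0∞,
    (∀ i, 1 < p i ∧ MemLp (ψ i) (p i) (volume.restrict Λ)) ∧ ∑ i, (p i)⁻¹ ≤ 1

/-- `φ ∈ L^{m-2}(Λ^{m-1})` and `φ` is continuous at `0`, where `m = n + 1`. The space `L⁰` is that
of all measurable functions (it is the one meant for `m = 2`, and for `m = 1`, where `φ` is
constant). Continuity at `0` means that `φ(0)` exists and that `φ(u) → φ(0)` as `u → 0` within
the set of those `u` for which `φ(u)` exists. -/
def ConvolutionCondition {n : ℕ} (Λ : Set ℝ) (ψ : Fin (n + 1) → ℝ → ℝ) : Prop :=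
  MemLp (convFun Λ ψ) ((n - 1 : ℕ) : ℝ≥0∞) (volume.restrict (Set.pi univ fun _ : Fin n => Λ)) ∧
    0 ∈ convDomain Λ ψ ∧ ContinuousWithinAt (convFun Λ ψ) (convDomain Λ ψ) 0

/-! ### Toeplitz matrices -/

/-- The `T × T` matrix `(ψ̂(t - s) h_T(s))`, `t, s = 1, …, T`, where `h_T(t) = h(t / T)`. -/
def toeplitz (h : ℝ → ℝ) (ψ : ℝ → ℝ) (T : ℕ) : Matrix (Fin T) (Fin T) ℂ :=
  Matrix.of fun t s => fourierHat freqDT ψ ((t : ℝ) - (s : ℝ)) * (h (((s : ℝ) + 1) / T) : ℂ)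

/-- The `T × T` matrix `(ψ̂(t - s) h_T(t) h_T(s))`, `t, s = 1, …, T`, where `h_T(t) = h(t / T)`. -/
def toeplitzTwoSided (h : ℝ → ℝ) (ψ : ℝ → ℝ) (T : ℕ) : Matrix (Fin T) (Fin T) ℂ :=
  Matrix.of fun t s => fourierHat freqDT ψ ((t : ℝ) - (s : ℝ)) *
    (h (((t : ℝ) + 1) / T) : ℂ) * (h (((s : ℝ) + 1) / T) : ℂ)

/-! ### Wiener-Hopf operators -/

/-- The measure `h_T(t) dt` on `[0, T]`, where `h_T(t) = h(t / T)`. -/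
def taperMeasure (h : ℝ → ℝ) (T : ℝ) : Measure ℝ :=
  (volume.restrict (Icc 0 T)).withDensity fun t => ENNReal.ofReal (h (t / T))

theorem IsTaper.exists_bound {h : ℝ → ℝ} (hh : IsTaper h) : ∃ C, ∀ t, h t ≤ C := by
  obtain ⟨C, hC⟩ := isCompact_Icc.exists_bound_of_continuousOn hh.continuousOn
  refine ⟨max C 0, fun t => ?_⟩
  by_cases ht : t ∈ Icc (0 : ℝ) 1
  · exact (le_abs_self _).trans ((hC t ht).trans (le_max_left _ _))
  · rw [hh.eq_zero t ht]
    exact le_max_right _ _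

theorem isFiniteMeasure_taperMeasure {h : ℝ → ℝ} (hh : IsTaper h) (T : ℝ) :
    IsFiniteMeasure (taperMeasure h T) := by
  obtain ⟨C, hC⟩ := hh.exists_bound
  refine isFiniteMeasure_withDensity (ne_of_lt ?_)
  calc ∫⁻ t in Icc 0 T, ENNReal.ofReal (h (t / T))
      ≤ ∫⁻ _ in Icc 0 T, ENNReal.ofReal C :=
        lintegral_mono fun t => ENNReal.ofReal_le_ofReal (hC _)
    _ < ∞ := by
        rw [setLIntegral_const, Real.volume_Icc]
        exact ENNReal.mul_lt_top ENNReal.ofReal_lt_top ENNReal.ofReal_lt_top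

theorem norm_fourierHat_le (ψ : ℝ → ℝ) (t : ℝ) :
    ‖fourierHat freqCT ψ t‖ ≤ ∫ x, ‖ψ x‖ := by
  unfold fourierHat freqCT
  rw [Measure.restrict_univ]
  refine (norm_integral_le_integral_norm _).trans_eq ?_
  congr 1
  funext x
  have : Complex.I * x * t = ((x * t : ℝ) : ℂ) * Complex.I := by push_cast; ring
  rw [norm_mul, this, Complex.norm_exp_ofReal_mul_I, one_mul, Complex.norm_real]

theorem continuous_fourierHat {ψ : ℝ → ℝ} (hψ : Integrable ψ) :
    Continuous (fourierHat freqCT ψ) := by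
  unfold fourierHat freqCT
  rw [Measure.restrict_univ]
  refine continuous_of_dominated (bound := fun x => ‖ψ x‖) (fun t => ?_) (fun t => ?_) hψ.norm ?_
  · exact (by fun_prop : Continuous fun x : ℝ =>
      Complex.exp (Complex.I * x * t)).aestronglyMeasurable.mul hψ.ofReal.aestronglyMeasurable
  · refine Eventually.of_forall fun x => le_of_eq ?_
    have : Complex.I * x * t = ((x * t : ℝ) : ℂ) * Complex.I := by push_cast; ring
    rw [norm_mul, this, Complex.norm_exp_ofReal_mul_I, one_mul, Complex.norm_real]
  · exact Eventually.of_forall fun x => by fun_prop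

/-- `t ↦ ∫₀ᵀ ψ̂(t - s) u(s) h_T(s) ds`. -/
def wienerHopfFun (h ψ : ℝ → ℝ) (T : ℝ) (u : ℝ → ℂ) (t : ℝ) : ℂ :=
  ∫ s, fourierHat freqCT ψ (t - s) * u s ∂(taperMeasure h T)

theorem integrable_wienerHopf {h ψ : ℝ → ℝ} (hψ : Integrable ψ) {T : ℝ} {u : ℝ → ℂ}
    (hu : Integrable u (taperMeasure h T)) (t : ℝ) :
    Integrable (fun s => fourierHat freqCT ψ (t - s) * u s) (taperMeasure h T) := by
  refine hu.bdd_mul (c := ∫ x, ‖ψ x‖) ?_ (Eventually.of_forall fun s => norm_fourierHat_le ψ _)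
  exact ((continuous_fourierHat hψ).comp (by fun_prop)).aestronglyMeasurable

theorem norm_wienerHopfFun_le {h ψ : ℝ → ℝ} {T : ℝ} {u : ℝ → ℂ}
    (hu : Integrable u (taperMeasure h T)) (t : ℝ) :
    ‖wienerHopfFun h ψ T u t‖ ≤ (∫ x, ‖ψ x‖) * ∫ s, ‖u s‖ ∂(taperMeasure h T) := by
  refine (norm_integral_le_of_norm_le (hu.norm.const_mul (∫ x, ‖ψ x‖))
    (Eventually.of_forall fun s => ?_)).trans_eq (integral_const_mul _ _)
  rw [norm_mul]
  exact mul_le_mul_of_nonneg_right (norm_fourierHat_le ψ _) (norm_nonneg _)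

theorem continuous_wienerHopfFun {h ψ : ℝ → ℝ} (hψ : Integrable ψ) {T : ℝ} {u : ℝ → ℂ}
    (hu : Integrable u (taperMeasure h T)) : Continuous (wienerHopfFun h ψ T u) := by
  refine continuous_of_dominated (bound := fun s => (∫ x, ‖ψ x‖) * ‖u s‖)
    (fun t => (integrable_wienerHopf hψ hu t).aestronglyMeasurable)
    (fun t => Eventually.of_forall fun s => ?_) (hu.norm.const_mul _)
    (Eventually.of_forall fun s => ?_)
  · rw [norm_mul]
    exact mul_le_mul_of_nonneg_right (norm_fourierHat_le ψ _) (norm_nonneg _)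
  · exact ((continuous_fourierHat hψ).comp (by fun_prop)).mul continuous_const

theorem integrable_coe_lp {h : ℝ → ℝ} (hh : IsTaper h) {T : ℝ} (u : Lp ℂ 2 (taperMeasure h T)) :
    Integrable u (taperMeasure h T) := by
  have := isFiniteMeasure_taperMeasure hh T
  exact (Lp.memLp u).integrable (by norm_num)

theorem memLp_wienerHopfFun {h ψ : ℝ → ℝ} (hh : IsTaper h) (hψ : Integrable ψ) (T : ℝ)
    (u : Lp ℂ 2 (taperMeasure h T)) :
    MemLp (wienerHopfFun h ψ T u) 2 (taperMeasure h T) := by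
  have := isFiniteMeasure_taperMeasure hh T
  exact MemLp.of_bound (continuous_wienerHopfFun hψ (integrable_coe_lp hh u)).aestronglyMeasurable _
    (Eventually.of_forall fun t => norm_wienerHopfFun_le (integrable_coe_lp hh u) t)

/-- The operator `u ↦ ∫₀ᵀ ψ̂(· - s) u(s) h_T(s) ds` as a linear map of `L²([0, T]; h_T)`. -/
def wienerHopfLinear {h ψ : ℝ → ℝ} (hh : IsTaper h) (hψ : Integrable ψ) (T : ℝ) :
    Lp ℂ 2 (taperMeasure h T) →ₗ[ℂ] Lp ℂ 2 (taperMeasure h T) where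
  toFun u := (memLp_wienerHopfFun hh hψ T u).toLp _
  map_add' u v := by
    rw [← MemLp.toLp_add]
    refine MemLp.toLp_congr _ _ (Eventually.of_forall fun t => ?_)
    simp only [wienerHopfFun, Pi.add_apply]
    rw [← integral_add (integrable_wienerHopf hψ (integrable_coe_lp hh u) t)
      (integrable_wienerHopf hψ (integrable_coe_lp hh v) t)]
    refine integral_congr_ae ?_
    filter_upwards [Lp.coeFn_add u v] with s hs
    rw [hs, Pi.add_apply, mul_add]
  map_smul' c u := by
    rw [RingHom.id_apply, ← MemLp.toLp_const_smul]
    refine MemLp.toLp_congr _ _ (Eventually.of_forall fun t => ?_)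
    simp only [wienerHopfFun, Pi.smul_apply, smul_eq_mul]
    rw [← integral_const_mul]
    refine integral_congr_ae ?_
    filter_upwards [Lp.coeFn_smul c u] with s hs
    rw [hs, Pi.smul_apply, smul_eq_mul]
    ring

theorem exists_bound_wienerHopfLinear {h ψ : ℝ → ℝ} (hh : IsTaper h) (hψ : Integrable ψ) (T : ℝ) :
    ∃ C, ∀ u, ‖wienerHopfLinear hh hψ T u‖ ≤ C * ‖u‖ := by
  have := isFiniteMeasure_taperMeasure hh T
  set μ := taperMeasure h T with hμ
  set K : ℝ := (μ univ ^ (1 / (1 : ℝ≥0∞).toReal - 1 / (2 : ℝ≥0∞).toReal)).toReal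
  set I : ℝ := ∫ x, ‖ψ x‖
  have hI : 0 ≤ I := integral_nonneg fun x => norm_nonneg _
  set M : ℝ := (measureUnivNNReal μ : ℝ) ^ (2 : ℝ≥0∞).toReal⁻¹
  have hM : 0 ≤ M := by positivity
  refine ⟨M * (I * K), fun u => ?_⟩
  have h1 : ∫ s, ‖u s‖ ∂μ ≤ K * ‖u‖ := by
    have hle := eLpNorm_le_eLpNorm_mul_rpow_measure_univ (μ := μ) (p := 1) (q := 2)
      (by norm_num) (Lp.aestronglyMeasurable u)
    have hfin : μ univ ^ (1 / (1 : ℝ≥0∞).toReal - 1 / (2 : ℝ≥0∞).toReal) ≠ ∞ :=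
      ENNReal.rpow_ne_top_of_nonneg (by norm_num) (measure_ne_top μ univ)
    have := ENNReal.toReal_mono (ENNReal.mul_ne_top (Lp.eLpNorm_ne_top u) hfin) hle
    rw [ENNReal.toReal_mul, ← Lp.norm_def, mul_comm] at this
    refine le_trans (le_of_eq ?_) this
    rw [integral_norm_eq_lintegral_enorm (Lp.aestronglyMeasurable u), eLpNorm_one_eq_lintegral_enorm]
  have h2 : ‖wienerHopfLinear hh hψ T u‖ ≤ M * (I * ∫ s, ‖u s‖ ∂μ) := by
    refine Lp.norm_le_of_ae_bound
      (mul_nonneg hI (integral_nonneg fun x => norm_nonneg _)) ?_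
    filter_upwards [(memLp_wienerHopfFun hh hψ T u).coeFn_toLp] with t ht
    refine (le_of_eq (congrArg norm ht)).trans ?_
    exact norm_wienerHopfFun_le (integrable_coe_lp hh u) t
  calc _ ≤ M * (I * ∫ s, ‖u s‖ ∂μ) := h2
    _ ≤ M * (I * (K * ‖u‖)) := by gcongr
    _ = M * (I * K) * ‖u‖ := by ring

/-- The tapered Wiener-Hopf operator on `L²([0, T]; h_T)`. -/
def wienerHopf {h ψ : ℝ → ℝ} (hh : IsTaper h) (hψ : Integrable ψ) (T : ℝ) :
    Lp ℂ 2 (taperMeasure h T) →L[ℂ] Lp ℂ 2 (taperMeasure h T) :=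
  (wienerHopfLinear hh hψ T).mkContinuousOfExistsBound (exists_bound_wienerHopfLinear hh hψ T)

/-- The bounded operator `A` of a complex Hilbert space is of trace class, with trace `τ`: for every
orthonormal basis `(b_i)`, the series `∑ ⟨b_i, A b_i⟩` converges unconditionally, with sum `τ`. -/
def HasTrace {H : Type u} [NormedAddCommGroup H] [InnerProductSpace ℂ H] (A : H →L[ℂ] H)
    (τ : ℂ) : Prop :=
  ∀ (ι : Type u) (b : HilbertBasis ι ℂ H), HasSum (fun i => inner ℂ (b i) (A (b i))) τ

end TaperedToeplitz

end

/-! Write `m = n + 1`. Each operator is a superposition `A(ψ) = ∫ ψ(x) e_x ⊗ e_x* dx` of rank one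
operators, where `e_x` is the character of frequency `x` and the pairing carries the taper weight.
Hence `⟨e_a, e_b⟩ = k_T(a - b)`, where `k_T` is the Fourier transform of the tapered window
(`kernelDT`, `kernelCT`). The trace of the product is therefore the integral of `∏ ψᵢ(xᵢ)` times the
product of `k_T` over the increments of a closed path `x₀, x₁, …, xₙ, x₀`
(`trace_prod_weightedToeplitz`, `hasTrace_prod_wienerHopf`). The substitution `xⱼ = x₀ - uⱼ` turns
it into `∫ φ(u) Φ_T(u) du`, with `φ` the function of (C2) and `Φ_T` the product of the kernels along
the closed path through `0` and the `uⱼ` (`integral_mul_pathIntegral`).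

It remains to see that `Φ_T / T` is an approximate identity of mass `(2π)ⁿ H_m` against `φ`. Bounded
variation of the taper gives `|k_T(u)| ≤ C T / (1 + T‖u‖)` (`enorm_kernelDT_le`,
`exists_enorm_kernelCT_le`), and a Young type inequality for closed paths
(`lintegral_prod_steps_le`) then bounds `Φ_T / T` in `L¹`. A closed path that leaves a neighbourhood
of `0` must come back, so it has two long increments, on which the kernel is bounded in `T`.
Consequently the `L¹` mass of `Φ_T / T` away from `0` vanishes, and there `Φ_T / T` stays bounded in
the space dual to `L^{m-2}` if `m ≥ 4`, and in `L^∞` if `m` is 2 or 3. This matches the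
integrability of `φ`, which lies in `L¹` in any case (`tendsto_setLIntegral_mul_pathMajorant`). Near
`0`, continuity of `φ` suffices (`tendsto_integral_mul_kernel`).

The mass is computed exactly. In discrete time it is read off from the trace formula with all `ψᵢ =
1`, where the matrices are diagonal, and gives a Riemann sum of `h^m`; in continuous time,
convolving two kernels multiplies their windows.

Condition (C1) reduces to (C2): the weighted inequality of arithmetic and geometric means dominates
the shifted product by a sum of translates of integrable functions, which gives boundedness of `φ`
and its continuity at `0` (`convolutionCondition_of_le`). The two-sided matrices have the same
traces as the one-sided ones with taper `h²`. -/

noncomputable section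

namespace TaperedToeplitz

/-! ### Increments of a path -/

/-- The increments `a - x₀, x₀ - x₁, …, xₙ₋₁ - b` of the path `a, x₀, …, xₙ₋₁, b`. -/
def steps {n : ℕ} (a b : ℝ) (x : Fin n → ℝ) (i : Fin (n + 1)) : ℝ :=
  (Fin.cons a x : Fin (n + 1) → ℝ) i - (Fin.snoc x b : Fin (n + 1) → ℝ) i

theorem steps_fin_zero (a b : ℝ) (x : Fin 0 → ℝ) (i : Fin 1) : steps a b x i = a - b := by
  obtain rfl : i = 0 := Subsingleton.elim _ _
  simp [steps, Fin.snoc]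

theorem steps_cons_zero {n : ℕ} (a b y : ℝ) (x : Fin n → ℝ) :
    steps a b (Fin.cons y x : Fin (n + 1) → ℝ) 0 = a - y := by
  simp only [steps, Fin.cons_zero]
  rw [← Fin.cons_snoc_eq_snoc_cons, Fin.cons_zero]

theorem steps_cons_succ {n : ℕ} (a b y : ℝ) (x : Fin n → ℝ) (i : Fin (n + 1)) :
    steps a b (Fin.cons y x : Fin (n + 1) → ℝ) i.succ = steps y b x i := by
  simp only [steps, Fin.cons_succ]
  rw [← Fin.cons_snoc_eq_snoc_cons, Fin.cons_succ]

theorem prod_steps_cons {M : Type*} [CommMonoid M] {n : ℕ} (F : Fin (n + 2) → ℝ → M) (a b y : ℝ)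
    (x : Fin n → ℝ) :
    ∏ i, F i (steps a b (Fin.cons y x : Fin (n + 1) → ℝ) i) =
      F 0 (a - y) * ∏ i : Fin (n + 1), F i.succ (steps y b x i) := by
  rw [Fin.prod_univ_succ, steps_cons_zero]
  simp_rw [steps_cons_succ]

theorem measurable_steps {n : ℕ} (i : Fin (n + 1)) :
    Measurable fun p : ℝ × ℝ × (Fin n → ℝ) => steps p.1 p.2.1 p.2.2 i := by
  refine Measurable.sub ?_ ?_
  · refine Fin.cases ?_ (fun j => ?_) i
    · simp only [Fin.cons_zero]; fun_prop
    · simp only [Fin.cons_succ]; fun_prop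
  · refine Fin.lastCases ?_ (fun j => ?_) i
    · simp only [Fin.snoc_last]; fun_prop
    · simp only [Fin.snoc_castSucc]; fun_prop

theorem measurable_steps_right {n : ℕ} (a b : ℝ) (i : Fin (n + 1)) :
    Measurable fun x : Fin n → ℝ => steps a b x i :=
  (measurable_steps i).comp (by fun_prop : Measurable fun x : Fin n → ℝ => (a, b, x))

/-- Increments are invariant modulo `τ` under translation of the path. -/
theorem exists_steps_eq {n : ℕ} {τ c a b : ℝ} {x y : Fin n → ℝ}
    (hxy : ∀ j, ∃ k : ℤ, y j = x j + c + k * τ) (i : Fin (n + 1)) :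
    ∃ k : ℤ, steps (a + c) (b + c) y i = steps a b x i + k * τ := by
  have h1 : ∃ k : ℤ, (Fin.cons (a + c) y : Fin (n + 1) → ℝ) i =
      (Fin.cons a x : Fin (n + 1) → ℝ) i + c + k * τ := by
    refine Fin.cases ⟨0, by simp⟩ (fun j => ?_) i
    simpa using hxy j
  have h2 : ∃ k : ℤ, (Fin.snoc y (b + c) : Fin (n + 1) → ℝ) i =
      (Fin.snoc x b : Fin (n + 1) → ℝ) i + c + k * τ := by
    refine Fin.lastCases ⟨0, by simp⟩ (fun j => ?_) i
    simpa using hxy j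
  obtain ⟨k, hk⟩ := h1
  obtain ⟨l, hl⟩ := h2
  refine ⟨k - l, ?_⟩
  rw [steps, steps, hk, hl]
  push_cast
  ring

/-! ### Iterated integrals -/

section Pi

variable {n : ℕ} {ν : Measure ℝ} [SigmaFinite ν]

theorem measurePreserving_finCons :
    MeasurePreserving (fun p : ℝ × (Fin n → ℝ) => (Fin.cons p.1 p.2 : Fin (n + 1) → ℝ))
      (ν.prod (Measure.pi fun _ => ν)) (Measure.pi fun _ => ν) := by
  have := (measurePreserving_piFinSuccAbove (fun _ : Fin (n + 1) => ν) 0).symm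
  convert this using 1
  funext p
  simp [MeasurableEquiv.piFinSuccAbove_symm_apply, Fin.insertNthEquiv, Fin.insertNth_zero']

theorem measurableEmbedding_finCons :
    MeasurableEmbedding (fun p : ℝ × (Fin n → ℝ) => (Fin.cons p.1 p.2 : Fin (n + 1) → ℝ)) := by
  have := (MeasurableEquiv.piFinSuccAbove (fun _ : Fin (n + 1) => ℝ) 0).symm.measurableEmbedding
  convert this using 1
  funext p
  simp [MeasurableEquiv.piFinSuccAbove_symm_apply, Fin.insertNthEquiv, Fin.insertNth_zero']

theorem integral_pi_succ {f : (Fin (n + 1) → ℝ) → ℂ} (hf : Integrable f (Measure.pi fun _ => ν)) :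
    ∫ x, f x ∂(Measure.pi fun _ => ν) =
      ∫ y, ∫ x, f (Fin.cons y x) ∂(Measure.pi fun _ => ν) ∂ν := by
  rw [← (measurePreserving_finCons (ν := ν)).integral_comp measurableEmbedding_finCons]
  exact integral_prod _ ((measurePreserving_finCons (ν := ν)).integrable_comp_of_integrable hf)

theorem lintegral_pi_succ {f : (Fin (n + 1) → ℝ) → ℝ≥0∞} (hf : Measurable f) :
    ∫⁻ x, f x ∂(Measure.pi fun _ => ν) =
      ∫⁻ y, ∫⁻ x, f (Fin.cons y x) ∂(Measure.pi fun _ => ν) ∂ν := by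
  rw [← (measurePreserving_finCons (ν := ν)).lintegral_comp hf]
  exact lintegral_prod _ (hf.comp (measurePreserving_finCons (ν := ν)).measurable).aemeasurable

end Pi

/-! ### Frequency domains -/

/-- A set `Λ` of representatives of `ℝ` modulo `τ`, where `τ = 0` is allowed, together with a
reduction map `r` into it. -/
structure IsFreqDomain (Λ : Set ℝ) (τ : ℝ) (r : ℝ → ℝ) : Prop where
  norm_coe : ∀ u ∈ Λ, ‖(u : AddCircle τ)‖ = |u|
  measurableSet : MeasurableSet Λ
  measurable_red : Measurable r
  red_eq : ∀ y, ∃ k : ℤ, r y = y + k * τ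
  preserving : ∀ a, MeasurePreserving (fun u => r (a - u)) (volume.restrict Λ) (volume.restrict Λ)
  tendsto_shift : ∀ g : ℝ → ℝ, Function.Periodic g τ → IntegrableOn g Λ →
    Tendsto (fun u => ∫ x in Λ, |g (x - u) - g x|) (𝓝 0) (𝓝 0)

theorem periodic_eq_of_exists {β : Type*} {f : ℝ → β} {τ x y : ℝ} (hf : Function.Periodic f τ)
    (h : ∃ k : ℤ, y = x + k * τ) : f y = f x := by
  obtain ⟨k, rfl⟩ := h
  simpa using (hf.int_mul k) x

namespace IsFreqDomain

variable {Λ : Set ℝ} {τ : ℝ} {r : ℝ → ℝ} (hΛ : IsFreqDomain Λ τ r)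
include hΛ

/-- Two reflections compose to a translation modulo `τ`, so invariance under reflections is all that
the structure needs to record. -/
theorem preserving_sub (a : ℝ) :
    MeasurePreserving (fun u => r (0 - r (a - u))) (volume.restrict Λ) (volume.restrict Λ) :=
  (hΛ.preserving 0).comp (hΛ.preserving a)

theorem red_sub_eq (a u : ℝ) : ∃ k : ℤ, r (0 - r (a - u)) = u - a + k * τ := by
  obtain ⟨k, hk⟩ := hΛ.red_eq (a - u)
  obtain ⟨l, hl⟩ := hΛ.red_eq (0 - r (a - u))
  refine ⟨l - k, ?_⟩
  rw [hl, hk]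
  push_cast
  ring

theorem lintegral_sub_left {F : ℝ → ℝ≥0∞} (hF : Measurable F) (hper : Function.Periodic F τ)
    (a : ℝ) : ∫⁻ u in Λ, F (a - u) = ∫⁻ u in Λ, F u := by
  rw [← (hΛ.preserving a).lintegral_comp hF]
  exact lintegral_congr fun u => (periodic_eq_of_exists hper (hΛ.red_eq _)).symm

theorem lintegral_sub_right {F : ℝ → ℝ≥0∞} (hF : Measurable F) (hper : Function.Periodic F τ)
    (a : ℝ) : ∫⁻ u in Λ, F (u - a) = ∫⁻ u in Λ, F u := by
  rw [← (hΛ.preserving_sub a).lintegral_comp hF]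
  exact lintegral_congr fun u => (periodic_eq_of_exists hper (hΛ.red_sub_eq a u)).symm

theorem pi_preserving {n : ℕ} (a : ℝ) :
    MeasurePreserving (fun u : Fin n → ℝ => fun j => r (a - u j))
      (Measure.pi fun _ => volume.restrict Λ) (Measure.pi fun _ => volume.restrict Λ) :=
  measurePreserving_pi _ _ fun _ => hΛ.preserving a

/-- This is the substitution `xⱼ = x - uⱼ` modulo `τ` behind the passage from the trace to
`convFun`. -/
theorem prod_preserving {n : ℕ} :
    MeasurePreserving (fun p : ℝ × (Fin n → ℝ) => (p.1, fun j => r (p.1 - p.2 j)))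
      ((volume.restrict Λ).prod (Measure.pi fun _ => volume.restrict Λ))
      ((volume.restrict Λ).prod (Measure.pi fun _ => volume.restrict Λ)) := by
  refine (MeasurePreserving.id _).skew_product (g := fun a (u : Fin n → ℝ) j => r (a - u j)) ?_
    (Eventually.of_forall fun a => (hΛ.pi_preserving a).map_eq)
  have := hΛ.measurable_red
  fun_prop

end IsFreqDomain

/-! ### The majorant kernel -/

/-- `T / (1 + T ‖u‖)`, where `‖u‖` is the distance of `u` to `τℤ`. -/
def majorant (τ T u : ℝ) : ℝ≥0∞ := ENNReal.ofReal (T / (1 + T * ‖(u : AddCircle τ)‖))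

/-- The majorant kernel truncated to `‖u‖ ≥ δ`. -/
def farMajorant (τ δ T u : ℝ) : ℝ≥0∞ :=
  {u : ℝ | δ ≤ ‖(u : AddCircle τ)‖}.indicator (majorant τ T) u

theorem continuous_norm_addCircle (τ : ℝ) : Continuous fun u : ℝ => ‖(u : AddCircle τ)‖ :=
  (AddCircle.continuous_mk' τ).norm

theorem measurable_majorant (τ T : ℝ) : Measurable (majorant τ T) := by
  have := (continuous_norm_addCircle τ).measurable
  unfold majorant
  fun_prop

theorem measurable_farMajorant (τ δ T : ℝ) : Measurable (farMajorant τ δ T) :=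
  (measurable_majorant τ T).indicator
    (measurableSet_le measurable_const (continuous_norm_addCircle τ).measurable)

theorem periodic_majorant (τ T : ℝ) : Function.Periodic (majorant τ T) τ := fun u => by
  simp [majorant]

theorem periodic_farMajorant (τ δ T : ℝ) : Function.Periodic (farMajorant τ δ T) τ := fun u => by
  simp [farMajorant, indicator, majorant]

theorem farMajorant_le (τ δ T u : ℝ) : farMajorant τ δ T u ≤ majorant τ T u :=
  indicator_le_self _ _ _

theorem farMajorant_eq {τ δ T u : ℝ} (hu : δ ≤ ‖(u : AddCircle τ)‖) :
    farMajorant τ δ T u = majorant τ T u := indicator_of_mem (s := {u : ℝ | δ ≤ ‖(u : AddCircle τ)‖}) hu _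

theorem majorant_le (τ : ℝ) {T : ℝ} (hT : 0 ≤ T) (u : ℝ) : majorant τ T u ≤ ENNReal.ofReal T := by
  refine ENNReal.ofReal_le_ofReal (div_le_self hT ?_)
  have := mul_nonneg hT (norm_nonneg (u : AddCircle τ))
  linarith

theorem farMajorant_le_inv (τ : ℝ) {δ T : ℝ} (hδ : 0 < δ) (hT : 0 ≤ T) (u : ℝ) :
    farMajorant τ δ T u ≤ ENNReal.ofReal δ⁻¹ := by
  refine indicator_le' (fun v hv => ENNReal.ofReal_le_ofReal ?_) (fun v _ => zero_le) u
  have h1 : T * δ ≤ T * ‖(v : AddCircle τ)‖ := mul_le_mul_of_nonneg_left hv hT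
  rw [div_le_iff₀ (by nlinarith), inv_mul_eq_div, le_div_iff₀ hδ]
  linarith

theorem lintegral_one_add_abs_rpow_lt_top {p : ℝ} (hp : 1 < p) :
    ∫⁻ u : ℝ, ENNReal.ofReal ((1 + |u|) ^ (-p)) < ∞ := by
  have := (integrable_one_add_norm (E := ℝ) (μ := volume) (r := p) (by simpa using hp))
  have h := this.hasFiniteIntegral
  rw [hasFiniteIntegral_iff_ofReal (Eventually.of_forall fun u => by positivity)] at h
  exact h

namespace IsFreqDomain

variable {Λ : Set ℝ} {τ : ℝ} {r : ℝ → ℝ} (hΛ : IsFreqDomain Λ τ r)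
include hΛ

/-- Scaling by `T` reduces the integral to that of `(1 + |u|)^(-p)`. The restriction `p > 1` is
essential: the `L¹` norm on `ℝ` is infinite. -/
theorem lintegral_majorant_rpow_le {p : ℝ} (hp : 1 < p) :
    ∃ C : ℝ≥0∞, C ≠ ∞ ∧ ∀ T : ℝ, 0 < T →
      ∫⁻ u in Λ, majorant τ T u ^ p ≤ C * ENNReal.ofReal T ^ (p - 1) := by
  refine ⟨_, (lintegral_one_add_abs_rpow_lt_top hp).ne, fun T hT => ?_⟩
  calc ∫⁻ u in Λ, majorant τ T u ^ p
      = ∫⁻ u in Λ, ENNReal.ofReal T ^ p * ENNReal.ofReal ((1 + |T * u|) ^ (-p)) := by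
        refine setLIntegral_congr_fun hΛ.measurableSet fun u hu => ?_
        have h0 : 0 < 1 + T * |u| := by positivity
        simp only [majorant]
        rw [hΛ.norm_coe u hu, ENNReal.ofReal_rpow_of_nonneg (by positivity) (by linarith),
          ENNReal.ofReal_rpow_of_nonneg hT.le (by linarith), ← ENNReal.ofReal_mul (by positivity),
          abs_mul, abs_of_pos hT, Real.rpow_neg h0.le, Real.div_rpow hT.le h0.le, div_eq_mul_inv]
    _ ≤ ∫⁻ u : ℝ, ENNReal.ofReal T ^ p * ENNReal.ofReal ((1 + |T * u|) ^ (-p)) :=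
        setLIntegral_le_lintegral _ _
    _ = ENNReal.ofReal T ^ p * ∫⁻ u : ℝ, ENNReal.ofReal ((1 + |T * u|) ^ (-p)) := by
        rw [lintegral_const_mul _ (by fun_prop)]
    _ = ENNReal.ofReal T ^ p *
          (ENNReal.ofReal T⁻¹ * ∫⁻ u : ℝ, ENNReal.ofReal ((1 + |u|) ^ (-p))) := by
        congr 1
        rw [← lintegral_map (μ := volume) (f := fun u : ℝ => ENNReal.ofReal ((1 + |u|) ^ (-p)))
          (g := fun u => T * u) (by fun_prop) (by fun_prop), Real.map_volume_mul_left hT.ne',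
          lintegral_smul_measure, abs_of_pos (inv_pos.2 hT), smul_eq_mul]
    _ = _ := by
        rw [← mul_assoc, mul_comm]
        congr 1
        rw [ENNReal.ofReal_inv_of_pos hT, ENNReal.rpow_sub _ _ (by simpa using hT) (by simp),
          ENNReal.rpow_one, div_eq_mul_inv]

/-- For `|u| ≥ δ` one has `T / (1 + T|u|) ≤ 1 / |u| ≤ (1 + 1/δ) / (1 + |u|)`, so no power of `T`
appears. -/
theorem lintegral_farMajorant_rpow_le {p : ℝ} (hp : 1 < p) {δ : ℝ} (hδ : 0 < δ) :
    ∃ C : ℝ≥0∞, C ≠ ∞ ∧ ∀ T : ℝ, 0 < T → ∫⁻ u in Λ, farMajorant τ δ T u ^ p ≤ C := by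
  have hc : 0 < 1 + δ⁻¹ := by positivity
  refine ⟨ENNReal.ofReal ((1 + δ⁻¹) ^ p) * ∫⁻ u : ℝ, ENNReal.ofReal ((1 + |u|) ^ (-p)),
    ENNReal.mul_ne_top (by simp) (lintegral_one_add_abs_rpow_lt_top hp).ne, fun T hT => ?_⟩
  rw [← lintegral_const_mul _ (by fun_prop)]
  refine (setLIntegral_mono (by fun_prop) fun u hu => ?_).trans (setLIntegral_le_lintegral _ _)
  by_cases h : δ ≤ ‖(u : AddCircle τ)‖
  · rw [farMajorant_eq h, majorant, hΛ.norm_coe u hu]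
    rw [hΛ.norm_coe u hu] at h
    have hu0 : 0 < |u| := hδ.trans_le h
    rw [ENNReal.ofReal_rpow_of_nonneg (by positivity) (by linarith),
      ← ENNReal.ofReal_mul (by positivity), Real.rpow_neg (by positivity), ← div_eq_mul_inv,
      ← Real.div_rpow hc.le (by positivity)]
    refine ENNReal.ofReal_le_ofReal (Real.rpow_le_rpow (by positivity) ?_ (by linarith))
    rw [div_le_div_iff₀ (by positivity) (by positivity)]
    have : 1 ≤ δ⁻¹ * |u| := by rwa [inv_mul_eq_div, one_le_div hδ]
    nlinarith
  · have : farMajorant τ δ T u = 0 := indicator_of_notMem (s := {u : ℝ | δ ≤ ‖(u : AddCircle τ)‖}) h _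
    rw [this, ENNReal.zero_rpow_of_pos (by linarith)]
    exact zero_le

end IsFreqDomain

/-! ### Integrals of products over the increments of a closed path -/

/-- The smallest factor is at most the geometric mean of the `n` others. Removing it leaves `n`
increments, which are free coordinates on the `n`-dimensional path space. -/
theorem prod_le_sum_prod_succAbove {n : ℕ} (hn : n ≠ 0) (f : Fin (n + 1) → ℝ≥0∞) :
    ∏ i, f i ≤ ∑ i : Fin (n + 1), ∏ j : Fin n, f (i.succAbove j) ^ (1 + (n : ℝ)⁻¹) := by
  obtain ⟨i, hi⟩ := Finite.exists_min f
  refine le_trans ?_ (Finset.single_le_sum (fun _ _ => zero_le) (Finset.mem_univ i))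
  rw [Fin.prod_univ_succAbove f i]
  have h0 : (0 : ℝ) ≤ (n : ℝ)⁻¹ := by positivity
  simp_rw [ENNReal.rpow_add_of_nonneg _ _ zero_le_one h0, ENNReal.rpow_one]
  rw [Finset.prod_mul_distrib, mul_comm]
  gcongr
  calc f i = ∏ _j : Fin n, f i ^ (n : ℝ)⁻¹ := by
        rw [Finset.prod_const, Finset.card_univ, Fintype.card_fin, ← ENNReal.rpow_natCast,
          ← ENNReal.rpow_mul, inv_mul_cancel₀ (by exact_mod_cast hn), ENNReal.rpow_one]
    _ ≤ _ := Finset.prod_le_prod' fun j _ => ENNReal.rpow_le_rpow (hi _) h0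

namespace IsFreqDomain

variable {Λ : Set ℝ} {τ : ℝ} {r : ℝ → ℝ} (hΛ : IsFreqDomain Λ τ r)
include hΛ

/-- With the starting point integrated too, the increments are independent coordinates: only the
endpoint `b` is fixed. -/
theorem lintegral_lintegral_prod_steps {n : ℕ} {G : Fin (n + 1) → ℝ → ℝ≥0∞}
    (hG : ∀ j, Measurable (G j)) (hper : ∀ j, Function.Periodic (G j) τ) (b : ℝ) :
    ∫⁻ y in Λ, ∫⁻ x : Fin n → ℝ, ∏ j, G j (steps y b x j) ∂(Measure.pi fun _ => volume.restrict Λ) =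
      ∏ j, ∫⁻ u in Λ, G j u := by
  induction n with
  | zero =>
    simp [steps_fin_zero, hΛ.lintegral_sub_right (hG 0) (hper 0)]
  | succ n ih =>
    have hm : ∀ y, Measurable fun x : Fin (n + 1) → ℝ => ∏ j, G j (steps y b x j) := fun y =>
      Finset.measurable_fun_prod _ fun j _ => (hG j).comp (measurable_steps_right y b j)
    simp_rw [fun y => lintegral_pi_succ (ν := volume.restrict Λ) (hm y), prod_steps_cons]
    have hm2 : ∀ z, Measurable fun x : Fin n → ℝ => ∏ j : Fin (n + 1), G j.succ (steps z b x j) :=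
      fun z => Finset.measurable_fun_prod _ fun j _ => (hG _).comp (measurable_steps_right z b j)
    have hm3 : Measurable fun z => ∫⁻ x : Fin n → ℝ, ∏ j : Fin (n + 1), G j.succ (steps z b x j)
        ∂(Measure.pi fun _ => volume.restrict Λ) := by
      refine Measurable.lintegral_prod_right' (f := fun p : ℝ × (Fin n → ℝ) =>
        ∏ j : Fin (n + 1), G j.succ (steps p.1 b p.2 j)) ?_
      exact Finset.measurable_fun_prod _ fun j _ => (hG _).comp
        ((measurable_steps j).comp (by fun_prop : Measurable fun p : ℝ × (Fin n → ℝ) =>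
          (p.1, b, p.2)))
    simp_rw [fun y z => lintegral_const_mul (μ := Measure.pi fun _ => volume.restrict Λ)
        (G 0 (y - z)) (hm2 z)]
    rw [lintegral_lintegral_swap]
    · have h1 : ∀ z, ∫⁻ y in Λ, G 0 (y - z) * ∫⁻ x : Fin n → ℝ,
          ∏ j : Fin (n + 1), G j.succ (steps z b x j) ∂(Measure.pi fun _ => volume.restrict Λ) =
          (∫⁻ u in Λ, G 0 u) * ∫⁻ x : Fin n → ℝ,
          ∏ j : Fin (n + 1), G j.succ (steps z b x j) ∂(Measure.pi fun _ => volume.restrict Λ) := by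
        intro z
        have hm4 : Measurable fun y => G 0 (y - z) := (hG 0).comp (measurable_sub_const z)
        rw [lintegral_mul_const _ hm4, hΛ.lintegral_sub_right (hG 0) (hper 0)]
      simp_rw [h1]
      rw [lintegral_const_mul _ hm3, ih (fun j => hG _) (fun j => hper _)]
      exact (Fin.prod_univ_succ fun j => ∫⁻ u in Λ, G j u).symm
    · refine (Measurable.mul ((hG 0).comp (by fun_prop)) (hm3.comp measurable_snd)).aemeasurable

/-- Leaving out one increment cuts the path into two pieces, each with one free end, so the other
increments are independent coordinates. The induction peels off the first increment until the cut is
reached. -/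
theorem lintegral_prod_steps_succAbove {n : ℕ} {G : Fin n → ℝ → ℝ≥0∞}
    (hG : ∀ j, Measurable (G j)) (hper : ∀ j, Function.Periodic (G j) τ) (i : Fin (n + 1))
    (a b : ℝ) :
    ∫⁻ x : Fin n → ℝ, ∏ j, G j (steps a b x (i.succAbove j))
      ∂(Measure.pi fun _ => volume.restrict Λ) = ∏ j, ∫⁻ u in Λ, G j u := by
  induction n generalizing a b with
  | zero => simp
  | succ n ih =>
    have hm : Measurable fun x : Fin (n + 1) → ℝ => ∏ j, G j (steps a b x (i.succAbove j)) :=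
      Finset.measurable_fun_prod _ fun j _ => (hG j).comp (measurable_steps_right a b _)
    rw [lintegral_pi_succ hm]
    clear hm
    obtain rfl | ⟨i, rfl⟩ := i.eq_zero_or_eq_succ
    · simp_rw [Fin.succAbove_zero, steps_cons_succ]
      exact hΛ.lintegral_lintegral_prod_steps hG hper b
    · simp_rw [Fin.prod_univ_succ, Fin.succ_succAbove_zero, Fin.succ_succAbove_succ,
        steps_cons_succ, steps_cons_zero]
      have hm2 : ∀ y, Measurable fun x : Fin n → ℝ =>
          ∏ j : Fin n, G j.succ (steps y b x (i.succAbove j)) := fun y =>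
        Finset.measurable_fun_prod _ fun j _ => (hG _).comp (measurable_steps_right y b _)
      simp_rw [fun y => lintegral_const_mul (μ := Measure.pi fun _ => volume.restrict Λ)
        (G 0 (a - y)) (hm2 y)]
      simp_rw [ih (fun j => hG _) (fun j => hper _)]
      have hm4 : Measurable fun y => G 0 (a - y) := (hG 0).comp (measurable_const_sub a)
      rw [lintegral_mul_const _ hm4, hΛ.lintegral_sub_left (hG 0) (hper 0)]

/-- A form of Young's inequality for closed paths. -/
theorem lintegral_prod_steps_le {n : ℕ} (hn : n ≠ 0) {G : Fin (n + 1) → ℝ → ℝ≥0∞}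
    (hG : ∀ j, Measurable (G j)) (hper : ∀ j, Function.Periodic (G j) τ) (a b : ℝ) :
    ∫⁻ x : Fin n → ℝ, ∏ j, G j (steps a b x j) ∂(Measure.pi fun _ => volume.restrict Λ) ≤
      ∑ i : Fin (n + 1), ∏ j : Fin n, ∫⁻ u in Λ, G (i.succAbove j) u ^ (1 + (n : ℝ)⁻¹) := by
  set p : ℝ := 1 + (n : ℝ)⁻¹ with hp
  have hG' : ∀ j, Measurable fun u => G j u ^ p := fun j => (hG j).pow_const _
  have hper' : ∀ j, Function.Periodic (fun u => G j u ^ p) τ := fun j u => by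
    simp only [hper j u]
  have hm : ∀ i : Fin (n + 1), Measurable fun x : Fin n → ℝ => ∏ j : Fin n,
      G (i.succAbove j) (steps a b x (i.succAbove j)) ^ p := fun i =>
    Finset.measurable_fun_prod _ fun j _ => (hG' _).comp (measurable_steps_right a b _)
  refine (lintegral_mono fun x => prod_le_sum_prod_succAbove hn _).trans_eq ?_
  rw [lintegral_finsetSum _ fun i _ => hm i]
  refine Finset.sum_congr rfl fun i _ => ?_
  exact hΛ.lintegral_prod_steps_succAbove (fun j => hG' (i.succAbove j))
    (fun j => hper' (i.succAbove j)) i a b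

end IsFreqDomain

/-! ### Localization of the path kernel -/

theorem sum_steps {n : ℕ} (a b : ℝ) (x : Fin n → ℝ) : ∑ i, steps a b x i = a - b := by
  induction n generalizing a with
  | zero => simp [steps_fin_zero]
  | succ n ih =>
    rw [← Fin.cons_self_tail x, Fin.sum_univ_succ, steps_cons_zero]
    simp_rw [steps_cons_succ]
    rw [ih]
    ring

/-- The vertex `x j` is reached after the increments `0, …, j`, whence the bound `j.castSucc`. -/
theorem sum_steps_le {n : ℕ} (a b : ℝ) (x : Fin n → ℝ) (j : Fin n) :
    ∑ i with i ≤ j.castSucc, steps a b x i = a - x j := by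
  induction n generalizing a with
  | zero => exact j.elim0
  | succ n ih =>
    rw [← Fin.cons_self_tail x, Finset.sum_filter, Fin.sum_univ_succ, steps_cons_zero]
    simp_rw [steps_cons_succ]
    obtain rfl | ⟨j, rfl⟩ := j.eq_zero_or_eq_succ
    · simp [Fin.succ_ne_zero]
    · simp_rw [← Fin.succ_castSucc, Fin.succ_le_succ_iff]
      rw [← Finset.sum_filter, ih]
      simp

theorem exists_le_norm_of_le_norm_sum {τ δ : ℝ} {n : ℕ} (s : Finset (Fin (n + 1)))
    (w : Fin (n + 1) → ℝ) (hδ : 0 < δ) (h : δ ≤ ‖((∑ i ∈ s, w i : ℝ) : AddCircle τ)‖) :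
    ∃ i ∈ s, δ / (n + 1) ≤ ‖(w i : AddCircle τ)‖ := by
  by_contra! hc
  have hs : s.Nonempty := by
    rw [Finset.nonempty_iff_ne_empty]
    rintro rfl
    simp only [Finset.sum_empty, QuotientAddGroup.mk_zero, norm_zero] at h
    linarith
  have h1 : ((∑ i ∈ s, w i : ℝ) : AddCircle τ) = ∑ i ∈ s, (w i : AddCircle τ) :=
    map_sum (QuotientAddGroup.mk' (AddSubgroup.zmultiples τ)) w s
  have h2 : ‖((∑ i ∈ s, w i : ℝ) : AddCircle τ)‖ < ∑ i ∈ s, δ / (n + 1) := by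
    rw [h1]
    exact (norm_sum_le _ _).trans_lt (Finset.sum_lt_sum_of_nonempty hs hc)
  have h3 : ∑ i ∈ s, δ / (n + 1) ≤ δ := by
    rw [Finset.sum_const, nsmul_eq_mul, mul_div_assoc', div_le_iff₀ (by positivity), mul_comm]
    gcongr
    exact_mod_cast (Finset.card_le_univ s).trans_eq (Fintype.card_fin _)
  linarith

/-- The increments up to `u j` sum to `-u j` and the remaining ones to `u j`. By pigeonhole each of
these disjoint blocks contains a long increment: one on the way out, one on the way back. -/
theorem exists_far_steps {τ δ : ℝ} {n : ℕ} {u : Fin n → ℝ} {j : Fin n} (hδ : 0 < δ)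
    (h : δ ≤ ‖(u j : AddCircle τ)‖) :
    ∃ a b, a ≠ b ∧ δ / (n + 1) ≤ ‖(steps 0 0 u a : AddCircle τ)‖ ∧
      δ / (n + 1) ≤ ‖(steps 0 0 u b : AddCircle τ)‖ := by
  have h1 := sum_steps_le 0 0 u j
  have h2 := Finset.sum_filter_add_sum_filter_not Finset.univ (fun i => i ≤ j.castSucc)
    (fun i => steps 0 0 u i)
  rw [sum_steps, h1] at h2
  obtain ⟨a, ha, ha'⟩ := exists_le_norm_of_le_norm_sum (τ := τ)
    (Finset.univ.filter fun i => i ≤ j.castSucc) (steps 0 0 u) hδ (by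
      rw [h1, zero_sub, QuotientAddGroup.mk_neg, norm_neg]; exact h)
  obtain ⟨b, hb, hb'⟩ := exists_le_norm_of_le_norm_sum (τ := τ)
    (Finset.univ.filter fun i => ¬ i ≤ j.castSucc) (steps 0 0 u) hδ (by
      rw [show ∑ i with ¬ i ≤ j.castSucc, steps 0 0 u i = u j by linarith]; exact h)
  refine ⟨a, b, ?_, ha', hb'⟩
  rintro rfl
  simp only [Finset.mem_filter, Finset.mem_univ, true_and] at ha hb
  exact hb ha

/-- The majorant of the normalized product of kernels along a closed path. -/
def pathMajorant (n : ℕ) (τ T : ℝ) (u : Fin n → ℝ) : ℝ≥0∞ :=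
  (ENNReal.ofReal T)⁻¹ * ∏ i, majorant τ T (steps 0 0 u i)

theorem measurable_prod_steps {n : ℕ} {G : Fin (n + 1) → ℝ → ℝ≥0∞} (hG : ∀ i, Measurable (G i))
    (a b : ℝ) : Measurable fun u : Fin n → ℝ => ∏ i, G i (steps a b u i) :=
  Finset.measurable_fun_prod _ fun i _ => (hG i).comp (measurable_steps_right a b i)

theorem measurable_pathMajorant (n : ℕ) (τ T : ℝ) : Measurable (pathMajorant n τ T) :=
  (measurable_prod_steps (fun _ => measurable_majorant τ T) 0 0).const_mul _

/-- The kernels with the increments `a` and `b` truncated. -/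
def mixedMajorant {n : ℕ} (τ δ T : ℝ) (a b i : Fin (n + 1)) : ℝ → ℝ≥0∞ :=
  if i = a ∨ i = b then farMajorant τ δ T else majorant τ T

theorem measurable_mixedMajorant {n : ℕ} (τ δ T : ℝ) (a b i : Fin (n + 1)) :
    Measurable (mixedMajorant τ δ T a b i) := by
  unfold mixedMajorant
  split_ifs
  exacts [measurable_farMajorant τ δ T, measurable_majorant τ T]

theorem periodic_mixedMajorant {n : ℕ} (τ δ T : ℝ) (a b i : Fin (n + 1)) :
    Function.Periodic (mixedMajorant τ δ T a b i) τ := by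
  unfold mixedMajorant
  split_ifs
  exacts [periodic_farMajorant τ δ T, periodic_majorant τ T]

theorem mixedMajorant_le {n : ℕ} (τ δ T : ℝ) (a b i : Fin (n + 1)) (u : ℝ) :
    mixedMajorant τ δ T a b i u ≤ majorant τ T u := by
  unfold mixedMajorant
  split_ifs
  exacts [farMajorant_le τ δ T u, le_rfl]

theorem exists_prod_majorant_eq {n : ℕ} {τ δ T : ℝ} {u : Fin n → ℝ} {j : Fin n} (hδ : 0 < δ)
    (h : δ ≤ ‖(u j : AddCircle τ)‖) :
    ∃ a b : Fin (n + 1), a ≠ b ∧ ∏ i, majorant τ T (steps 0 0 u i) =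
      ∏ i, mixedMajorant τ (δ / (n + 1)) T a b i (steps 0 0 u i) := by
  obtain ⟨a, b, hab, ha, hb⟩ := exists_far_steps hδ h
  refine ⟨a, b, hab, Finset.prod_congr rfl fun i _ => ?_⟩
  unfold mixedMajorant
  split_ifs with hi
  · rcases hi with rfl | rfl
    exacts [(farMajorant_eq ha).symm, (farMajorant_eq hb).symm]
  · rfl

theorem prod_le_mul_pow {ι : Type*} {s : Finset ι} {F : ι → ℝ≥0∞} {A B : ℝ≥0∞}
    (hA : ∀ i ∈ s, F i ≤ A) {j : ι} (hj : j ∈ s) (hB : F j ≤ B) :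
    ∏ i ∈ s, F i ≤ B * A ^ (s.card - 1) := by
  classical
  rw [← Finset.mul_prod_erase s F hj, ← Finset.card_erase_of_mem hj]
  gcongr
  exact Finset.prod_le_pow_card _ _ _ fun i hi => hA i (Finset.mem_of_mem_erase hi)

theorem ae_pi_mem {Λ : Set ℝ} (hΛ : MeasurableSet Λ) (n : ℕ) :
    ∀ᵐ u : Fin n → ℝ ∂(Measure.pi fun _ => volume.restrict Λ), ∀ j, u j ∈ Λ := by
  rw [← Measure.restrict_pi_pi, ← volume_pi]
  filter_upwards [ae_restrict_mem (MeasurableSet.univ_pi fun _ => hΛ)] with u hu j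
  exact hu j (mem_univ j)

/-- The paths that leave the `δ`-cube. -/
def farSet (n : ℕ) (δ : ℝ) : Set (Fin n → ℝ) := {u | ∃ j, δ ≤ |u j|}

theorem measurableSet_farSet (n : ℕ) (δ : ℝ) : MeasurableSet (farSet n δ) := by
  have : farSet n δ = ⋃ j, {u | δ ≤ |u j|} := by
    ext u
    simp [farSet]
  rw [this]
  exact MeasurableSet.iUnion fun j => measurableSet_le measurable_const (by fun_prop)

namespace IsFreqDomain

variable {Λ : Set ℝ} {τ : ℝ} {r : ℝ → ℝ} (hΛ : IsFreqDomain Λ τ r)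
include hΛ

/-- With the exponent `p = 1 + 1/n`, each of the `n` integrals in the Young type inequality is
`O(T^(1/n))`. Their product is `O(T)`, which the normalization cancels. -/
theorem lintegral_pathMajorant_le (n : ℕ) :
    ∃ C : ℝ≥0∞, C ≠ ∞ ∧ ∀ T : ℝ, 0 < T →
      ∫⁻ u, pathMajorant n τ T u ∂(Measure.pi fun _ => volume.restrict Λ) ≤ C := by
  rcases Nat.eq_zero_or_pos n with rfl | hn
  · refine ⟨1, by simp, fun T hT => ?_⟩
    simp only [pathMajorant, steps_fin_zero, majorant]
    simp [ENNReal.inv_mul_cancel, hT]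
  · have hp : (1 : ℝ) < 1 + (n : ℝ)⁻¹ := by
      have : 0 < (n : ℝ)⁻¹ := by positivity
      linarith
    obtain ⟨C, hC, h⟩ := hΛ.lintegral_majorant_rpow_le hp
    refine ⟨(n + 1) * C ^ n, ENNReal.mul_ne_top (by simp) (by finiteness), fun T hT => ?_⟩
    have hT0 : ENNReal.ofReal T ≠ 0 := by simpa using hT
    have hm : Measurable fun u : Fin n → ℝ => ∏ i, majorant τ T (steps 0 0 u i) :=
      measurable_prod_steps (fun _ => measurable_majorant τ T) 0 0
    unfold pathMajorant
    rw [lintegral_const_mul _ hm, mul_comm, ← div_eq_mul_inv]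
    refine ENNReal.div_le_of_le_mul ?_
    refine (hΛ.lintegral_prod_steps_le hn.ne' (fun _ => measurable_majorant τ T)
      (fun _ => periodic_majorant τ T) 0 0).trans ?_
    rw [Finset.sum_const, Finset.prod_const, Finset.card_univ, Finset.card_univ, Fintype.card_fin,
      Fintype.card_fin, nsmul_eq_mul, mul_assoc]
    push_cast
    gcongr
    refine (pow_le_pow_left' (h T hT) n).trans_eq ?_
    rw [mul_pow, add_sub_cancel_left, ← ENNReal.rpow_natCast (_ ^ _), ← ENNReal.rpow_mul,
      inv_mul_cancel₀ (by exact_mod_cast hn.ne'), ENNReal.rpow_one]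

/-- The pair of long increments depends on the path; summing over all pairs `a ≠ b` removes this
dependence. -/
theorem setLIntegral_farSet_le {n : ℕ} {δ T : ℝ} (hδ : 0 < δ) {p : ℝ} (hp : 0 ≤ p) :
    ∫⁻ u in farSet n δ, pathMajorant n τ T u ^ p ∂(Measure.pi fun _ => volume.restrict Λ) ≤
      (ENNReal.ofReal T)⁻¹ ^ p * ∑ a : Fin (n + 1), ∑ b with a ≠ b,
        ∫⁻ u, ∏ i, mixedMajorant τ (δ / (n + 1)) T a b i (steps 0 0 u i) ^ p
          ∂(Measure.pi fun _ => volume.restrict Λ) := by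
  have hm : ∀ a b : Fin (n + 1), Measurable fun u : Fin n → ℝ =>
      ∏ i, mixedMajorant τ (δ / (n + 1)) T a b i (steps 0 0 u i) ^ p := fun a b =>
    measurable_prod_steps (fun i => (measurable_mixedMajorant τ _ T a b i).pow_const p) 0 0
  simp_rw [← lintegral_finsetSum _ fun b _ => hm _ b]
  rw [← lintegral_finsetSum _ fun a _ => Finset.measurable_sum _ fun b _ => hm a b,
    ← lintegral_const_mul _ (Finset.measurable_sum _ fun a _ =>
      Finset.measurable_sum _ fun b _ => hm a b),
    ← lintegral_indicator (measurableSet_farSet n δ)]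
  refine lintegral_mono_ae ?_
  filter_upwards [ae_pi_mem hΛ.measurableSet n] with u hu
  refine indicator_apply_le' (fun hf => ?_) fun _ => zero_le
  obtain ⟨j, hj⟩ := hf
  rw [← hΛ.norm_coe _ (hu j)] at hj
  obtain ⟨a, b, hab, h⟩ := exists_prod_majorant_eq (T := T) hδ hj
  rw [pathMajorant, ENNReal.mul_rpow_of_nonneg _ _ hp, h,
    ← ENNReal.prod_rpow_of_nonneg hp]
  gcongr
  refine le_trans ?_ (Finset.single_le_sum (fun _ _ => zero_le) (Finset.mem_univ a))
  exact Finset.single_le_sum (f := fun b => ∏ i, mixedMajorant τ (δ / (n + 1)) T a b i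
    (steps 0 0 u i) ^ p) (fun _ _ => zero_le) (by simpa using hab)

/-- Compared with `lintegral_pathMajorant_le`, one factor `T^(1/n)` is replaced by a constant, so
the far mass is `O(T^(-1/n))`. -/
theorem tendsto_setLIntegral_pathMajorant (n : ℕ) {δ : ℝ} (hδ : 0 < δ) :
    Tendsto (fun T : ℝ => ∫⁻ u in farSet n δ, pathMajorant n τ T u
      ∂(Measure.pi fun _ => volume.restrict Λ)) atTop (𝓝 0) := by
  rcases Nat.eq_zero_or_pos n with rfl | hn
  · have : farSet 0 δ = ∅ := by ext u; simp [farSet]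
    simp [this]
  have hδ' : 0 < δ / (n + 1) := by positivity
  have hn' : 0 < (n : ℝ)⁻¹ := by positivity
  set p : ℝ := 1 + (n : ℝ)⁻¹ with hp
  have hp1 : 1 < p := by linarith
  obtain ⟨C, hC, h⟩ := hΛ.lintegral_majorant_rpow_le hp1
  obtain ⟨D, hD, hfar⟩ := hΛ.lintegral_farMajorant_rpow_le hp1 hδ'
  have key : ∀ T : ℝ, 1 ≤ T → ∫⁻ u in farSet n δ, pathMajorant n τ T u
      ∂(Measure.pi fun _ => volume.restrict Λ) ≤
      (∑ a : Fin (n + 1), ∑ b with a ≠ b, ∑ _i : Fin (n + 1), D * C ^ (n - 1)) *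
        ENNReal.ofReal T ^ (-(n : ℝ)⁻¹) := by
    intro T hT
    have hT0 : 0 < T := by linarith
    have h1 := hΛ.setLIntegral_farSet_le (n := n) (T := T) hδ zero_le_one
    simp only [ENNReal.rpow_one] at h1
    refine h1.trans ?_
    have h2 : ∀ a b : Fin (n + 1), a ≠ b →
        ∫⁻ u, ∏ i, mixedMajorant τ (δ / (n + 1)) T a b i (steps 0 0 u i)
          ∂(Measure.pi fun _ => volume.restrict Λ) ≤
        (∑ _i : Fin (n + 1), D * C ^ (n - 1)) * ENNReal.ofReal T ^ (1 - (n : ℝ)⁻¹) := by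
      intro a b hab
      refine (hΛ.lintegral_prod_steps_le hn.ne' (fun i => measurable_mixedMajorant τ _ T a b i)
        (fun i => periodic_mixedMajorant τ _ T a b i) 0 0).trans ?_
      rw [Finset.sum_mul]
      refine Finset.sum_le_sum fun i _ => ?_
      -- The omitted increment `i` can be only one of `a` and `b`, so a truncated factor survives.
      -- This is why two long increments are needed.
      obtain ⟨j, hj⟩ : ∃ j, i.succAbove j = a ∨ i.succAbove j = b := by
        by_cases hia : a = i
        · obtain ⟨j, hj⟩ := Fin.exists_succAbove_eq (x := b) (y := i) (by rintro rfl; exact hab hia)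
          exact ⟨j, Or.inr hj⟩
        · obtain ⟨j, hj⟩ := Fin.exists_succAbove_eq (x := a) (y := i) hia
          exact ⟨j, Or.inl hj⟩
      refine (prod_le_mul_pow (s := Finset.univ) (A := C * ENNReal.ofReal T ^ (p - 1)) (B := D)
        (fun j _ => ?_) (Finset.mem_univ j) ?_).trans_eq ?_
      · refine (lintegral_mono fun u => ?_).trans (h T hT0)
        exact ENNReal.rpow_le_rpow (mixedMajorant_le τ _ T a b _ u) (by linarith)
      · rw [mixedMajorant, if_pos hj]
        exact hfar T hT0
      · rw [Finset.card_univ, Fintype.card_fin, mul_pow, ← ENNReal.rpow_natCast (_ ^ _),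
          ← ENNReal.rpow_mul, mul_assoc, Nat.cast_sub hn]
        congr 3
        rw [hp]
        field_simp
        push_cast
        ring
    calc _ ≤ (ENNReal.ofReal T)⁻¹ * ∑ a : Fin (n + 1), ∑ b with a ≠ b,
          (∑ _i : Fin (n + 1), D * C ^ (n - 1)) * ENNReal.ofReal T ^ (1 - (n : ℝ)⁻¹) := by
          gcongr with a _ b hb
          exact h2 a b (by simpa using hb)
      _ = _ := by
          have hT' : ENNReal.ofReal T ≠ 0 := by simpa using hT0
          simp_rw [← Finset.sum_mul]
          rw [mul_left_comm, sub_eq_add_neg, ENNReal.rpow_add _ _ hT' (by simp), ENNReal.rpow_one,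
            ← mul_assoc (_⁻¹), ENNReal.inv_mul_cancel hT' (by simp), one_mul]
  have hlim : Tendsto (fun T : ℝ => ENNReal.ofReal T ^ (-(n : ℝ)⁻¹)) atTop (𝓝 0) := by
    have := (ENNReal.tendsto_rpow_at_top hn').comp ENNReal.tendsto_ofReal_atTop
    simpa [ENNReal.rpow_neg] using this.inv
  have hfin : (∑ a : Fin (n + 1), ∑ b with a ≠ b, ∑ _i : Fin (n + 1), D * C ^ (n - 1)) ≠ ∞ := by
    refine ENNReal.sum_ne_top.2 fun a _ => ENNReal.sum_ne_top.2 fun b _ =>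
      ENNReal.sum_ne_top.2 fun i _ => ?_
    finiteness
  refine tendsto_of_tendsto_of_tendsto_of_le_of_le' tendsto_const_nhds
    ((ENNReal.Tendsto.const_mul hlim (Or.inr hfin)).trans_eq (by rw [mul_zero]))
    (Eventually.of_forall fun _ => zero_le) ?_
  filter_upwards [eventually_ge_atTop 1] with T hT using key T hT

/-- Two of the `n + 1` factors are bounded and the others are at most `T`; after normalization the
power of `T` is `n - 2 ≤ 0`. -/
theorem pathMajorant_le_of_mem_farSet {n : ℕ} (hn : 1 ≤ n) (hn2 : n ≤ 2) {δ T : ℝ} (hδ : 0 < δ)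
    (hT : 1 ≤ T) :
    ∀ᵐ u ∂(Measure.pi fun _ => volume.restrict Λ), u ∈ farSet n δ →
      pathMajorant n τ T u ≤ ENNReal.ofReal (δ / (n + 1))⁻¹ ^ 2 := by
  have hδ' : 0 < δ / (n + 1) := by positivity
  have hT0 : 0 < T := by linarith
  filter_upwards [ae_pi_mem hΛ.measurableSet n] with u hu hf
  obtain ⟨j, hj⟩ := hf
  rw [← hΛ.norm_coe _ (hu j)] at hj
  obtain ⟨a, b, hab, h⟩ := exists_prod_majorant_eq (T := T) hδ hj
  have hT' : ENNReal.ofReal T ≠ 0 := by simpa using hT0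
  have hT1 : 1 ≤ ENNReal.ofReal T := by simpa using hT
  rw [pathMajorant, h, mul_comm, ← div_eq_mul_inv]
  refine ENNReal.div_le_of_le_mul ?_
  rw [← Finset.mul_prod_erase _ _ (Finset.mem_univ a), sq, mul_assoc]
  gcongr
  · rw [mixedMajorant, if_pos (Or.inl rfl)]
    exact farMajorant_le_inv τ hδ' hT0.le _
  · refine (prod_le_mul_pow (A := ENNReal.ofReal T) (j := b)
      (B := ENNReal.ofReal (δ / (n + 1))⁻¹) (fun i _ => ?_) ?_ ?_).trans ?_
    · exact (mixedMajorant_le ..).trans (majorant_le τ hT0.le _)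
    · simpa using hab.symm
    · rw [mixedMajorant, if_pos (Or.inr rfl)]
      exact farMajorant_le_inv τ hδ' hT0.le _
    · gcongr
      rw [Finset.card_erase_of_mem (Finset.mem_univ a), Finset.card_univ, Fintype.card_fin]
      calc ENNReal.ofReal T ^ (n + 1 - 1 - 1) ≤ ENNReal.ofReal T ^ 1 :=
            pow_le_pow_right₀ hT1 (by omega)
        _ = _ := pow_one _

/-- The exponent `p = (n-1)/(n-2)` is conjugate to `n - 1`. One long increment is bounded pointwise
and taken out, the other contributes a bounded integral, and the remaining `n - 1` give
`T^((p-1)(n-1)) = T^p`, exactly offset by the normalization. -/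
theorem lintegral_rpow_pathMajorant_le {n : ℕ} (hn : 3 ≤ n) {δ : ℝ} (hδ : 0 < δ) :
    ∃ C : ℝ≥0∞, C ≠ ∞ ∧ ∀ T : ℝ, 0 < T →
      ∫⁻ u in farSet n δ, pathMajorant n τ T u ^ ((n - 1 : ℝ) / (n - 2))
        ∂(Measure.pi fun _ => volume.restrict Λ) ≤ C := by
  have hn' : (3 : ℝ) ≤ n := by exact_mod_cast hn
  have hδ' : 0 < δ / (n + 1) := by positivity
  set p : ℝ := (n - 1 : ℝ) / (n - 2) with hp
  have hp1 : 1 < p := by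
    rw [hp, one_lt_div (by linarith)]
    linarith
  have hp0 : 0 ≤ p := by linarith
  obtain ⟨C, hC, h⟩ := hΛ.lintegral_majorant_rpow_le hp1
  obtain ⟨D, hD, hfar⟩ := hΛ.lintegral_farMajorant_rpow_le hp1 hδ'
  refine ⟨∑ a : Fin (n + 1), ∑ b with a ≠ b,
    ENNReal.ofReal (δ / (n + 1))⁻¹ ^ p * (D * C ^ (n - 1)), ?_, fun T hT => ?_⟩
  · refine ENNReal.sum_ne_top.2 fun a _ => ENNReal.sum_ne_top.2 fun b _ => ?_
    finiteness
  have hT' : ENNReal.ofReal T ≠ 0 := by simpa using hT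
  refine (hΛ.setLIntegral_farSet_le hδ hp0).trans ?_
  have h2 : ∀ a b : Fin (n + 1), a ≠ b →
      ∫⁻ u, ∏ i, mixedMajorant τ (δ / (n + 1)) T a b i (steps 0 0 u i) ^ p
        ∂(Measure.pi fun _ => volume.restrict Λ) ≤
      ENNReal.ofReal (δ / (n + 1))⁻¹ ^ p * (D * C ^ (n - 1)) * ENNReal.ofReal T ^ p := by
    intro a b hab
    have hm : Measurable fun u : Fin n → ℝ => ∏ j : Fin n, mixedMajorant τ (δ / (n + 1)) T a b
        (b.succAbove j) (steps 0 0 u (b.succAbove j)) ^ p :=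
      Finset.measurable_fun_prod _ fun j _ =>
        ((measurable_mixedMajorant τ _ T a b _).pow_const p).comp (measurable_steps_right 0 0 _)
    have h3 : ∫⁻ u, ∏ i, mixedMajorant τ (δ / (n + 1)) T a b i (steps 0 0 u i) ^ p
        ∂(Measure.pi fun _ => volume.restrict Λ) ≤
        ENNReal.ofReal (δ / (n + 1))⁻¹ ^ p * ∫⁻ u, ∏ j : Fin n,
          mixedMajorant τ (δ / (n + 1)) T a b (b.succAbove j) (steps 0 0 u (b.succAbove j)) ^ p
            ∂(Measure.pi fun _ => volume.restrict Λ) := by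
      rw [← lintegral_const_mul _ hm]
      refine lintegral_mono fun u => ?_
      rw [Fin.prod_univ_succAbove _ b]
      gcongr
      rw [mixedMajorant, if_pos (Or.inr rfl)]
      exact farMajorant_le_inv τ hδ' hT.le _
    refine h3.trans ?_
    rw [hΛ.lintegral_prod_steps_succAbove
      (G := fun j u => mixedMajorant τ (δ / (n + 1)) T a b (b.succAbove j) u ^ p)
      (fun j => (measurable_mixedMajorant τ _ T a b _).pow_const p)
      (fun j u => by simp only [periodic_mixedMajorant τ _ T a b _ u]) b 0 0, mul_assoc]
    gcongr
    obtain ⟨j, hj⟩ := Fin.exists_succAbove_eq (x := a) (y := b) hab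
    refine (prod_le_mul_pow (s := Finset.univ) (A := C * ENNReal.ofReal T ^ (p - 1)) (B := D)
        (fun j _ => ?_) (Finset.mem_univ j) ?_).trans_eq ?_
    · refine (lintegral_mono fun u => ?_).trans (h T hT)
      exact ENNReal.rpow_le_rpow (mixedMajorant_le τ _ T a b _ u) hp0
    · rw [mixedMajorant, if_pos (Or.inl hj)]
      exact hfar T hT
    · rw [Finset.card_univ, Fintype.card_fin, mul_pow, ← ENNReal.rpow_natCast (_ ^ _),
        ← ENNReal.rpow_mul, mul_assoc, Nat.cast_sub (by omega)]
      congr 3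
      have : (n - 2 : ℝ) ≠ 0 := by linarith
      rw [hp]
      field_simp
      push_cast
      ring
  calc _ ≤ (ENNReal.ofReal T)⁻¹ ^ p * ∑ a : Fin (n + 1), ∑ b with a ≠ b,
        ENNReal.ofReal (δ / (n + 1))⁻¹ ^ p * (D * C ^ (n - 1)) * ENNReal.ofReal T ^ p := by
        gcongr with a _ b hb
        exact h2 a b (by simpa using hb)
    _ = _ := by
        simp_rw [← Finset.sum_mul]
        rw [mul_left_comm, ← ENNReal.mul_rpow_of_nonneg _ _ hp0, ENNReal.inv_mul_cancel hT' (by simp),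
          ENNReal.one_rpow, mul_one]

end IsFreqDomain

/-! ### Convergence of the smoothed convolution -/

/-- Split `f` at height `N`. The part below contributes at most `N ∫ X i → 0`; the part above is
small in `Lᵖ`, and the uniform dual bound transfers this to its integral against `X i`. -/
theorem tendsto_lintegral_mul_of_dual_bound {α ι : Type*} [MeasurableSpace α] {ν : Measure α}
    {l : Filter ι} {f : α → ℝ≥0∞} (hf : Measurable f) {p : ℝ} (hp : 0 < p)
    (hfp : ∫⁻ x, f x ^ p ∂ν ≠ ∞) {X : ι → α → ℝ≥0∞} (hX : ∀ i, Measurable (X i))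
    (hX0 : Tendsto (fun i => ∫⁻ x, X i x ∂ν) l (𝓝 0)) {C : ℝ≥0∞} (hC : C ≠ ∞)
    (hdual : ∀ᶠ i in l, ∀ g : α → ℝ≥0∞, Measurable g →
      ∫⁻ x, g x * X i x ∂ν ≤ C * (∫⁻ x, g x ^ p ∂ν) ^ p⁻¹) :
    Tendsto (fun i => ∫⁻ x, f x * X i x ∂ν) l (𝓝 0) := by
  let g : ℕ → α → ℝ≥0∞ := fun N => {x | (N : ℝ≥0∞) < f x}.indicator f
  have hs : ∀ N : ℕ, MeasurableSet {x | (N : ℝ≥0∞) < f x} := fun N =>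
    measurableSet_lt measurable_const hf
  have hg : ∀ N, Measurable (g N) := fun N => hf.indicator (hs N)
  have hle : ∀ N x, g N x ≤ f x := fun N x => indicator_le_self _ _ _
  have hfin : ∀ᵐ x ∂ν, f x < ∞ := by
    filter_upwards [ae_lt_top (hf.pow_const p) hfp] with x hx
    by_contra h
    rw [not_lt, top_le_iff] at h
    rw [h, ENNReal.top_rpow_of_pos hp] at hx
    exact lt_irrefl _ hx
  have hlim : Tendsto (fun N => ∫⁻ x, g N x ^ p ∂ν) atTop (𝓝 0) := by
    have h0 : (0 : ℝ≥0∞) = ∫⁻ _, 0 ∂ν := by simp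
    rw [h0]
    refine tendsto_lintegral_of_dominated_convergence _ (fun N => (hg N).pow_const p)
      (fun N => Eventually.of_forall fun x => ENNReal.rpow_le_rpow (hle N x) hp.le) hfp ?_
    filter_upwards [hfin] with x hx
    obtain ⟨N, hN⟩ := ENNReal.exists_nat_gt hx.ne
    refine tendsto_const_nhds.congr' ?_
    filter_upwards [eventually_ge_atTop N] with k hk
    have : g k x = 0 := indicator_of_notMem (by
      rw [mem_ofPred_eq, not_lt]
      exact hN.le.trans (by exact_mod_cast hk)) _
    rw [this, ENNReal.zero_rpow_of_pos hp]
  have hlim2 : Tendsto (fun N => C * (∫⁻ x, g N x ^ p ∂ν) ^ p⁻¹) atTop (𝓝 0) := by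
    have h1 := ENNReal.Tendsto.const_mul ((ENNReal.continuous_rpow_const (y := p⁻¹)).tendsto _ |>.comp hlim)
      (Or.inr hC)
    rwa [ENNReal.zero_rpow_of_pos (inv_pos.2 hp), mul_zero] at h1
  rw [ENNReal.tendsto_nhds_zero]
  intro ε hε
  have hε2 : 0 < ε / 2 := ENNReal.half_pos hε.ne'
  obtain ⟨N, hN⟩ := (ENNReal.tendsto_nhds_zero.1 hlim2 _ hε2).exists
  have hlim3 : Tendsto (fun i => (N : ℝ≥0∞) * ∫⁻ x, X i x ∂ν) l (𝓝 0) := by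
    have h1 := ENNReal.Tendsto.const_mul (a := (N : ℝ≥0∞)) hX0 (Or.inr (by simp))
    rwa [mul_zero] at h1
  filter_upwards [hdual, ENNReal.tendsto_nhds_zero.1 hlim3 _ hε2] with i hi hi2
  calc ∫⁻ x, f x * X i x ∂ν ≤ ∫⁻ x, N * X i x + g N x * X i x ∂ν := by
        refine lintegral_mono fun x => ?_
        rw [← add_mul]
        gcongr
        by_cases hx : (N : ℝ≥0∞) < f x
        · have : g N x = f x := indicator_of_mem (s := {x | (N : ℝ≥0∞) < f x}) hx _
          rw [this]
          exact le_add_self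
        · exact (not_lt.1 hx).trans le_self_add
    _ = N * (∫⁻ x, X i x ∂ν) + ∫⁻ x, g N x * X i x ∂ν := by
        rw [lintegral_add_left ((hX i).const_mul _), lintegral_const_mul _ (hX i)]
    _ ≤ ε / 2 + ε / 2 := add_le_add hi2 ((hi _ (hg N)).trans hN)
    _ = ε := ENNReal.add_halves ε

theorem enorm_complex_ofReal (x : ℝ) : ‖(x : ℂ)‖ₑ = ‖x‖ₑ := by
  rw [← ofReal_norm, Complex.norm_real, ofReal_norm]

theorem pathMajorant_le (n : ℕ) (τ : ℝ) {T : ℝ} (hT : 0 < T) (u : Fin n → ℝ) :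
    pathMajorant n τ T u ≤ ENNReal.ofReal T ^ n := by
  have hT' : ENNReal.ofReal T ≠ 0 := by simpa using hT
  rw [pathMajorant, mul_comm, ← div_eq_mul_inv]
  refine ENNReal.div_le_of_le_mul ?_
  refine (Finset.prod_le_pow_card _ _ _ fun i _ => majorant_le τ hT.le _).trans_eq ?_
  rw [Finset.card_univ, Fintype.card_fin, pow_succ]

namespace IsFreqDomain

variable {Λ : Set ℝ} {τ : ℝ} {r : ℝ → ℝ} (hΛ : IsFreqDomain Λ τ r)
include hΛ

/-- The dual bound comes from the pointwise estimate for `n ≤ 2`, with `f ∈ L¹`, and from Hölder's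
inequality with exponents `n - 1` and `(n-1)/(n-2)` for `n ≥ 3`. -/
theorem tendsto_setLIntegral_mul_pathMajorant {n : ℕ} {δ : ℝ} (hδ : 0 < δ)
    {f : (Fin n → ℝ) → ℝ≥0∞} (hf : Measurable f)
    (h1 : ∫⁻ u, f u ∂(Measure.pi fun _ => volume.restrict Λ) ≠ ∞)
    (h2 : 3 ≤ n → ∫⁻ u, f u ^ (n - 1 : ℝ) ∂(Measure.pi fun _ => volume.restrict Λ) ≠ ∞) :
    Tendsto (fun T : ℝ => ∫⁻ u in farSet n δ, f u * pathMajorant n τ T u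
      ∂(Measure.pi fun _ => volume.restrict Λ)) atTop (𝓝 0) := by
  have hX0 := hΛ.tendsto_setLIntegral_pathMajorant n hδ
  have hX : ∀ T, Measurable (pathMajorant n τ T) := measurable_pathMajorant n τ
  set ν : Measure (Fin n → ℝ) := Measure.pi fun _ => volume.restrict Λ with hν
  rcases Nat.eq_zero_or_pos n with rfl | hn
  · have : farSet 0 δ = ∅ := by ext u; simp [farSet]
    simp [this]
  rcases le_or_gt n 2 with hn2 | hn3
  · refine tendsto_lintegral_mul_of_dual_bound hf one_pos ?_ hX hX0
      (C := ENNReal.ofReal (δ / (n + 1))⁻¹ ^ 2) (by finiteness) ?_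
    · simp only [ENNReal.rpow_one]
      exact ((setLIntegral_le_lintegral _ _).trans_lt h1.lt_top).ne
    · filter_upwards [eventually_ge_atTop 1] with T hT g hg
      simp only [ENNReal.rpow_one, inv_one]
      rw [← lintegral_const_mul _ hg]
      refine lintegral_mono_ae ?_
      filter_upwards [ae_restrict_of_ae (hΛ.pathMajorant_le_of_mem_farSet hn hn2 hδ hT),
        ae_restrict_mem (measurableSet_farSet n δ)] with u hu hu2
      rw [mul_comm]
      gcongr
      exact hu hu2
  · have hn' : (3 : ℝ) ≤ n := by exact_mod_cast hn3
    obtain ⟨C, hC, hb⟩ := hΛ.lintegral_rpow_pathMajorant_le hn3 hδ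
    have hconj : (n - 1 : ℝ).HolderConjugate ((n - 1 : ℝ) / (n - 2)) := by
      rw [Real.holderConjugate_iff]
      refine ⟨by linarith, ?_⟩
      have h3 : (n - 1 : ℝ) ≠ 0 := by linarith
      have h4 : (n - 2 : ℝ) ≠ 0 := by linarith
      field_simp
      ring
    refine tendsto_lintegral_mul_of_dual_bound hf (p := (n - 1 : ℝ)) (by linarith) ?_ hX hX0
      (C := C ^ (1 / ((n - 1 : ℝ) / (n - 2)))) ?_ ?_
    · exact ((setLIntegral_le_lintegral _ _).trans_lt (h2 hn3).lt_top).ne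
    · exact ENNReal.rpow_ne_top_of_nonneg (one_div_nonneg.2 hconj.symm.nonneg) hC
    · filter_upwards [eventually_gt_atTop 0] with T hT g hg
      refine (ENNReal.lintegral_mul_le_Lp_mul_Lq _ hconj hg.aemeasurable
        (hX T).aemeasurable).trans ?_
      rw [mul_comm, one_div (n - 1 : ℝ)]
      gcongr
      · exact one_div_nonneg.2 hconj.symm.nonneg
      · exact hb T hT

/-- The approximate identity argument: `φ 0` times the mass converges by hypothesis, and `φ - φ 0`
is small near `0` by continuity, while its far part is controlled by the far estimates for `φ` and
for the constant. -/
theorem tendsto_integral_mul_kernel {n : ℕ} {ι : Type*} {l : Filter ι} {T : ι → ℝ}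
    (hT : Tendsto T l atTop) {Φ : ι → (Fin n → ℝ) → ℂ} (hΦm : ∀ i, Measurable (Φ i)) {C : ℝ≥0∞}
    (hC : C ≠ ∞) (hΦ : ∀ᶠ i in l, ∀ u, ‖Φ i u‖ₑ ≤ C * pathMajorant n τ (T i) u)
    {φ : (Fin n → ℝ) → ℝ} {D : Set (Fin n → ℝ)}
    (hD : ∀ᵐ u ∂(Measure.pi fun _ => volume.restrict Λ), u ∈ D) (hcont : ContinuousWithinAt φ D 0)
    (hint : Integrable φ (Measure.pi fun _ => volume.restrict Λ))
    (hmem : MemLp φ (n - 1 : ℕ) (Measure.pi fun _ => volume.restrict Λ)) {M : ℂ}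
    (hmass : Tendsto (fun i => ∫ u, Φ i u ∂(Measure.pi fun _ => volume.restrict Λ)) l (𝓝 M)) :
    Tendsto (fun i => ∫ u, φ u * Φ i u ∂(Measure.pi fun _ => volume.restrict Λ)) l
      (𝓝 (φ 0 * M)) := by
  obtain ⟨B, hB, hQ⟩ := hΛ.lintegral_pathMajorant_le n
  have hfar0 : ∀ δ : ℝ, 0 < δ → Tendsto (fun i => ∫⁻ u in farSet n δ, pathMajorant n τ (T i) u
      ∂(Measure.pi fun _ => volume.restrict Λ)) l (𝓝 0) := fun δ hδ =>
    (hΛ.tendsto_setLIntegral_pathMajorant n hδ).comp hT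
  have hfar : ∀ δ : ℝ, 0 < δ → Tendsto (fun i => ∫⁻ u in farSet n δ, ‖φ u‖ₑ *
      pathMajorant n τ (T i) u ∂(Measure.pi fun _ => volume.restrict Λ)) l (𝓝 0) := by
    intro δ hδ
    have hm := hint.aestronglyMeasurable.enorm
    have hae := hm.ae_eq_mk
    have h1 : ∫⁻ u, ‖φ u‖ₑ ∂(Measure.pi fun _ => volume.restrict Λ) ≠ ∞ :=
      hint.hasFiniteIntegral.ne
    have h2 : 3 ≤ n →
        ∫⁻ u, ‖φ u‖ₑ ^ (n - 1 : ℝ) ∂(Measure.pi fun _ => volume.restrict Λ) ≠ ∞ := by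
      intro hn
      have h3 := lintegral_rpow_enorm_lt_top_of_eLpNorm_lt_top (p := ((n - 1 : ℕ) : ℝ≥0∞))
        (by exact_mod_cast (by omega : n - 1 ≠ 0)) (by simp) hmem.eLpNorm_lt_top
      rw [ENNReal.toReal_natCast, Nat.cast_sub (by omega)] at h3
      simpa using h3.ne
    have key := hΛ.tendsto_setLIntegral_mul_pathMajorant (n := n) hδ (f := hm.mk _) hm.measurable_mk
      (by rwa [← lintegral_congr_ae hae])
      (fun hn => by
        rw [← lintegral_congr_ae (hae.mono fun u hu => congrArg (· ^ (n - 1 : ℝ)) hu)]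
        exact h2 hn)
    refine (key.comp hT).congr fun i => ?_
    refine lintegral_congr_ae ?_
    filter_upwards [ae_restrict_of_ae hae] with u hu
    rw [hu]
  set ν : Measure (Fin n → ℝ) := Measure.pi fun _ => volume.restrict Λ with hν
  have hQm : ∀ T, Measurable (pathMajorant n τ T) := measurable_pathMajorant n τ
  have hdiff : Tendsto (fun i => ∫ u, ((φ u : ℂ) - φ 0) * Φ i u ∂ν) l (𝓝 0) := by
    rw [tendsto_zero_iff_enorm_tendsto_zero, ENNReal.tendsto_nhds_zero]
    intro ε hε
    -- `η` is the oscillation of `φ` allowed near `0`; `C * B` bounds the total `L¹` mass of the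
    -- kernels.
    obtain ⟨η, hη, hη2⟩ : ∃ η : ℝ, 0 < η ∧ C * (ENNReal.ofReal η * B) ≤ ε / 2 := by
      have h1 : Tendsto (fun η : ℝ => C * (ENNReal.ofReal η * B)) (𝓝[>] 0) (𝓝 0) := by
        have h2 : Tendsto (fun η : ℝ => ENNReal.ofReal η) (𝓝[>] 0) (𝓝 0) := by
          have := (ENNReal.continuous_ofReal.tendsto 0).mono_left (nhdsWithin_le_nhds (s := Ioi 0))
          simpa using this
        have h3 := ENNReal.Tendsto.const_mul (ENNReal.Tendsto.mul_const h2 (Or.inr hB))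
          (Or.inr hC)
        simpa using h3
      obtain ⟨η, h2, h3⟩ := ((ENNReal.tendsto_nhds_zero.1 h1 _ (ENNReal.half_pos hε.ne')).and
        self_mem_nhdsWithin).exists
      exact ⟨η, h3, h2⟩
    obtain ⟨δ, hδ, hδ2⟩ := Metric.continuousWithinAt_iff.1 hcont η hη
    have hsum : Tendsto (fun i => C * ((∫⁻ u in farSet n δ, ‖φ u‖ₑ * pathMajorant n τ (T i) u ∂ν) +
        ‖φ 0‖ₑ * ∫⁻ u in farSet n δ, pathMajorant n τ (T i) u ∂ν)) l (𝓝 0) := by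
      have h3 := ENNReal.Tendsto.const_mul ((hfar δ hδ).add (ENNReal.Tendsto.const_mul (hfar0 δ hδ)
        (Or.inr (enorm_ne_top (x := φ 0))))) (Or.inr hC)
      simpa using h3
    filter_upwards [hΦ, hT.eventually_gt_atTop 0,
      ENNReal.tendsto_nhds_zero.1 hsum _ (ENNReal.half_pos hε.ne')] with i hi hTi hsi
    calc ‖∫ u, ((φ u : ℂ) - φ 0) * Φ i u ∂ν‖ₑ
        ≤ ∫⁻ u, ‖((φ u : ℂ) - φ 0) * Φ i u‖ₑ ∂ν := enorm_integral_le_lintegral_enorm _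
      _ ≤ ∫⁻ u, (farSet n δ).indicator (fun u => C * (‖φ u‖ₑ * pathMajorant n τ (T i) u +
            ‖φ 0‖ₑ * pathMajorant n τ (T i) u)) u +
            C * (ENNReal.ofReal η * pathMajorant n τ (T i) u) ∂ν := by
          refine lintegral_mono_ae ?_
          -- Continuity holds only within `D`, which is enough since almost every `u` lies in `D`.
          filter_upwards [hD] with u hu
          rw [enorm_mul, ← Complex.ofReal_sub, enorm_complex_ofReal]
          by_cases hf : u ∈ farSet n δ
          · rw [indicator_of_mem hf]
            refine le_trans ?_ le_self_add
            rw [← add_mul, mul_left_comm]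
            exact mul_le_mul' (enorm_sub_le (E := ℝ)) (hi u)
          · rw [indicator_of_notMem hf, zero_add, mul_left_comm]
            refine mul_le_mul' ?_ (hi u)
            have h3 : dist u 0 < δ := by
              rw [dist_pi_lt_iff hδ]
              intro j
              by_contra h4
              refine hf ⟨j, ?_⟩
              simpa using h4
            have h5 := hδ2 hu h3
            rw [Real.dist_eq] at h5
            rw [Real.enorm_eq_ofReal_abs]
            exact ENNReal.ofReal_le_ofReal h5.le
      _ = C * ((∫⁻ u in farSet n δ, ‖φ u‖ₑ * pathMajorant n τ (T i) u ∂ν) +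
            ‖φ 0‖ₑ * ∫⁻ u in farSet n δ, pathMajorant n τ (T i) u ∂ν) +
            C * (ENNReal.ofReal η * ∫⁻ u, pathMajorant n τ (T i) u ∂ν) := by
          rw [lintegral_add_right _ (((hQm _).const_mul _).const_mul _),
            lintegral_indicator (measurableSet_farSet n δ),
            lintegral_const_mul' _ _ hC, lintegral_add_right _ ((hQm _).const_mul _),
            lintegral_const_mul _ (hQm _), lintegral_const_mul' _ _ hC,
            lintegral_const_mul _ (hQm _)]
      _ ≤ ε / 2 + ε / 2 := by
          refine add_le_add hsi (le_trans ?_ hη2)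
          gcongr
          exact hQ _ hTi
      _ = ε := ENNReal.add_halves ε
  have hlim := hdiff.add (hmass.const_mul (φ 0 : ℂ))
  rw [zero_add] at hlim
  refine hlim.congr' ?_
  filter_upwards [hΦ, hT.eventually_gt_atTop 0] with i hi hTi
  have hb : ∀ u, ‖Φ i u‖ ≤ (C * ENNReal.ofReal (T i) ^ n).toReal := by
    intro u
    rw [← toReal_enorm]
    refine ENNReal.toReal_mono (by finiteness) ((hi u).trans ?_)
    gcongr
    exact pathMajorant_le n τ hTi u
  have hΦi : Integrable (Φ i) ν := by
    refine ⟨(hΦm i).aestronglyMeasurable, ?_⟩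
    refine (lintegral_mono hi).trans_lt ?_
    rw [lintegral_const_mul _ (hQm _)]
    exact ENNReal.mul_lt_top hC.lt_top ((hQ _ hTi).trans_lt hB.lt_top)
  have hφΦ : Integrable (fun u => (φ u : ℂ) * Φ i u) ν :=
    hint.ofReal.mul_bdd (hΦm i).aestronglyMeasurable (Eventually.of_forall hb)
  rw [← integral_const_mul, ← integral_add _ (hΦi.const_mul _)]
  · refine integral_congr_ae (Eventually.of_forall fun u => ?_)
    simp only
    ring
  · simp_rw [sub_mul]
    exact hφΦ.sub (hΦi.const_mul _)

end IsFreqDomain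

/-! ### Path integrals -/

/-- The integral over the paths `a, x₀, …, xₙ₋₁, b` of the product of the densities `ψᵢ(xᵢ)` and of
the values of the kernel `k` at the increments. -/
def pathIntegral {n : ℕ} (Λ : Set ℝ) (k : ℝ → ℂ) (ψ : Fin n → ℝ → ℝ) (a b : ℝ) : ℂ :=
  ∫ x : Fin n → ℝ, (∏ i, (ψ i (x i) : ℂ)) * ∏ i, k (steps a b x i)
    ∂(Measure.pi fun _ => volume.restrict Λ)

theorem pathIntegral_zero (Λ : Set ℝ) (k : ℝ → ℂ) (ψ : Fin 0 → ℝ → ℝ) (a b : ℝ) :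
    pathIntegral Λ k ψ a b = k (a - b) := by
  simp [pathIntegral, steps_fin_zero, measureReal_def]

theorem measurable_prod_kernel {n : ℕ} {k : ℝ → ℂ} (hk : Measurable k) (a b : ℝ) :
    Measurable fun x : Fin n → ℝ => ∏ i, k (steps a b x i) :=
  Finset.measurable_fun_prod _ fun i _ => hk.comp (measurable_steps_right a b i)

theorem norm_prod_kernel_le {n : ℕ} {k : ℝ → ℂ} {K : ℝ} (hK : ∀ u, ‖k u‖ ≤ K)
    (w : Fin n → ℝ) : ‖∏ i, k (w i)‖ ≤ K ^ n := by
  rw [norm_prod]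
  refine (Finset.prod_le_prod (fun i _ => norm_nonneg _) fun i _ => hK (w i)).trans_eq ?_
  rw [Finset.prod_const, Finset.card_univ, Fintype.card_fin]

theorem integrable_prod_density {Λ : Set ℝ} {n : ℕ} {ψ : Fin n → ℝ → ℝ}
    (hψ : ∀ i, IntegrableOn (ψ i) Λ) :
    Integrable (fun x : Fin n → ℝ => ∏ i, (ψ i (x i) : ℂ))
      (Measure.pi fun _ => volume.restrict Λ) :=
  Integrable.fintype_prod (f := fun i x => (ψ i x : ℂ)) fun i => (hψ i).ofReal

theorem pathIntegral_succ {Λ : Set ℝ} {k : ℝ → ℂ} (hk : Measurable k) {K : ℝ}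
    (hK : ∀ u, ‖k u‖ ≤ K) {n : ℕ} {ψ : Fin (n + 1) → ℝ → ℝ} (hψ : ∀ i, IntegrableOn (ψ i) Λ)
    (a b : ℝ) :
    pathIntegral Λ k ψ a b =
      ∫ y in Λ, (ψ 0 y : ℂ) * k (a - y) * pathIntegral Λ k (fun i => ψ i.succ) y b := by
  rw [pathIntegral, integral_pi_succ]
  · refine integral_congr_ae (Eventually.of_forall fun y => ?_)
    simp only
    rw [pathIntegral, ← integral_const_mul]
    refine integral_congr_ae (Eventually.of_forall fun x => ?_)
    simp only
    rw [prod_steps_cons (fun _ => k), Fin.prod_univ_succ]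
    simp only [Fin.cons_zero, Fin.cons_succ]
    ring
  · exact (integrable_prod_density hψ).mul_bdd (measurable_prod_kernel hk a b).aestronglyMeasurable
      (Eventually.of_forall fun x => norm_prod_kernel_le hK _)

theorem steps_neg {n : ℕ} (u : Fin n → ℝ) (i : Fin (n + 1)) :
    steps 0 0 (fun j => -u j) i = -steps 0 0 u i := by
  have h1 : (Fin.cons 0 (fun j => -u j) : Fin (n + 1) → ℝ) i =
      -(Fin.cons 0 u : Fin (n + 1) → ℝ) i := by
    refine Fin.cases (by simp) (fun j => by simp) i
  have h2 : (Fin.snoc (fun j => -u j) 0 : Fin (n + 1) → ℝ) i =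
      -(Fin.snoc u 0 : Fin (n + 1) → ℝ) i := by
    refine Fin.lastCases (by simp) (fun j => by simp) i
  rw [steps, steps, h1, h2]
  ring

namespace IsFreqDomain

variable {Λ : Set ℝ} {τ : ℝ} {r : ℝ → ℝ} (hΛ : IsFreqDomain Λ τ r)
include hΛ

/-- In the coordinates `xⱼ = x - uⱼ` the function is a tensor product of integrable functions. By
Fubini, `φ` exists almost everywhere and is integrable under the standing assumption `ψᵢ ∈ L¹`
alone. -/
theorem integrable_shiftedProduct {n : ℕ} {ψ : Fin (n + 1) → ℝ → ℝ}
    (hper : ∀ i, Function.Periodic (ψ i) τ) (hψ : ∀ i, IntegrableOn (ψ i) Λ) :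
    Integrable (fun p : ℝ × (Fin n → ℝ) => shiftedProduct ψ p.2 p.1)
      ((volume.restrict Λ).prod (Measure.pi fun _ => volume.restrict Λ)) := by
  have h1 : Integrable (fun x : Fin n → ℝ => ∏ i : Fin n, ψ i.succ (x i))
      (Measure.pi fun _ => volume.restrict Λ) :=
    Integrable.fintype_prod (f := fun (i : Fin n) x => ψ i.succ x) fun i => hψ i.succ
  refine (hΛ.prod_preserving.integrable_comp_of_integrable
    (Integrable.mul_prod (hψ 0) h1)).congr (Eventually.of_forall fun p => ?_)
  simp only [Function.comp, shiftedProduct]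
  congr 1
  exact Finset.prod_congr rfl fun j _ => periodic_eq_of_exists (hper _) (hΛ.red_eq _)

theorem integrable_convFun {n : ℕ} {ψ : Fin (n + 1) → ℝ → ℝ}
    (hper : ∀ i, Function.Periodic (ψ i) τ) (hψ : ∀ i, IntegrableOn (ψ i) Λ) :
    Integrable (convFun Λ ψ) (Measure.pi fun _ => volume.restrict Λ) :=
  (hΛ.integrable_shiftedProduct hper hψ).integral_prod_right

theorem ae_mem_convDomain {n : ℕ} {ψ : Fin (n + 1) → ℝ → ℝ}
    (hper : ∀ i, Function.Periodic (ψ i) τ) (hψ : ∀ i, IntegrableOn (ψ i) Λ) :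
    ∀ᵐ u ∂(Measure.pi fun _ => volume.restrict Λ), u ∈ convDomain Λ ψ :=
  (hΛ.integrable_shiftedProduct hper hψ).prod_left_ae

/-- After the substitution `xⱼ = x - uⱼ` the increments of the closed path no longer depend on `x`,
so the kernels leave the `x`-integral and `φ(u)` remains. -/
theorem integral_mul_pathIntegral {k : ℝ → ℂ} (hk : Measurable k) {K : ℝ} (hK : ∀ u, ‖k u‖ ≤ K)
    (hkper : Function.Periodic k τ) {n : ℕ} {ψ : Fin (n + 1) → ℝ → ℝ}
    (hper : ∀ i, Function.Periodic (ψ i) τ) (hψ : ∀ i, IntegrableOn (ψ i) Λ) :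
    ∫ x in Λ, (ψ 0 x : ℂ) * pathIntegral Λ k (fun i => ψ i.succ) x x =
      ∫ u, convFun Λ ψ u * ∏ i, k (-steps 0 0 u i) ∂(Measure.pi fun _ => volume.restrict Λ) := by
  set ν : Measure (Fin n → ℝ) := Measure.pi fun _ => volume.restrict Λ with hν
  set F : ℝ × (Fin n → ℝ) → ℂ := fun p =>
    (ψ 0 p.1 : ℂ) * (∏ i : Fin n, (ψ i.succ (p.2 i) : ℂ)) * ∏ i, k (steps p.1 p.1 p.2 i) with hF
  have hkm : Measurable fun p : ℝ × (Fin n → ℝ) => ∏ i, k (steps p.1 p.1 p.2 i) :=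
    Finset.measurable_fun_prod _ fun i _ => hk.comp ((measurable_steps i).comp
      (by fun_prop : Measurable fun p : ℝ × (Fin n → ℝ) => (p.1, p.1, p.2)))
  have hFi : Integrable F ((volume.restrict Λ).prod ν) := by
    refine Integrable.mul_bdd (c := K ^ (n + 1)) ?_ hkm.aestronglyMeasurable
      (Eventually.of_forall fun x => norm_prod_kernel_le hK _)
    exact Integrable.mul_prod (hψ 0).ofReal (integrable_prod_density fun i => hψ i.succ)
  have hmp := hΛ.prod_preserving (n := n)
  have hcomp : ∀ p : ℝ × (Fin n → ℝ), F (p.1, fun j => r (p.1 - p.2 j)) =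
      (shiftedProduct ψ p.2 p.1 : ℂ) * ∏ i, k (-steps 0 0 p.2 i) := by
    intro p
    simp only [hF, shiftedProduct]
    push_cast
    congr 1
    · congr 1
      refine Finset.prod_congr rfl fun j _ => ?_
      rw [periodic_eq_of_exists (hper _) (hΛ.red_eq _)]
    · refine Finset.prod_congr rfl fun i _ => ?_
      rw [← steps_neg]
      have h1 := exists_steps_eq (τ := τ) (c := p.1) (a := 0) (b := 0) (x := fun j => -p.2 j)
        (y := fun j => r (p.1 - p.2 j)) (fun j => by
          obtain ⟨m, hm⟩ := hΛ.red_eq (p.1 - p.2 j)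
          exact ⟨m, by rw [hm]; ring⟩) i
      rw [zero_add] at h1
      exact periodic_eq_of_exists hkper h1
  calc ∫ x in Λ, (ψ 0 x : ℂ) * pathIntegral Λ k (fun i => ψ i.succ) x x
      = ∫ x in Λ, ∫ y, F (x, y) ∂ν := by
        refine integral_congr_ae (Eventually.of_forall fun x => ?_)
        simp only [pathIntegral, hF]
        rw [← integral_const_mul]
        simp_rw [mul_assoc]
        rfl
    _ = ∫ p, F p ∂((volume.restrict Λ).prod ν) := (integral_prod F hFi).symm
    _ = ∫ p, F (p.1, fun j => r (p.1 - p.2 j)) ∂((volume.restrict Λ).prod ν) := by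
        conv_lhs => rw [← hmp.map_eq]
        refine integral_map hmp.measurable.aemeasurable ?_
        rw [hmp.map_eq]
        exact hFi.aestronglyMeasurable
    _ = ∫ u : Fin n → ℝ, (∫ x in Λ, F (x, fun j => r (x - u j))) ∂ν :=
        integral_prod_symm (fun p : ℝ × (Fin n → ℝ) => F (p.1, fun j => r (p.1 - p.2 j)))
          (hmp.integrable_comp_of_integrable hFi)
    _ = _ := by
        refine integral_congr_ae (Eventually.of_forall fun u => ?_)
        simp only [fun x => hcomp (x, u)]
        rw [integral_mul_const, convFun, integral_complex_ofReal]

/-- The limit theorem under the convolution condition, for kernels of unit mass `M`. -/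
theorem tendsto_integral_mul_pathIntegral {n : ℕ} {ψ : Fin (n + 1) → ℝ → ℝ}
    (hper : ∀ i, Function.Periodic (ψ i) τ) (hψ : ∀ i, IntegrableOn (ψ i) Λ)
    (hconv : ConvolutionCondition Λ ψ) {ι : Type*} {l : Filter ι} {T : ι → ℝ}
    (hT : Tendsto T l atTop) {k : ι → ℝ → ℂ} (hk : ∀ i, Measurable (k i))
    (hkper : ∀ i, Function.Periodic (k i) τ) {C : ℝ≥0∞} (hC : C ≠ ∞)
    (hkC : ∀ i, 0 < T i → ∀ u, ‖k i u‖ₑ ≤ C * majorant τ (T i) u) {M : ℂ}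
    (hmass : Tendsto (fun i => (1 / (T i : ℂ)) *
      ∫ u : Fin n → ℝ, ∏ j, k i (-steps 0 0 u j) ∂(Measure.pi fun _ => volume.restrict Λ)) l (𝓝 M)) :
    Tendsto (fun i => (1 / (T i : ℂ)) *
      ∫ x in Λ, (ψ 0 x : ℂ) * pathIntegral Λ (k i) (fun i => ψ i.succ) x x) l
        (𝓝 (M * ((∫ x in Λ, ∏ i, ψ i x : ℝ) : ℂ))) := by
  obtain ⟨hmem, h0, hcont⟩ := hconv
  rw [volume_pi, Measure.restrict_pi_pi] at hmem
  have hφ0 : convFun Λ ψ 0 = ∫ x in Λ, ∏ i, ψ i x := by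
    simp [convFun, shiftedProduct, Fin.prod_univ_succ]
  have hΦ : ∀ᶠ i in l, ∀ u : Fin n → ℝ, ‖(1 / (T i : ℂ)) * ∏ j, k i (-steps 0 0 u j)‖ₑ ≤
      C ^ (n + 1) * pathMajorant n τ (T i) u := by
    filter_upwards [hT.eventually_gt_atTop 0] with i hi u
    have h1 : ‖(1 / (T i : ℂ))‖ₑ = (ENNReal.ofReal (T i))⁻¹ := by
      rw [one_div, enorm_inv (by exact_mod_cast hi.ne'), enorm_complex_ofReal,
        Real.enorm_eq_ofReal hi.le]
    rw [enorm_mul, h1, pathMajorant, mul_left_comm]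
    gcongr
    have h2 : ‖∏ j, k i (-steps 0 0 u j)‖ₑ = ∏ j, ‖k i (-steps 0 0 u j)‖ₑ := by
      simp only [← ofReal_norm, norm_prod]
      exact ENNReal.ofReal_prod_of_nonneg fun _ _ => norm_nonneg _
    have h3 : C ^ (n + 1) = ∏ _j : Fin (n + 1), C := by simp
    rw [h2, h3, ← Finset.prod_mul_distrib]
    refine Finset.prod_le_prod' fun j _ => (hkC i hi _).trans_eq ?_
    rw [majorant, majorant, QuotientAddGroup.mk_neg, norm_neg]
  have hΦm : ∀ i, Measurable fun u : Fin n → ℝ =>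
      (1 / (T i : ℂ)) * ∏ j, k i (-steps 0 0 u j) := fun i =>
    (Finset.measurable_fun_prod _ fun j _ =>
      (hk i).comp (measurable_steps_right 0 0 j).fun_neg).const_mul _
  have key := hΛ.tendsto_integral_mul_kernel hT hΦm
    (C := C ^ (n + 1)) (by finiteness) hΦ (hΛ.ae_mem_convDomain hper hψ) hcont
    (hΛ.integrable_convFun hper hψ) hmem (M := M) (by simpa only [integral_const_mul] using hmass)
  rw [hφ0, mul_comm] at key
  refine key.congr' ?_
  filter_upwards [hT.eventually_gt_atTop 0] with i hi
  have hK : ∀ u, ‖k i u‖ ≤ (C * ENNReal.ofReal (T i)).toReal := fun u => by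
    rw [← toReal_enorm]
    refine ENNReal.toReal_mono (by finiteness) ((hkC i hi u).trans ?_)
    gcongr
    exact majorant_le τ hi.le u
  rw [hΛ.integral_mul_pathIntegral (hk i) hK (hkper i) hper hψ, ← integral_const_mul]
  refine integral_congr_ae (Eventually.of_forall fun u => ?_)
  simp only
  ring

end IsFreqDomain

/-! ### The two frequency domains -/

/-- Translations act continuously on `L¹`. -/
theorem tendsto_integral_norm_shift {E : Type*} [NormedAddCommGroup E] {g : ℝ → E}
    (hg : Integrable g) : Tendsto (fun u => ∫ x, ‖g (x - u) - g x‖) (𝓝 0) (𝓝 0) := by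
  have hm : MemLp g 1 := memLp_one_iff_integrable.2 hg
  set f : Lp E 1 (volume : Measure ℝ) := hm.toLp g with hf
  have : Fact ((1 : ℝ≥0∞) ≠ ∞) := ⟨by simp⟩
  have hc : Continuous fun u : ℝ => ‖(DomAddAct.mk (-u) +ᵥ f) - f‖ := by
    have h1 : Continuous fun u : ℝ => DomAddAct.mk (-u) +ᵥ f := by
      have : Continuous fun u : ℝ => (DomAddAct.mk (-u), f) := by
        refine Continuous.prodMk ?_ continuous_const
        exact DomAddAct.continuous_mk.comp continuous_neg
      exact continuous_vadd.comp this
    fun_prop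
  have h0 := hc.tendsto 0
  simp only [neg_zero] at h0
  have h1 : ‖(DomAddAct.mk (0 : ℝ) +ᵥ f) - f‖ = 0 := by
    have : DomAddAct.mk (0 : ℝ) +ᵥ f = f := zero_vadd _ f
    rw [this, sub_self, norm_zero]
  rw [h1] at h0
  refine h0.congr fun u => ?_
  rw [L1.norm_eq_integral_norm]
  refine integral_congr_ae ?_
  have h2 : (DomAddAct.mk (-u) +ᵥ f : Lp E 1 (volume : Measure ℝ)) =ᵐ[volume] fun x => f (-u + x) :=
    DomAddAct.vadd_Lp_ae_eq _ _
  have h3 : (fun x => f (-u + x)) =ᵐ[volume] fun x => g (-u + x) :=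
    (measurePreserving_add_left volume (-u)).quasiMeasurePreserving.ae_eq_comp hm.coeFn_toLp
  filter_upwards [Lp.coeFn_sub (DomAddAct.mk (-u) +ᵥ f) f, h2, h3, hm.coeFn_toLp] with x e1 e2 e3 e4
  rw [e1, Pi.sub_apply, e2, e3, e4, neg_add_eq_sub]

/-- With `τ = 0` the circle `AddCircle 0` is `ℝ` itself and periodicity is vacuous, so the line is a
degenerate case of the circle. -/
theorem isFreqDomain_freqCT : IsFreqDomain freqCT 0 id where
  norm_coe u _ := by simp [AddCircle.norm_eq]
  measurableSet := MeasurableSet.univ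
  measurable_red := measurable_id
  red_eq y := ⟨0, by simp⟩
  preserving a := by
    simp only [freqCT, Measure.restrict_univ, id]
    exact Measure.measurePreserving_sub_left volume a
  tendsto_shift g _ hg := by
    simp only [freqCT, Measure.restrict_univ, integrableOn_univ] at hg ⊢
    exact tendsto_integral_norm_shift hg

theorem restrict_freqDT :
    (volume : Measure ℝ).restrict freqDT = volume.restrict (Ioc (-Real.pi) (-Real.pi + 2 * Real.pi)) := by
  rw [freqDT, show -Real.pi + 2 * Real.pi = Real.pi by ring]
  exact Measure.restrict_congr_set Ioc_ae_eq_Icc.symm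

/-- The map factors through the circle, where it is the reflection `z ↦ b - z`, which preserves Haar
measure. -/
theorem measurePreserving_toIocMod (p a : ℝ) (hp : 0 < p) (b : ℝ) :
    MeasurePreserving (fun u => toIocMod hp a (b - u)) (volume.restrict (Ioc a (a + p)))
      (volume.restrict (Ioc a (a + p))) := by
  have : Fact (0 < p) := ⟨hp⟩
  let S : AddCircle p → ℝ := fun z => (AddCircle.equivIoc p a z : ℝ)
  have hS : Measurable S := measurable_subtype_coe.comp (AddCircle.measurableEquivIoc p a).measurable
  have hSm : MeasurePreserving S volume (volume.restrict (Ioc a (a + p))) := by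
    refine ⟨hS, ?_⟩
    rw [← (AddCircle.measurePreserving_mk p a).map_eq,
      Measure.map_map hS (AddCircle.measurePreserving_mk p a).measurable]
    conv_rhs => rw [← Measure.map_id (μ := volume.restrict (Ioc a (a + p)))]
    refine Measure.map_congr ?_
    filter_upwards [ae_restrict_mem measurableSet_Ioc] with x hx
    simp only [S, Function.comp, AddCircle.equivIoc_coe_eq hx, id]
  have h := hSm.comp ((Measure.measurePreserving_sub_left volume (b : AddCircle p)).comp
    (AddCircle.measurePreserving_mk p a))
  exact h

theorem isFreqDomain_freqDT :
    IsFreqDomain freqDT (2 * Real.pi) (toIocMod Real.two_pi_pos (-Real.pi)) where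
  norm_coe u hu := by
    rw [AddCircle.norm_coe_eq_abs_iff _ Real.two_pi_pos.ne', abs_of_pos Real.two_pi_pos,
      mul_div_cancel_left₀ _ two_ne_zero]
    exact abs_le.2 hu
  measurableSet := measurableSet_Icc
  measurable_red := by
    have h := (measurePreserving_toIocMod _ (-Real.pi) Real.two_pi_pos 0).measurable.comp
      measurable_neg
    simpa [Function.comp_def] using h
  red_eq y := ⟨-toIocDiv Real.two_pi_pos (-Real.pi) y, by
    rw [← self_sub_toIocDiv_mul]
    push_cast
    ring⟩
  preserving a := by
    rw [restrict_freqDT]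
    exact measurePreserving_toIocMod _ _ _ a
  tendsto_shift g hper hg := by
    have hpi := Real.pi_pos
    -- Cutting `g` off makes it integrable on the line without changing `g x` and `g (x - u)` for
    -- `|x| ≤ π` and `|u| < π`.
    set G : ℝ → ℝ := (Icc (-(3 * Real.pi)) (3 * Real.pi)).indicator g with hG
    have hGi : Integrable G := by
      rw [hG, integrable_indicator_iff measurableSet_Icc, ← intervalIntegrable_iff_integrableOn_Icc_of_le
        (by linarith)]
      refine hper.intervalIntegrable Real.two_pi_pos.ne' (t := -Real.pi) ?_ _ _
      rw [intervalIntegrable_iff_integrableOn_Icc_of_le (by linarith)]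
      rwa [show -Real.pi + 2 * Real.pi = Real.pi by ring]
    have h1 := tendsto_integral_norm_shift hGi
    refine squeeze_zero' (Eventually.of_forall fun u => integral_nonneg fun x => abs_nonneg _) ?_ h1
    filter_upwards [Metric.ball_mem_nhds (0 : ℝ) hpi] with u hu
    rw [Metric.mem_ball, dist_zero_right, Real.norm_eq_abs, abs_lt] at hu
    have hmem : ∀ y, |y| ≤ 2 * Real.pi → G y = g y := fun y hy => by
      rw [abs_le] at hy
      exact indicator_of_mem (s := Icc (-(3 * Real.pi)) (3 * Real.pi))
        ⟨by linarith, by linarith⟩ g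
    have h2 : ∫ x in freqDT, |g (x - u) - g x| = ∫ x in freqDT, |G (x - u) - G x| := by
      refine setIntegral_congr_fun measurableSet_Icc fun x hx => ?_
      rw [hmem _ (abs_le.2 ⟨by linarith [hx.1], by linarith [hx.2]⟩),
        hmem _ (abs_le.2 ⟨by linarith [hx.1], by linarith [hx.2]⟩)]
    rw [h2]
    refine setIntegral_le_integral ?_ (Eventually.of_forall fun x => abs_nonneg _)
    exact ((hGi.comp_sub_right u).sub hGi).abs

/-! ### The Hölder condition implies the convolution condition -/

/-- Dominated convergence with varying, convergent bounds. -/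
theorem tendsto_integral_of_tendsto_bound {α ι : Type*} [MeasurableSpace α] {ν : Measure α}
    {l : Filter ι} [l.IsCountablyGenerated] {f G S : ι → α → ℝ} {f₀ G₀ : α → ℝ}
    (hf : ∀ i, AEStronglyMeasurable (f i) ν) (hG : ∀ i, Integrable (G i) ν)
    (hG₀ : Integrable G₀ ν) (hS : ∀ i, Integrable (S i) ν) (hfG : ∀ i, ∀ᵐ x ∂ν, |f i x| ≤ G i x)
    (hfG₀ : ∀ᵐ x ∂ν, |f₀ x| ≤ G₀ x)
    (hGlim : Tendsto (fun i => ∫ x, |G i x - G₀ x| ∂ν) l (𝓝 0))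
    (hSlim : Tendsto (fun i => ∫ x, |S i x| ∂ν) l (𝓝 0))
    (hlim : ∀ (ns : ℕ → ι) (x : α), Tendsto (fun m => S (ns m) x) atTop (𝓝 0) →
      Tendsto (fun m => f (ns m) x) atTop (𝓝 (f₀ x))) :
    Tendsto (fun i => ∫ x, f i x ∂ν) l (𝓝 (∫ x, f₀ x ∂ν)) := by
  -- Clamping `f i` to `[-G₀, G₀]` gives a function with a fixed dominating bound, at distance at
  -- most `|G i - G₀|` from `f i`.
  set c : ι → α → ℝ := fun i x => max (-G₀ x) (min (f i x) (G₀ x)) with hc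
  have hcm : ∀ i, AEStronglyMeasurable (c i) ν := fun i =>
    hG₀.aestronglyMeasurable.neg.sup ((hf i).inf hG₀.aestronglyMeasurable)
  have hG₀nn : ∀ᵐ x ∂ν, 0 ≤ G₀ x := hfG₀.mono fun x hx => (abs_nonneg _).trans hx
  have hcb : ∀ i, ∀ᵐ x ∂ν, ‖c i x‖ ≤ G₀ x := by
    intro i
    filter_upwards [hG₀nn] with x hx
    rw [Real.norm_eq_abs, abs_le]
    exact ⟨le_max_left _ _, max_le (by linarith) (min_le_right _ _)⟩
  have hci : ∀ i, Integrable (c i) ν := fun i => hG₀.mono' (hcm i) (hcb i)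
  have hfi : ∀ i, Integrable (f i) ν := fun i => (hG i).mono' (hf i) (hfG i)
  have h1 : Tendsto (fun i => ∫ x, c i x ∂ν) l (𝓝 (∫ x, f₀ x ∂ν)) := by
    -- `S i` tends to `0` only in `L¹`; along a subsequence it does so almost everywhere, and `hlim`
    -- then yields pointwise convergence of `f`.
    refine tendsto_of_subseq_tendsto fun ns hns => ?_
    have h2 : TendstoInMeasure ν (fun m => S (ns m)) atTop 0 := by
      refine tendstoInMeasure_of_tendsto_eLpNorm one_ne_zero
        (fun m => (hS _).aestronglyMeasurable) aestronglyMeasurable_zero ?_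
      have h3 : ∀ m, eLpNorm (S (ns m) - 0) 1 ν = ENNReal.ofReal (∫ x, |S (ns m) x| ∂ν) := by
        intro m
        rw [sub_zero, eLpNorm_one_eq_lintegral_enorm,
          ofReal_integral_eq_lintegral_ofReal (hS _).abs (Eventually.of_forall fun x => abs_nonneg _)]
        simp_rw [Real.enorm_eq_ofReal_abs]
      simp_rw [h3]
      have h4 := (ENNReal.continuous_ofReal.tendsto 0).comp (hSlim.comp hns)
      simpa [Function.comp_def] using h4
    obtain ⟨ms, -, hms⟩ := h2.exists_seq_tendsto_ae
    refine ⟨ms, tendsto_integral_of_dominated_convergence G₀ (fun m => hcm _) hG₀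
      (fun m => hcb _) ?_⟩
    filter_upwards [hms, hfG₀] with x hx hx2
    have h5 := hlim (fun m => ns (ms m)) x hx
    have h6 : max (-G₀ x) (min (f₀ x) (G₀ x)) = f₀ x := by
      rw [abs_le] at hx2
      rw [min_eq_left hx2.2, max_eq_right hx2.1]
    rw [← h6]
    exact tendsto_const_nhds.max (h5.min tendsto_const_nhds)
  have h7 : Tendsto (fun i => ∫ x, f i x ∂ν - ∫ x, c i x ∂ν) l (𝓝 0) := by
    refine squeeze_zero_norm (fun i => ?_) hGlim
    rw [← integral_sub (hfi i) (hci i)]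
    refine (norm_integral_le_integral_norm _).trans
      (integral_mono_ae ((hfi i).sub (hci i)).norm ((hG i).sub hG₀).abs ?_)
    filter_upwards [hfG i, hG₀nn] with x hx hx0
    rw [abs_le] at hx
    simp only [hc, Real.norm_eq_abs]
    have e1 := le_abs_self (G i x - G₀ x)
    have e2 := abs_nonneg (G i x - G₀ x)
    rcases le_total (f i x) (G₀ x) with h | h
    · rw [min_eq_left h]
      rcases le_total (-G₀ x) (f i x) with h' | h'
      · rw [max_eq_right h', sub_self, abs_zero]
        exact e2
      · rw [max_eq_left h', abs_le]
        constructor <;> linarith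
    · rw [min_eq_right h, max_eq_right (by linarith), abs_le]
      constructor <;> linarith
  simpa using h7.add h1

/-- A function in `L¹ ∩ Lᵖ` is, up to a constant factor, at most the `w`-th power of an integrable
function, if `1 / p ≤ w ≤ 1`. -/
theorem exists_le_mul_rpow {ν : Measure ℝ} {ψ : ℝ → ℝ} {τ : ℝ} (hper : Function.Periodic ψ τ)
    (hψ : Integrable ψ ν) {p : ℝ≥0∞} (hp : 1 ≤ p) (hψp : MemLp ψ p ν) {w : ℝ}
    (hpw : p⁻¹.toReal ≤ w) (hw : w ≤ 1) :
    ∃ (z : ℝ → ℝ) (M : ℝ), (∀ x, 0 ≤ z x) ∧ Function.Periodic z τ ∧ Integrable z ν ∧ 0 ≤ M ∧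
      ∀ᵐ x ∂ν, |ψ x| ≤ M * z x ^ w := by
  have hw0 : 0 ≤ w := ENNReal.toReal_nonneg.trans hpw
  have htop : p = ∞ → ∃ M : ℝ, 0 ≤ M ∧ ∀ᵐ x ∂ν, |ψ x| ≤ M := by
    rintro rfl
    refine ⟨(eLpNormEssSup ψ ν).toReal, ENNReal.toReal_nonneg, ?_⟩
    have h1 := hψp.eLpNorm_ne_top
    rw [eLpNorm_exponent_top] at h1
    filter_upwards [enorm_ae_le_eLpNormEssSup ψ ν] with x hx
    have := ENNReal.toReal_mono h1 hx
    rwa [toReal_enorm, Real.norm_eq_abs] at this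
  rcases hw0.eq_or_lt with rfl | hwpos
  · have hp' : p = ∞ := by
      have h1 : p⁻¹.toReal = 0 := le_antisymm hpw ENNReal.toReal_nonneg
      rw [ENNReal.toReal_eq_zero_iff, ENNReal.inv_eq_zero, ENNReal.inv_eq_top] at h1
      rcases h1 with h | h
      · exact h
      · rw [h] at hp
        simp at hp
    obtain ⟨M, hM, h⟩ := htop hp'
    -- The weight `0` forces `p = ∞`, and `z = 0` is a legitimate choice because `0 ^ 0 = 1`.
    exact ⟨0, M, fun x => le_rfl, fun x => rfl, integrable_zero _ _ _, hM, by simpa using h⟩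
  · have hw1 : 1 ≤ w⁻¹ := (one_le_inv₀ hwpos).2 hw
    -- Since `1 ≤ 1/w ≤ p`, the power `|ψ|^(1/w)` is dominated by `|ψ| + |ψ|^p`, or by a multiple of
    -- `|ψ|` if `ψ` is bounded.
    refine ⟨fun x => |ψ x| ^ w⁻¹, 1, fun x => by positivity, fun x => by simp only [hper x], ?_,
      zero_le_one, Eventually.of_forall fun x => ?_⟩
    · have hm : AEStronglyMeasurable (fun x => |ψ x| ^ w⁻¹) ν :=
        ((Real.continuous_rpow_const (by positivity)).comp
          continuous_abs).comp_aestronglyMeasurable hψ.aestronglyMeasurable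
      by_cases hp' : p = ∞
      · obtain ⟨M, hM, h⟩ := htop hp'
        refine (hψ.abs.const_mul (M ^ (w⁻¹ - 1))).mono' hm ?_
        filter_upwards [h] with x hx
        rw [Real.norm_eq_abs, abs_of_nonneg (by positivity)]
        rcases (abs_nonneg (ψ x)).eq_or_lt with h0 | h0
        · rw [← h0, Real.zero_rpow (by positivity), mul_zero]
        · calc |ψ x| ^ w⁻¹ = |ψ x| ^ (w⁻¹ - 1) * |ψ x| := by
                rw [← Real.rpow_add_one h0.ne', sub_add_cancel]
            _ ≤ _ := by
                gcongr
      · have hp0 : 0 < p.toReal := ENNReal.toReal_pos (by rintro rfl; simp at hp) hp'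
        have hwp : w⁻¹ ≤ p.toReal := by
          rw [ENNReal.toReal_inv] at hpw
          exact inv_le_of_inv_le₀ hp0 hpw
        have hψp' := hψp.integrable_norm_rpow (by rintro rfl; simp at hp) hp'
        refine (hψ.abs.add hψp').mono' hm (Eventually.of_forall fun x => ?_)
        rw [Real.norm_eq_abs, abs_of_nonneg (by positivity), Pi.add_apply, Real.norm_eq_abs]
        rcases le_total |ψ x| 1 with h | h
        · have h2 : |ψ x| ^ w⁻¹ ≤ |ψ x| ^ (1 : ℝ) :=
            Real.rpow_le_rpow_of_exponent_ge' (abs_nonneg _) h zero_le_one hw1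
          rw [Real.rpow_one] at h2
          have : 0 ≤ |ψ x| ^ p.toReal := by positivity
          linarith
        · have h2 : |ψ x| ^ w⁻¹ ≤ |ψ x| ^ p.toReal := Real.rpow_le_rpow_of_exponent_le h hwp
          linarith
    · rw [one_mul, ← Real.rpow_mul (abs_nonneg _), inv_mul_cancel₀ hwpos.ne', Real.rpow_one]

/-- Exponents `p` with `∑ 1 / pᵢ ≤ 1` can be lowered to weights of sum `1`. -/
theorem exists_weights {n : ℕ} {p : Fin (n + 1) → ℝ≥0∞} (hp : ∀ i, 1 < p i)
    (hsum : ∑ i, (p i)⁻¹ ≤ 1) :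
    ∃ w : Fin (n + 1) → ℝ, (∀ i, (p i)⁻¹.toReal ≤ w i ∧ w i ≤ 1) ∧ ∑ i, w i = 1 := by
  have hfin : ∀ i, (p i)⁻¹ ≠ ∞ := fun i => by
    rw [ENNReal.inv_ne_top]
    exact (zero_lt_one.trans (hp i)).ne'
  have hv : ∀ i, (p i)⁻¹.toReal < 1 := fun i => by
    have := ENNReal.toReal_strict_mono ENNReal.one_ne_top (ENNReal.inv_lt_one.2 (hp i))
    simpa using this
  set s : ℝ := ∑ i, (p i)⁻¹.toReal with hs
  have hs1 : s ≤ 1 := by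
    rw [hs, ← ENNReal.toReal_sum fun i _ => hfin i]
    simpa using ENNReal.toReal_mono ENNReal.one_ne_top hsum
  have hsn : s < n + 1 := by
    have : s < ∑ _i : Fin (n + 1), (1 : ℝ) :=
      Finset.sum_lt_sum_of_nonempty Finset.univ_nonempty fun i _ => hv i
    simpa using this
  have hd : 0 < (n + 1 : ℝ) - s := by linarith
  -- The point at which the segment from `(1/pᵢ)` to `(1, …, 1)`, along which the coordinate sum
  -- grows from `s` to `n + 1`, has sum `1`. The strict inequality `1 < p i` keeps the denominator
  -- positive even for `n = 0`.
  set θ : ℝ := (1 - s) / (n + 1 - s) with hθ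
  have hθ0 : 0 ≤ θ := div_nonneg (by linarith) hd.le
  have hθ1 : θ ≤ 1 := by
    rw [hθ, div_le_one hd]
    have : (0 : ℝ) ≤ n := Nat.cast_nonneg n
    linarith
  refine ⟨fun i => (p i)⁻¹.toReal + θ * (1 - (p i)⁻¹.toReal), fun i => ⟨?_, ?_⟩, ?_⟩
  · nlinarith [hv i]
  · nlinarith [hv i]
  · rw [Finset.sum_add_distrib, ← Finset.mul_sum, Finset.sum_sub_distrib, ← hs]
    simp only [Finset.sum_const, Finset.card_univ, Fintype.card_fin, nsmul_eq_mul, mul_one]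
    push_cast
    rw [hθ, div_mul_cancel₀ _ hd.ne']
    ring

namespace IsFreqDomain

variable {Λ : Set ℝ} {τ : ℝ} {r : ℝ → ℝ} (hΛ : IsFreqDomain Λ τ r)
include hΛ

theorem integrableOn_comp_sub {g : ℝ → ℝ} (hper : Function.Periodic g τ) (hg : IntegrableOn g Λ)
    (a : ℝ) : IntegrableOn (fun x => g (x - a)) Λ :=
  ((hΛ.preserving_sub a).integrable_comp_of_integrable hg).congr
    (Eventually.of_forall fun x => periodic_eq_of_exists hper (hΛ.red_sub_eq a x))

theorem integral_comp_sub {g : ℝ → ℝ} (hper : Function.Periodic g τ) (hg : IntegrableOn g Λ)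
    (a : ℝ) : ∫ x in Λ, g (x - a) = ∫ x in Λ, g x := by
  have h := hΛ.preserving_sub a
  calc ∫ x in Λ, g (x - a) = ∫ x in Λ, g (r (0 - r (a - x))) :=
        integral_congr_ae (Eventually.of_forall fun x =>
          (periodic_eq_of_exists hper (hΛ.red_sub_eq a x)).symm)
    _ = ∫ y, g y ∂(Measure.map (fun x => r (0 - r (a - x))) (volume.restrict Λ)) :=
        (integral_map h.measurable.aemeasurable
          (by rw [h.map_eq]; exact hg.aestronglyMeasurable)).symm
    _ = _ := by rw [h.map_eq]

/-- By weighted AM-GM the shifted product is at most `G u`, a combination of translates of the `zᵢ`.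
The integral of `G u` does not depend on `u`, so `φ` is everywhere defined and bounded; as `u → 0`,
`G u → G 0` in `L¹`, which is the domination needed for continuity. -/
theorem convolutionCondition_of_le {n : ℕ} {ψ : Fin (n + 1) → ℝ → ℝ}
    (hper : ∀ i, Function.Periodic (ψ i) τ) (hψ : ∀ i, IntegrableOn (ψ i) Λ)
    {z : Fin (n + 1) → ℝ → ℝ} {M w : Fin (n + 1) → ℝ} (hz : ∀ i x, 0 ≤ z i x)
    (hzper : ∀ i, Function.Periodic (z i) τ) (hzi : ∀ i, IntegrableOn (z i) Λ) (hM : ∀ i, 0 ≤ M i)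
    (hw : ∀ i, 0 ≤ w i) (hw1 : ∑ i, w i = 1)
    (hle : ∀ i, ∀ᵐ x ∂volume.restrict Λ, |ψ i x| ≤ M i * z i x ^ w i) :
    ConvolutionCondition Λ ψ := by
  set G : (Fin n → ℝ) → ℝ → ℝ := fun u x =>
    (∏ i, M i) * (w 0 * z 0 x + ∑ j : Fin n, w j.succ * z j.succ (x - u j)) with hG
  have hGi : ∀ u, IntegrableOn (G u) Λ := fun u =>
    (((hzi 0).const_mul _).add (integrable_finsetSum _ fun j _ =>
      (hΛ.integrableOn_comp_sub (hzper j.succ) (hzi j.succ) (u j)).const_mul _)).const_mul _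
  have hshift : ∀ (i : Fin (n + 1)) (a : ℝ), ∀ᵐ x ∂volume.restrict Λ,
      |ψ i (x - a)| ≤ M i * z i (x - a) ^ w i := by
    intro i a
    filter_upwards [(hΛ.preserving_sub a).quasiMeasurePreserving.ae (hle i)] with x hx
    rwa [periodic_eq_of_exists (hper i) (hΛ.red_sub_eq a x),
      periodic_eq_of_exists (hzper i) (hΛ.red_sub_eq a x)] at hx
  have hbound : ∀ u, ∀ᵐ x ∂volume.restrict Λ, |shiftedProduct ψ u x| ≤ G u x := by
    intro u
    have h1 : ∀ᵐ x ∂volume.restrict Λ, ∀ j : Fin n,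
        |ψ j.succ (x - u j)| ≤ M j.succ * z j.succ (x - u j) ^ w j.succ :=
      ae_all_iff.2 fun j => hshift j.succ (u j)
    filter_upwards [h1, hle 0] with x hx hx0
    rw [shiftedProduct, abs_mul, Finset.abs_prod]
    calc |ψ 0 x| * ∏ j : Fin n, |ψ j.succ (x - u j)|
        ≤ (M 0 * z 0 x ^ w 0) * ∏ j : Fin n, M j.succ * z j.succ (x - u j) ^ w j.succ := by
          have h2 : 0 ≤ M 0 * z 0 x ^ w 0 := (abs_nonneg _).trans hx0
          gcongr with j _
          exact hx j
      _ = (∏ i, M i) * ∏ i, (z i (x - (Fin.cons 0 u : Fin (n + 1) → ℝ) i)) ^ w i := by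
          rw [Finset.prod_mul_distrib, Fin.prod_univ_succ M, Fin.prod_univ_succ]
          simp only [Fin.cons_zero, Fin.cons_succ, sub_zero]
          ring
      _ ≤ (∏ i, M i) * ∑ i, w i * z i (x - (Fin.cons 0 u : Fin (n + 1) → ℝ) i) := by
          have h3 : 0 ≤ ∏ i, M i := Finset.prod_nonneg fun i _ => hM i
          gcongr
          exact Real.geom_mean_le_arith_mean_weighted _ _ _ (fun i _ => hw i) hw1
            fun i _ => hz i _
      _ = G u x := by
          simp only [hG, Fin.sum_univ_succ, Fin.cons_zero, Fin.cons_succ, sub_zero]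
  have hm : ∀ u, AEStronglyMeasurable (shiftedProduct ψ u) (volume.restrict Λ) := fun u =>
    (hψ 0).aestronglyMeasurable.mul (Finset.aestronglyMeasurable_fun_prod _ fun j _ =>
      (hΛ.integrableOn_comp_sub (hper j.succ) (hψ j.succ) (u j)).aestronglyMeasurable)
  have hint : ∀ u, IntegrableOn (shiftedProduct ψ u) Λ := fun u => (hGi u).mono' (hm u) (hbound u)
  refine ⟨?_, hint 0, ?_⟩
  · rw [volume_pi, Measure.restrict_pi_pi]
    have hφ := hΛ.integrable_convFun hper hψ
    have hGu : ∀ u, ∫ x in Λ, G u x = ∫ x in Λ, G 0 x := by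
      have h1 : ∀ u, ∫ x in Λ, G u x =
          (∏ i, M i) * (w 0 * (∫ x in Λ, z 0 x) + ∑ j : Fin n, w j.succ * ∫ x in Λ, z j.succ x) := by
        intro u
        simp only [hG]
        rw [integral_const_mul, integral_add ((hzi 0).const_mul _) (integrable_finsetSum _ fun j _ =>
            (hΛ.integrableOn_comp_sub (hzper j.succ) (hzi j.succ) (u j)).const_mul _),
          integral_const_mul, integral_finsetSum _ fun j _ =>
            (hΛ.integrableOn_comp_sub (hzper j.succ) (hzi j.succ) (u j)).const_mul _]
        simp_rw [integral_const_mul]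
        congr 2
        exact Finset.sum_congr rfl fun j _ => by
          rw [hΛ.integral_comp_sub (hzper j.succ) (hzi j.succ)]
      intro u
      rw [h1 u, h1 0]
    have hB : ∀ u, |convFun Λ ψ u| ≤ ∫ x in Λ, G 0 x := by
      intro u
      rw [← hGu u, convFun]
      exact norm_integral_le_of_norm_le (f := shiftedProduct ψ u) (hGi u) (hbound u)
    rcases Nat.eq_zero_or_pos (n - 1) with h0 | h0
    · rw [h0, Nat.cast_zero, memLp_zero_iff_aestronglyMeasurable]
      exact hφ.aestronglyMeasurable
    · have h1 : ((n - 1 : ℕ) : ℝ≥0∞) ≠ 0 := by exact_mod_cast h0.ne'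
      rw [← integrable_norm_rpow_iff hφ.aestronglyMeasurable h1 (by simp), ENNReal.toReal_natCast]
      -- `φ` is bounded and integrable, hence in every `Lᵖ` with `p ≥ 1`.
      refine (hφ.norm.const_mul ((∫ x in Λ, G 0 x) ^ (n - 1 - 1))).mono' ?_
        (Eventually.of_forall fun u => ?_)
      · simp_rw [Real.rpow_natCast]
        exact hφ.aestronglyMeasurable.norm.pow _
      · rw [Real.rpow_natCast, norm_pow, norm_norm]
        calc ‖convFun Λ ψ u‖ ^ (n - 1) = ‖convFun Λ ψ u‖ ^ (n - 1 - 1) * ‖convFun Λ ψ u‖ := by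
              rw [← pow_succ, Nat.sub_add_cancel h0]
          _ ≤ _ := by
              gcongr
              exact hB u
  · refine Tendsto.mono_left ?_ nhdsWithin_le_nhds
    have hj : ∀ j : Fin n, Tendsto (fun u : Fin n → ℝ => u j) (𝓝 0) (𝓝 0) := fun j =>
      (continuous_apply j).tendsto 0
    refine tendsto_integral_of_tendsto_bound (f := shiftedProduct ψ) (G := G) (G₀ := G 0)
      (S := fun u x => ∑ j : Fin n, |ψ j.succ (x - u j) - ψ j.succ x|) hm hGi (hGi 0) (fun u => ?_)
      hbound (hbound 0) ?_ ?_ ?_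
    · exact integrable_finsetSum _ fun j _ =>
        ((hΛ.integrableOn_comp_sub (hper j.succ) (hψ j.succ) (u j)).sub (hψ j.succ)).abs
    · have hdi : ∀ (u : Fin n → ℝ) (j : Fin n), IntegrableOn
          (fun x => w j.succ * |z j.succ (x - u j) - z j.succ x|) Λ := fun u j =>
        (((hΛ.integrableOn_comp_sub (hzper j.succ) (hzi j.succ) (u j)).sub
          (hzi j.succ)).abs).const_mul _
      have h1 : Tendsto (fun u : Fin n → ℝ => (∏ i, M i) * ∑ j : Fin n,
          w j.succ * ∫ x in Λ, |z j.succ (x - u j) - z j.succ x|) (𝓝 0) (𝓝 0) := by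
        have h2 := (tendsto_finsetSum Finset.univ fun (j : Fin n) _ =>
          ((hΛ.tendsto_shift _ (hzper j.succ) (hzi j.succ)).comp (hj j)).const_mul
            (w j.succ)).const_mul (∏ i, M i)
        simpa [Function.comp_def] using h2
      refine squeeze_zero (fun u => integral_nonneg fun x => abs_nonneg _) (fun u => ?_) h1
      simp_rw [← integral_const_mul (w _)]
      rw [← integral_finsetSum _ fun j _ => hdi u j, ← integral_const_mul]
      refine integral_mono_ae ((hGi u).sub (hGi 0)).abs
        ((integrable_finsetSum _ fun j _ => hdi u j).const_mul _) (Eventually.of_forall fun x => ?_)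
      simp only [hG, Pi.zero_apply, sub_zero]
      rw [← mul_sub, add_sub_add_left_eq_sub, ← Finset.sum_sub_distrib, abs_mul,
        abs_of_nonneg (Finset.prod_nonneg fun i _ => hM i)]
      refine mul_le_mul_of_nonneg_left ?_ (Finset.prod_nonneg fun i _ => hM i)
      refine (Finset.abs_sum_le_sum_abs _ _).trans_eq (Finset.sum_congr rfl fun j _ => ?_)
      rw [← mul_sub, abs_mul, abs_of_nonneg (hw _)]
    · have h2 := tendsto_finsetSum Finset.univ fun (j : Fin n) _ =>
        (hΛ.tendsto_shift _ (hper j.succ) (hψ j.succ)).comp (hj j)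
      simp only [Finset.sum_const_zero] at h2
      refine h2.congr fun u => ?_
      have h3 : ∀ j : Fin n, IntegrableOn (fun x => |ψ j.succ (x - u j) - ψ j.succ x|) Λ := fun j =>
        ((hΛ.integrableOn_comp_sub (hper j.succ) (hψ j.succ) (u j)).sub (hψ j.succ)).abs
      refine (integral_finsetSum _ fun j _ => h3 j).symm.trans ?_
      refine integral_congr_ae (Eventually.of_forall fun x => ?_)
      exact (abs_of_nonneg (Finset.sum_nonneg fun j _ => abs_nonneg _)).symm
    · intro ns x hx
      simp only [shiftedProduct, Pi.zero_apply, sub_zero]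
      refine tendsto_const_nhds.mul (tendsto_finsetProd _ fun j _ => ?_)
      rw [tendsto_iff_norm_sub_tendsto_zero]
      refine squeeze_zero (fun m => norm_nonneg _) (fun m => ?_) hx
      exact Finset.single_le_sum (f := fun j : Fin n => |ψ j.succ (x - ns m j) - ψ j.succ x|)
        (fun j _ => abs_nonneg _) (Finset.mem_univ j)

theorem convolutionCondition_of_holderCondition {n : ℕ} {ψ : Fin (n + 1) → ℝ → ℝ}
    (hper : ∀ i, Function.Periodic (ψ i) τ) (hψ : ∀ i, IntegrableOn (ψ i) Λ)
    (h : HolderCondition Λ ψ) : ConvolutionCondition Λ ψ := by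
  obtain ⟨p, hp, hsum⟩ := h
  obtain ⟨w, hw, hw1⟩ := exists_weights (fun i => (hp i).1) hsum
  choose z M hz hzper hzi hM hle using fun i => exists_le_mul_rpow (hper i) (hψ i) (hp i).1.le
    (hp i).2 (hw i).1 (hw i).2
  exact hΛ.convolutionCondition_of_le hper hψ hz hzper hzi hM
    (fun i => ENNReal.toReal_nonneg.trans (hw i).1) hw1 hle

end IsFreqDomain

/-! ### Bounds for the kernels -/

/-- Adding the first bound to `T` times the second gives `‖k‖ (1 + T‖u‖) ≤ (A + B) T`. It reduces
kernel estimates to a trivial bound and a decay bound. -/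
theorem enorm_le_majorant {k : ℂ} {τ T u A B : ℝ} (hT : 0 < T) (hA : ‖k‖ ≤ A * T)
    (hB : ‖k‖ * ‖(u : AddCircle τ)‖ ≤ B) : ‖k‖ₑ ≤ ENNReal.ofReal (A + B) * majorant τ T u := by
  have hA0 : 0 ≤ A := by
    by_contra h
    have := mul_neg_of_neg_of_pos (not_le.1 h) hT
    linarith [norm_nonneg k]
  have hB0 : 0 ≤ B := (by positivity : 0 ≤ ‖k‖ * ‖(u : AddCircle τ)‖).trans hB
  rw [majorant, ← ENNReal.ofReal_mul (by positivity), ← ofReal_norm]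
  refine ENNReal.ofReal_le_ofReal ?_
  rw [mul_div_assoc', le_div_iff₀ (by positivity)]
  nlinarith [mul_le_mul_of_nonneg_left hB hT.le]

theorem sum_abs_sub_le {g : ℝ → ℝ} (hg : BoundedVariationOn g univ) {x : ℕ → ℝ} (hx : Monotone x)
    (N : ℕ) : ∑ s ∈ Finset.range N, |g (x (s + 1)) - g (x s)| ≤ (eVariationOn g univ).toReal := by
  have h1 := eVariationOn.sum_le (f := g) (s := univ) (n := N) hx fun _ => mem_univ _
  have h2 := ENNReal.toReal_mono hg h1
  rw [ENNReal.toReal_sum fun s _ => edist_ne_top _ _] at h2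
  simpa [edist_dist, Real.dist_eq] using h2

/-- Summation by parts: two boundary terms of size `H` and the total variation of the coefficients.
-/
theorem norm_mul_sum_mul_pow_le {a : ℕ → ℝ} {z : ℂ} (hz : ‖z‖ = 1) {H V : ℝ}
    (hH : ∀ s, |a s| ≤ H) {N : ℕ} (hV : ∑ s ∈ Finset.range N, |a (s + 1) - a s| ≤ V) :
    ‖z - 1‖ * ‖∑ s ∈ Finset.range N, (a s : ℂ) * z ^ s‖ ≤ 2 * H + V := by
  have key : (z - 1) * ∑ s ∈ Finset.range N, (a s : ℂ) * z ^ s =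
      a N * z ^ N - a 0 - ∑ s ∈ Finset.range N, ((a (s + 1) - a s : ℝ) : ℂ) * z ^ (s + 1) := by
    clear hV
    induction N with
    | zero => simp
    | succ N ih =>
      rw [Finset.sum_range_succ, mul_add, ih, Finset.sum_range_succ]
      push_cast
      ring
  rw [← norm_mul, key]
  have h1 : ‖∑ s ∈ Finset.range N, ((a (s + 1) - a s : ℝ) : ℂ) * z ^ (s + 1)‖ ≤ V := by
    refine (norm_sum_le _ _).trans (le_of_eq_of_le (Finset.sum_congr rfl fun s _ => ?_) hV)
    rw [norm_mul, norm_pow, hz, one_pow, mul_one, Complex.norm_real, Real.norm_eq_abs]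
  have h2 : ‖(a N : ℂ) * z ^ N‖ ≤ H := by
    rw [norm_mul, norm_pow, hz, one_pow, mul_one, Complex.norm_real]
    exact hH N
  have h3 : ‖(a 0 : ℂ)‖ ≤ H := by
    rw [Complex.norm_real]
    exact hH 0
  calc _ ≤ ‖(a N : ℂ) * z ^ N‖ + ‖(a 0 : ℂ)‖ +
        ‖∑ s ∈ Finset.range N, ((a (s + 1) - a s : ℝ) : ℂ) * z ^ (s + 1)‖ :=
        (norm_sub_le _ _).trans (add_le_add_left (norm_sub_le _ _) _)
    _ ≤ _ := by linarith

/-- With `v` the representative of `u` in `(-π, π]`, the chord has length `2 |sin (v/2)|`, which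
Jordan's inequality bounds below by `2|v|/π`. -/
theorem norm_coe_le_norm_exp_sub_one (u : ℝ) :
    ‖(u : AddCircle (2 * Real.pi))‖ ≤ Real.pi / 2 * ‖Complex.exp (-Complex.I * u) - 1‖ := by
  set v := toIocMod Real.two_pi_pos (-Real.pi) u with hv
  obtain ⟨k, hk⟩ := isFreqDomain_freqDT.red_eq u
  rw [← hv] at hk
  have hmem := toIocMod_mem_Ioc Real.two_pi_pos (-Real.pi) u
  rw [← hv] at hmem
  have habs : |v| ≤ Real.pi := abs_le.2 ⟨hmem.1.le, by linarith [hmem.2]⟩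
  have h1 : ‖(u : AddCircle (2 * Real.pi))‖ = |v| := by
    rw [← (AddCircle.norm_coe_eq_abs_iff (2 * Real.pi) Real.two_pi_pos.ne').2
      (by rw [abs_of_pos Real.two_pi_pos]; linarith)]
    exact (periodic_eq_of_exists (f := fun x : ℝ => ‖(x : AddCircle (2 * Real.pi))‖)
      (fun x => by simp) ⟨k, hk⟩).symm
  have h2 : Complex.exp (-Complex.I * u) = Complex.exp (Complex.I * (-v : ℝ)) := by
    rw [Complex.exp_eq_exp_iff_exists_int]
    exact ⟨k, by rw [hk]; push_cast; ring⟩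
  have h3 := Real.mul_abs_le_abs_sin (x := -v / 2) (by
    rw [abs_div, abs_neg, abs_two]
    linarith)
  have hpi := Real.pi_pos
  rw [h1, h2, Complex.norm_exp_I_mul_ofReal_sub_one, norm_mul, Real.norm_two, Real.norm_eq_abs]
  rw [abs_div, abs_neg, abs_two] at h3
  calc |v| = Real.pi / 2 * (2 * (2 / Real.pi * (|v| / 2))) := by field_simp
    _ ≤ _ := by gcongr

/-- The kernel of a weighted Toeplitz matrix. -/
def kernelDT {T : ℕ} (w : Fin T → ℝ) (u : ℝ) : ℂ :=
  ∑ s : Fin T, (w s : ℂ) * Complex.exp (-Complex.I * u * (s : ℕ))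

theorem measurable_kernelDT {T : ℕ} (w : Fin T → ℝ) : Measurable (kernelDT w) := by
  unfold kernelDT
  fun_prop

theorem norm_exp_neg_I (u : ℝ) (s : ℕ) : ‖Complex.exp (-Complex.I * u * s)‖ = 1 := by
  rw [show -Complex.I * u * s = ((-(u * s) : ℝ) : ℂ) * Complex.I by push_cast; ring,
    Complex.norm_exp_ofReal_mul_I]

theorem norm_kernelDT_le {T : ℕ} {w : Fin T → ℝ} {H : ℝ} (hw : ∀ s, |w s| ≤ H) (u : ℝ) :
    ‖kernelDT w u‖ ≤ H * T := by
  refine (norm_sum_le _ _).trans ?_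
  refine (Finset.sum_le_sum (g := fun _ => H) fun s _ => ?_).trans_eq (by simp [mul_comm])
  rw [norm_mul, norm_exp_neg_I, mul_one, Complex.norm_real]
  exact hw s

theorem periodic_kernelDT {T : ℕ} (w : Fin T → ℝ) :
    Function.Periodic (kernelDT w) (2 * Real.pi) := by
  intro u
  refine Finset.sum_congr rfl fun s _ => ?_
  congr 1
  rw [Complex.exp_eq_exp_iff_exists_int]
  exact ⟨-(s : ℕ), by push_cast; ring⟩

theorem enorm_kernelDT_le {g : ℝ → ℝ} {H : ℝ} (hH : ∀ t, |g t| ≤ H)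
    (hg : BoundedVariationOn g univ) {T : ℕ} (hT : 0 < T) (u : ℝ) :
    ‖kernelDT (fun s : Fin T => g (((s : ℝ) + 1) / T)) u‖ₑ ≤
      ENNReal.ofReal (H + Real.pi / 2 * (2 * H + (eVariationOn g univ).toReal)) *
        majorant (2 * Real.pi) T u := by
  have hT' : (0 : ℝ) < T := by exact_mod_cast hT
  refine enorm_le_majorant hT' (norm_kernelDT_le (fun s => hH _) u) ?_
  have h1 : kernelDT (fun s : Fin T => g (((s : ℝ) + 1) / T)) u =
      ∑ s ∈ Finset.range T, ((g (((s : ℝ) + 1) / T) : ℝ) : ℂ) *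
        Complex.exp (-Complex.I * u) ^ s := by
    rw [kernelDT, Finset.sum_range]
    refine Finset.sum_congr rfl fun s _ => ?_
    rw [← Complex.exp_nat_mul]
    congr 2
    ring
  have hmono : Monotone fun s : ℕ => ((s : ℝ) + 1) / T := fun a b hab => by
    have : (a : ℝ) ≤ b := by exact_mod_cast hab
    simp only
    gcongr
  have h2 := norm_mul_sum_mul_pow_le (a := fun s => g (((s : ℝ) + 1) / T))
    (z := Complex.exp (-Complex.I * u)) (by simpa using norm_exp_neg_I u 1) (fun s => hH _)
    (N := T) (sum_abs_sub_le hg hmono T)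
  rw [← h1] at h2
  calc _ ≤ ‖kernelDT (fun s : Fin T => g (((s : ℝ) + 1) / T)) u‖ *
        (Real.pi / 2 * ‖Complex.exp (-Complex.I * u) - 1‖) := by
        gcongr
        exact norm_coe_le_norm_exp_sub_one u
    _ = Real.pi / 2 * (‖Complex.exp (-Complex.I * u) - 1‖ *
        ‖kernelDT (fun s : Fin T => g (((s : ℝ) + 1) / T)) u‖) := by ring
    _ ≤ _ := by
        have := Real.pi_pos
        gcongr

/-! ### Traces of products of Toeplitz matrices -/

/-- The matrix `(ψ̂(t - s) w_s)`. -/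
def weightedToeplitz {T : ℕ} (w : Fin T → ℝ) (ψ : ℝ → ℝ) : Matrix (Fin T) (Fin T) ℂ :=
  Matrix.of fun t s => fourierHat freqDT ψ ((t : ℝ) - (s : ℝ)) * (w s : ℂ)

/-- The functional `v ↦ ∑ w_s e^{-ixs} v_s`. -/
def waveFunctional {T : ℕ} (w : Fin T → ℝ) (x : ℝ) (v : Fin T → ℂ) : ℂ :=
  ∑ s : Fin T, (w s : ℂ) * Complex.exp (-Complex.I * x * (s : ℕ)) * v s

/-- The vector `(e^{ixt})`. -/
def waveVector (T : ℕ) (x : ℝ) (t : Fin T) : ℂ := Complex.exp (Complex.I * x * (t : ℕ))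

theorem waveFunctional_waveVector {T : ℕ} (w : Fin T → ℝ) (a b : ℝ) :
    waveFunctional w a (waveVector T b) = kernelDT w (a - b) := by
  refine Finset.sum_congr rfl fun s _ => ?_
  rw [waveVector, mul_assoc, ← Complex.exp_add]
  congr 2
  push_cast
  ring

theorem integrableOn_exp_mul {ψ : ℝ → ℝ} (hψ : IntegrableOn ψ freqDT) (t s : ℕ) (c : ℂ) :
    IntegrableOn (fun x : ℝ => (ψ x : ℂ) * (Complex.exp (Complex.I * x * t) *
      Complex.exp (-Complex.I * x * s) * c)) freqDT := by
  refine hψ.ofReal.mul_bdd (c := ‖c‖) (by fun_prop) (Eventually.of_forall fun x => ?_)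
  have h1 : ‖Complex.exp (Complex.I * x * t)‖ = 1 := by
    simpa using norm_exp_neg_I (-x) t
  rw [norm_mul, norm_mul, h1, norm_exp_neg_I, one_mul, one_mul]

theorem fourierHat_sub_mul (ψ : ℝ → ℝ) (t s : ℕ) (c : ℂ) :
    fourierHat freqDT ψ ((t : ℝ) - s) * c = ∫ x in freqDT, (ψ x : ℂ) *
      (Complex.exp (Complex.I * x * t) * Complex.exp (-Complex.I * x * s) * c) := by
  rw [fourierHat, ← integral_mul_const]
  refine integral_congr_ae (Eventually.of_forall fun x => ?_)
  simp only
  rw [← Complex.exp_add, mul_comm (Complex.exp _), mul_assoc]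
  congr 3
  push_cast
  ring

/-- Inserting the integral for `ψ̂` exhibits the matrix as `∫ ψ(y) waveVector y ⊗ waveFunctional y
dy`. Indices start at `0` rather than `1`, which is harmless because only differences `t - s` enter
the phases. -/
theorem waveFunctional_weightedToeplitz_mulVec {T : ℕ} (w : Fin T → ℝ) {ψ : ℝ → ℝ}
    (hψ : IntegrableOn ψ freqDT) (a : ℝ) (v : Fin T → ℂ) :
    waveFunctional w a ((weightedToeplitz w ψ).mulVec v) =
      ∫ y in freqDT, (ψ y : ℂ) * kernelDT w (a - y) * waveFunctional w y v := by
  have hi : ∀ (c : ℂ) (t s : Fin T), IntegrableOn (fun x : ℝ => c * ((ψ x : ℂ) *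
      (Complex.exp (Complex.I * x * (t : ℕ)) * Complex.exp (-Complex.I * x * (s : ℕ)) *
        (w s * v s)))) freqDT := fun c t s => (integrableOn_exp_mul hψ t s _).const_mul c
  simp only [waveFunctional, Matrix.mulVec, dotProduct, weightedToeplitz, Matrix.of_apply]
  simp_rw [mul_assoc (fourierHat _ _ _), fourierHat_sub_mul, Finset.mul_sum, ← integral_const_mul]
  rw [Finset.sum_congr rfl fun t _ => (integral_finsetSum _ fun s _ => hi _ t s).symm,
    ← integral_finsetSum _ fun t _ => integrable_finsetSum _ fun s _ => hi _ t s]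
  refine integral_congr_ae (Eventually.of_forall fun y => ?_)
  simp only [kernelDT]
  rw [Finset.sum_comm]
  refine Finset.sum_congr rfl fun s _ => ?_
  rw [Finset.mul_sum, Finset.sum_mul]
  refine Finset.sum_congr rfl fun t _ => ?_
  have : Complex.exp (-Complex.I * ((a - y : ℝ) : ℂ) * (t : ℕ)) =
      Complex.exp (-Complex.I * a * (t : ℕ)) * Complex.exp (Complex.I * y * (t : ℕ)) := by
    rw [← Complex.exp_add]
    congr 1
    push_cast
    ring
  rw [this]
  ring

theorem trace_weightedToeplitz_mul {T : ℕ} (w : Fin T → ℝ) {ψ : ℝ → ℝ}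
    (hψ : IntegrableOn ψ freqDT) (C : Matrix (Fin T) (Fin T) ℂ) :
    (weightedToeplitz w ψ * C).trace =
      ∫ x in freqDT, (ψ x : ℂ) * waveFunctional w x (C.mulVec (waveVector T x)) := by
  have hi : ∀ t s : Fin T, IntegrableOn (fun x : ℝ => (ψ x : ℂ) *
      (Complex.exp (Complex.I * x * (t : ℕ)) * Complex.exp (-Complex.I * x * (s : ℕ)) *
        (w s * C s t))) freqDT := fun t s => integrableOn_exp_mul hψ t s _
  simp only [Matrix.trace, Matrix.diag_apply, Matrix.mul_apply, weightedToeplitz, Matrix.of_apply]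
  simp_rw [mul_assoc (fourierHat _ _ _), fourierHat_sub_mul]
  rw [Finset.sum_congr rfl fun t _ => (integral_finsetSum _ fun s _ => hi t s).symm,
    ← integral_finsetSum _ fun t _ => integrable_finsetSum _ fun s _ => hi t s]
  refine integral_congr_ae (Eventually.of_forall fun x => ?_)
  simp only [waveFunctional, waveVector, Matrix.mulVec, dotProduct]
  rw [Finset.sum_comm, Finset.mul_sum]
  refine Finset.sum_congr rfl fun s _ => ?_
  rw [Finset.mul_sum, Finset.mul_sum]
  refine Finset.sum_congr rfl fun t _ => ?_
  ring

theorem waveFunctional_prod_mulVec {T : ℕ} (w : Fin T → ℝ) {n : ℕ} {ψ : Fin n → ℝ → ℝ}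
    (hψ : ∀ i, IntegrableOn (ψ i) freqDT) (a b : ℝ) :
    waveFunctional w a ((List.ofFn fun i => weightedToeplitz w (ψ i)).prod.mulVec
      (waveVector T b)) = pathIntegral freqDT (kernelDT w) ψ a b := by
  induction n generalizing a with
  | zero => simp [waveFunctional_waveVector, pathIntegral_zero]
  | succ n ih =>
    obtain ⟨H, hH⟩ := (Set.finite_range fun s => |w s|).bddAbove
    rw [List.ofFn_succ, List.prod_cons, ← Matrix.mulVec_mulVec,
      waveFunctional_weightedToeplitz_mulVec w (hψ 0),
      pathIntegral_succ (measurable_kernelDT w) (norm_kernelDT_le fun s => hH ⟨s, rfl⟩) hψ]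
    simp_rw [ih fun i => hψ i.succ]

theorem trace_prod_weightedToeplitz {T : ℕ} (w : Fin T → ℝ) {n : ℕ} {ψ : Fin (n + 1) → ℝ → ℝ}
    (hψ : ∀ i, IntegrableOn (ψ i) freqDT) :
    (List.ofFn fun i => weightedToeplitz w (ψ i)).prod.trace =
      ∫ x in freqDT, (ψ 0 x : ℂ) * pathIntegral freqDT (kernelDT w) (fun i => ψ i.succ) x x := by
  rw [List.ofFn_succ, List.prod_cons, trace_weightedToeplitz_mul w (hψ 0)]
  simp_rw [waveFunctional_prod_mulVec w fun i => hψ i.succ]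

theorem fourierHat_one (t s : ℕ) :
    fourierHat freqDT 1 ((t : ℝ) - s) = (if t = s then 2 * Real.pi else 0 : ℂ) := by
  have hpi := Real.pi_pos
  rw [fourierHat, freqDT, integral_Icc_eq_integral_Ioc,
    ← intervalIntegral.integral_of_le (by linarith)]
  simp only [Pi.one_apply, Complex.ofReal_one, mul_one]
  split_ifs with h
  · subst h
    simp
    ring
  · have hc : Complex.I * ((t : ℂ) - s) ≠ 0 := by
      refine mul_ne_zero Complex.I_ne_zero (sub_ne_zero.2 ?_)
      exact_mod_cast h
    have h1 : ∀ x : ℝ, Complex.exp (Complex.I * x * ((((t : ℝ) - s : ℝ)) : ℂ)) =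
        Complex.exp (Complex.I * ((t : ℂ) - s) * x) := fun x => by
      congr 1
      push_cast
      ring
    simp_rw [h1]
    rw [integral_exp_mul_complex hc, div_eq_zero_iff, sub_eq_zero]
    left
    rw [Complex.exp_eq_exp_iff_exists_int]
    exact ⟨t - s, by push_cast; ring⟩

theorem weightedToeplitz_one {T : ℕ} (w : Fin T → ℝ) :
    weightedToeplitz w 1 = Matrix.diagonal fun s => 2 * Real.pi * (w s : ℂ) := by
  ext t s
  rw [weightedToeplitz, Matrix.of_apply, fourierHat_one, Matrix.diagonal_apply]
  by_cases h : t = s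
  · subst h
    simp
  · rw [if_neg (by simpa [Fin.ext_iff] using h), if_neg h, zero_mul]

/-- The trace formula is applied backwards with all `ψᵢ = 1`: the matrices become `2π diag(w)` and
`φ` is the constant `2π`, so the mass of the kernel can be solved for. -/
theorem integral_prod_kernelDT {T : ℕ} (w : Fin T → ℝ) (n : ℕ) :
    ∫ u : Fin n → ℝ, ∏ j, kernelDT w (-steps 0 0 u j) ∂(Measure.pi fun _ => volume.restrict freqDT) =
      (2 * Real.pi) ^ n * ∑ s, (w s : ℂ) ^ (n + 1) := by
  have hpi : (2 * Real.pi : ℂ) ≠ 0 := by exact_mod_cast Real.two_pi_pos.ne'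
  obtain ⟨H, hH⟩ := (Set.finite_range fun s => |w s|).bddAbove
  have h1 : ∀ i : Fin (n + 1), IntegrableOn ((fun _ => 1 : Fin (n + 1) → ℝ → ℝ) i) freqDT :=
    fun i => integrableOn_const (by simp [freqDT]) (by simp)
  have h2 := trace_prod_weightedToeplitz w h1
  rw [isFreqDomain_freqDT.integral_mul_pathIntegral (measurable_kernelDT w)
    (norm_kernelDT_le fun s => hH ⟨s, rfl⟩) (periodic_kernelDT w) (fun i x => rfl) h1] at h2
  have h3 : ∀ u : Fin n → ℝ, convFun freqDT (fun _ => 1 : Fin (n + 1) → ℝ → ℝ) u = 2 * Real.pi := by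
    intro u
    have : Real.pi + Real.pi = 2 * Real.pi := by ring
    simp [convFun, shiftedProduct, freqDT, Real.pi_pos.le, this]
  simp_rw [h3] at h2
  rw [integral_const_mul, weightedToeplitz_one, List.ofFn_const, List.prod_replicate,
    Matrix.diagonal_pow, Matrix.trace_diagonal] at h2
  simp only [Pi.pow_apply, mul_pow, ← Finset.mul_sum] at h2
  refine mul_left_cancel₀ hpi ?_
  push_cast at h2
  rw [← h2]
  ring

/-! ### Limits in discrete time -/

theorem tendsto_riemann_sum {f : ℝ → ℝ} (hf : ContinuousOn f (Icc 0 1)) :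
    Tendsto (fun T : ℕ => (1 / (T : ℝ)) * ∑ s : Fin T, f (((s : ℝ) + 1) / T)) atTop
      (𝓝 (∫ x in (0 : ℝ)..1, f x)) := by
  have huc := isCompact_Icc.uniformContinuousOn_of_continuous hf
  rw [Metric.uniformContinuousOn_iff] at huc
  rw [Metric.tendsto_atTop]
  intro ε hε
  obtain ⟨δ, hδ, hδ2⟩ := huc (ε / 2) (by positivity)
  obtain ⟨N, hN⟩ := exists_nat_gt (1 / δ)
  refine ⟨max N 1, fun T hT => ?_⟩
  have hT0 : (0 : ℝ) < T := by
    have : 1 ≤ T := (le_max_right _ _).trans hT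
    exact_mod_cast this
  have hTδ : 1 / (T : ℝ) < δ := by
    have h1 : (N : ℝ) ≤ T := by exact_mod_cast (le_max_left _ _).trans hT
    rw [div_lt_iff₀ hT0, mul_comm, ← div_lt_iff₀ hδ]
    exact hN.trans_le h1
  have hsub : ∀ s < T, Icc ((s : ℝ) / T) (((s : ℝ) + 1) / T) ⊆ Icc 0 1 := by
    intro s hs
    have h1 : (s : ℝ) + 1 ≤ T := by exact_mod_cast hs
    exact Icc_subset_Icc (by positivity) ((div_le_one hT0).2 h1)
  have hle : ∀ s : ℕ, (s : ℝ) / T ≤ ((s : ℝ) + 1) / T := fun s => by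
    gcongr
    linarith
  have hint : ∀ s < T, IntervalIntegrable f volume ((s : ℝ) / T) ((((s + 1 : ℕ)) : ℝ) / T) := by
    intro s hs
    push_cast
    refine ContinuousOn.intervalIntegrable ?_
    rw [uIcc_of_le (hle s)]
    exact hf.mono (hsub s hs)
  have hsum := intervalIntegral.sum_integral_adjacent_intervals (a := fun s : ℕ => (s : ℝ) / T) hint
  simp only [Nat.cast_zero, zero_div, div_self hT0.ne'] at hsum
  rw [← hsum, ← Finset.sum_range fun s => f (((s : ℝ) + 1) / T), Finset.mul_sum, dist_eq_norm,
    ← Finset.sum_sub_distrib]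
  have hterm : ∀ s ∈ Finset.range T, ‖1 / (T : ℝ) * f (((s : ℝ) + 1) / T) -
      ∫ x in ((s : ℝ) / T)..(((s + 1 : ℕ) : ℝ) / T), f x‖ ≤ ε / 2 * (1 / T) := by
    intro s hs
    rw [Finset.mem_range] at hs
    have hint' := hint s hs
    push_cast at hint' ⊢
    have hlen : ((s : ℝ) + 1) / T - s / T = 1 / T := by ring
    have h1 : 1 / (T : ℝ) * f (((s : ℝ) + 1) / T) =
        ∫ _x in ((s : ℝ) / T)..(((s : ℝ) + 1) / T), f (((s : ℝ) + 1) / T) := by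
      rw [intervalIntegral.integral_const, hlen, smul_eq_mul]
    rw [h1, ← intervalIntegral.integral_sub intervalIntegrable_const hint']
    have h2 := intervalIntegral.norm_integral_le_of_norm_le_const (a := (s : ℝ) / T)
      (b := ((s : ℝ) + 1) / T) (C := ε / 2) (f := fun x => f (((s : ℝ) + 1) / T) - f x) ?_
    · rwa [hlen, abs_of_nonneg (by positivity)] at h2
    · intro x hx
      rw [uIoc_of_le (hle s)] at hx
      have hx' : x ∈ Icc ((s : ℝ) / T) (((s : ℝ) + 1) / T) := Ioc_subset_Icc_self hx
      refine (hδ2 _ (hsub s hs (right_mem_Icc.2 (hle s))) x (hsub s hs hx') ?_).le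
      rw [Real.dist_eq, abs_of_nonneg (by linarith [hx.2])]
      linarith [hx.1]
  calc _ ≤ ∑ s ∈ Finset.range T, ε / 2 * (1 / (T : ℝ)) := norm_sum_le_of_le _ hterm
    _ = ε / 2 := by
        rw [Finset.sum_const, Finset.card_range, nsmul_eq_mul]
        field_simp
    _ < ε := by linarith

/-- Stated for a general window `g` because it is used both for `h` and for `h²`. -/
theorem tendsto_trace_toeplitz {g : ℝ → ℝ} (hgc : ContinuousOn g (Icc 0 1)) {H : ℝ}
    (hH : ∀ t, |g t| ≤ H) (hg : BoundedVariationOn g univ) {n : ℕ} {ψ : Fin (n + 1) → ℝ → ℝ}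
    (hper : ∀ i, Function.Periodic (ψ i) (2 * Real.pi)) (hψ : ∀ i, IntegrableOn (ψ i) freqDT)
    (hconv : ConvolutionCondition freqDT ψ) :
    Tendsto (fun T : ℕ => (1 / (T : ℂ)) * (List.ofFn fun i => toeplitz g (ψ i) T).prod.trace) atTop
      (𝓝 (((2 * Real.pi) ^ n * moment g (n + 1) * ∫ x in freqDT, ∏ i, ψ i x : ℝ) : ℂ)) := by
  have hmass : Tendsto (fun T : ℕ => (1 / (((T : ℕ) : ℝ) : ℂ)) * ∫ u : Fin n → ℝ,
      ∏ j, kernelDT (fun s : Fin T => g (((s : ℝ) + 1) / T)) (-steps 0 0 u j)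
        ∂(Measure.pi fun _ => volume.restrict freqDT)) atTop
      (𝓝 (((2 * Real.pi) ^ n * moment g (n + 1) : ℝ) : ℂ)) := by
    have h1 := ((tendsto_riemann_sum (f := fun x => g x ^ (n + 1)) (hgc.pow (n + 1))).const_mul ((2 * Real.pi) ^ n))
    have h2 := (Complex.continuous_ofReal.tendsto _).comp h1
    refine h2.congr fun T => ?_
    rw [integral_prod_kernelDT]
    simp only [Function.comp]
    push_cast
    ring
  have key := isFreqDomain_freqDT.tendsto_integral_mul_pathIntegral hper hψ hconv
    tendsto_natCast_atTop_atTop (k := fun T : ℕ => kernelDT fun s : Fin T => g (((s : ℝ) + 1) / T))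
    (fun T => measurable_kernelDT _) (fun T => periodic_kernelDT _) ENNReal.ofReal_ne_top
    (fun T hT => enorm_kernelDT_le hH hg (by exact_mod_cast hT)) hmass
  rw [Complex.ofReal_mul]
  refine key.congr fun T => ?_
  rw [← trace_prod_weightedToeplitz _ hψ]
  rfl

theorem prod_ofFn_mul_comm {M : Type*} [Monoid M] {n : ℕ} (d : M) (a : Fin n → M) :
    (List.ofFn fun i => d * a i).prod * d = d * (List.ofFn fun i => a i * d).prod := by
  induction n with
  | zero => simp
  | succ n ih =>
    rw [List.ofFn_succ, List.ofFn_succ, List.prod_cons, List.prod_cons, mul_assoc, ih]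
    simp only [mul_assoc]

/-- With `d = diag(h_T)`, the two-sided matrix is `d A` and the one-sided matrix with taper `h²` is
`A d`; the two products are cyclic rotations of each other. -/
theorem trace_prod_toeplitzTwoSided (h : ℝ → ℝ) {n : ℕ} (ψ : Fin (n + 1) → ℝ → ℝ) (T : ℕ) :
    (List.ofFn fun i => toeplitzTwoSided h (ψ i) T).prod.trace =
      (List.ofFn fun i => toeplitz (fun t => h t ^ 2) (ψ i) T).prod.trace := by
  set d : Matrix (Fin T) (Fin T) ℂ := Matrix.diagonal fun s => (h (((s : ℝ) + 1) / T) : ℂ) with hd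
  have h1 : ∀ i, toeplitzTwoSided h (ψ i) T = d * toeplitz h (ψ i) T := fun i => by
    ext t s
    rw [hd, Matrix.diagonal_mul, toeplitzTwoSided, toeplitz, Matrix.of_apply, Matrix.of_apply]
    ring
  have h2 : ∀ i, toeplitz (fun t => h t ^ 2) (ψ i) T = toeplitz h (ψ i) T * d := fun i => by
    ext t s
    rw [hd, Matrix.mul_diagonal, toeplitz, toeplitz, Matrix.of_apply, Matrix.of_apply]
    push_cast
    ring
  simp_rw [h1, h2]
  rw [List.ofFn_succ, List.ofFn_succ, List.prod_cons, List.prod_cons, mul_assoc,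
    Matrix.trace_mul_comm, mul_assoc, prod_ofFn_mul_comm, mul_assoc]

theorem IsTaper.exists_abs_bound {h : ℝ → ℝ} (hh : IsTaper h) : ∃ C, 0 ≤ C ∧ ∀ t, |h t| ≤ C := by
  obtain ⟨C, hC⟩ := hh.exists_bound
  exact ⟨C, (hh.nonneg 0).trans (hC 0), fun t => (abs_of_nonneg (hh.nonneg t)).trans_le (hC t)⟩

theorem IsTaper.boundedVariationOn_sq {h : ℝ → ℝ} (hh : IsTaper h) :
    BoundedVariationOn (fun t => h t ^ 2) univ := by
  have h1 : (fun t => h t ^ 2) = h * h := funext fun t => sq (h t)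
  rw [h1]
  exact hh.boundedVariation.mul hh.boundedVariation

theorem tendsto_trace_toeplitzTwoSided {h : ℝ → ℝ} (hh : IsTaper h) {n : ℕ}
    {ψ : Fin (n + 1) → ℝ → ℝ} (hper : ∀ i, Function.Periodic (ψ i) (2 * Real.pi))
    (hψ : ∀ i, IntegrableOn (ψ i) freqDT) (hconv : ConvolutionCondition freqDT ψ) :
    Tendsto (fun T : ℕ => (1 / (T : ℂ)) *
        (List.ofFn fun i => toeplitzTwoSided h (ψ i) T).prod.trace) atTop
      (𝓝 (((2 * Real.pi) ^ n * moment h (2 * (n + 1)) * ∫ x in freqDT, ∏ i, ψ i x : ℝ) : ℂ)) := by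
  obtain ⟨C, hC0, hC⟩ := hh.exists_abs_bound
  have key := tendsto_trace_toeplitz (g := fun t => h t ^ 2) (hh.continuousOn.pow 2) (H := C ^ 2)
    (fun t => by rw [abs_pow]; gcongr; exact hC t) hh.boundedVariationOn_sq hper hψ hconv
  have hm : moment (fun t => h t ^ 2) (n + 1) = moment h (2 * (n + 1)) := by
    simp only [moment, pow_mul]
  rw [hm] at key
  exact key.congr fun T => by rw [trace_prod_toeplitzTwoSided]

/-! ### Fourier transforms of windows -/

/-- Bounded functions of bounded variation which vanish outside `[0, 1]`. -/
structure IsWindow (g : ℝ → ℝ) : Prop where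
  measurable : Measurable g
  bounded : ∃ H, ∀ t, |g t| ≤ H
  eq_zero : ∀ t, t ∉ Icc (0 : ℝ) 1 → g t = 0
  boundedVariation : BoundedVariationOn g univ

theorem IsTaper.isWindow {h : ℝ → ℝ} (hh : IsTaper h) : IsWindow h where
  measurable := by
    have h1 : h = (Icc 0 1).indicator h := by
      ext t
      by_cases ht : t ∈ Icc (0 : ℝ) 1
      · rw [indicator_of_mem ht]
      · rw [indicator_of_notMem ht, hh.eq_zero t ht]
    have h2 : Measurable ((Icc (0 : ℝ) 1).piecewise h 0) :=
      hh.continuousOn.measurable_piecewise continuousOn_const measurableSet_Icc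
    rw [h1, ← piecewise_eq_indicator]
    exact h2
  bounded := hh.exists_abs_bound.imp fun _ h => h.2
  eq_zero := hh.eq_zero
  boundedVariation := hh.boundedVariation

namespace IsWindow

variable {f g : ℝ → ℝ}

theorem mul (hf : IsWindow f) (hg : IsWindow g) : IsWindow (f * g) where
  measurable := hf.measurable.mul hg.measurable
  bounded := by
    obtain ⟨A, hA⟩ := hf.bounded
    obtain ⟨B, hB⟩ := hg.bounded
    refine ⟨A * B, fun t => ?_⟩
    rw [Pi.mul_apply, abs_mul]
    exact mul_le_mul (hA t) (hB t) (abs_nonneg _) ((abs_nonneg _).trans (hA t))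
  eq_zero t ht := by rw [Pi.mul_apply, hf.eq_zero t ht, zero_mul]
  boundedVariation := hf.boundedVariation.mul hg.boundedVariation

theorem pow_succ (hg : IsWindow g) (n : ℕ) : IsWindow (g ^ (n + 1)) := by
  induction n with
  | zero => simpa using hg
  | succ n ih =>
    rw [_root_.pow_succ]
    exact ih.mul hg

theorem integrable (hg : IsWindow g) : Integrable g := by
  obtain ⟨H, hH⟩ := hg.bounded
  have h1 : IntegrableOn g (Icc 0 1) :=
    Measure.integrableOn_of_bounded (by simp) hg.measurable.aestronglyMeasurable
      (M := H) (Eventually.of_forall hH)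
  refine (integrableOn_iff_integrable_of_support_subset fun t ht => ?_).1 h1
  by_contra h
  exact ht (hg.eq_zero t h)

theorem integrable_div (hg : IsWindow g) {T : ℝ} (hT : 0 < T) :
    Integrable fun t => g (t / T) := hg.integrable.comp_div hT.ne'

/-- Cutting the line into cells of length `a` and translating them onto one cell, the integrand at
each point becomes a sum of increments of `g` along an arithmetic progression, at most the total
variation. -/
theorem integral_abs_shift_le_of_pos (hg : IsWindow g) {a : ℝ} (ha : 0 < a) :
    ∫ t, |g (t + a) - g t| ≤ a * (eVariationOn g univ).toReal := by
  -- Then `N a > 1 + a`, so `N` cells starting at `-a` cover `[-a, 1]`, outside which both `g t` and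
  -- `g (t + a)` vanish.
  obtain ⟨N, hN⟩ := exists_nat_gt ((1 + a) / a)
  rw [div_lt_iff₀ ha] at hN
  have hi : Integrable fun t => |g (t + a) - g t| :=
    ((hg.integrable.comp_add_right a).sub hg.integrable).abs
  -- The point `-a` is exceptional, since `g 0` need not vanish.
  have hsupp : ∀ t, t ∉ Ioc (-a) (-a + N * a) → g t = 0 ∧ g (t + a) = 0 ∨ t = -a := by
    intro t ht
    by_cases h : t = -a
    · exact Or.inr h
    refine Or.inl ⟨hg.eq_zero _ fun h1 => ht ⟨?_, ?_⟩, hg.eq_zero _ fun h1 => ht ⟨?_, ?_⟩⟩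
    · linarith [h1.1]
    · linarith [h1.2]
    · exact lt_of_le_of_ne (by linarith [h1.1]) (Ne.symm h)
    · linarith [h1.2]
  have h1 : ∫ t, |g (t + a) - g t| = ∫ t in (-a)..(-a + N * a), |g (t + a) - g t| := by
    rw [intervalIntegral.integral_of_le (by nlinarith), ← integral_indicator measurableSet_Ioc]
    have hne : ∀ᵐ t : ℝ, t ≠ -a := by simp [ae_iff]
    refine integral_congr_ae ?_
    filter_upwards [hne] with t ht
    by_cases hm : t ∈ Ioc (-a) (-a + N * a)
    · rw [indicator_of_mem hm]
    · rw [indicator_of_notMem hm]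
      rcases hsupp t hm with h2 | h2
      · rw [h2.1, h2.2, sub_zero, abs_zero]
      · exact absurd h2 ht
  have h2 := intervalIntegral.sum_integral_adjacent_intervals (μ := volume) (n := N)
    (f := fun t => |g (t + a) - g t|) (a := fun s : ℕ => -a + s * a)
    fun s _ => hi.intervalIntegrable
  simp only [Nat.cast_zero, zero_mul, add_zero] at h2
  have h3 : ∀ s : ℕ, ∫ t in (-a + s * a)..(-a + (s + 1 : ℕ) * a), |g (t + a) - g t| =
      ∫ t in (-a)..0, |g (t + (s + 1 : ℕ) * a) - g (t + s * a)| := by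
    intro s
    have := intervalIntegral.integral_comp_add_right (a := -a) (b := 0)
      (fun t => |g (t + a) - g t|) ((s : ℝ) * a)
    rw [show -a + ((s + 1 : ℕ) : ℝ) * a = 0 + s * a by push_cast; ring, ← this]
    congr 1
    ext t
    congr 3
    push_cast
    ring
  have hi2 : ∀ s : ℕ, Integrable fun t => |g (t + (s + 1 : ℕ) * a) - g (t + s * a)| := fun s =>
    ((hg.integrable.comp_add_right _).sub (hg.integrable.comp_add_right _)).abs
  rw [h1, ← h2, Finset.sum_congr rfl fun s _ => h3 s,
    ← intervalIntegral.integral_finsetSum fun s _ => (hi2 s).intervalIntegrable]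
  calc _ ≤ ∫ _t in (-a)..0, (eVariationOn g univ).toReal := by
        refine intervalIntegral.integral_mono_on (by linarith)
          (integrable_finsetSum _ fun s _ => hi2 s).intervalIntegrable
          intervalIntegrable_const fun t _ => ?_
        refine sum_abs_sub_le hg.boundedVariation (x := fun s : ℕ => t + s * a) (fun p q hpq => ?_) N
        have : (p : ℝ) ≤ q := by exact_mod_cast hpq
        simp only
        gcongr
    _ = _ := by
        rw [intervalIntegral.integral_const, smul_eq_mul]
        ring

theorem integral_abs_shift_le (hg : IsWindow g) (a : ℝ) :
    ∫ t, |g (t + a) - g t| ≤ |a| * (eVariationOn g univ).toReal := by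
  rcases lt_trichotomy a 0 with h | rfl | h
  · rw [abs_of_neg h, ← integral_add_right_eq_self _ (-a)]
    refine le_of_eq_of_le (integral_congr_ae (Eventually.of_forall fun t => ?_))
      (hg.integral_abs_shift_le_of_pos (neg_pos.2 h))
    simp only [neg_add_cancel_right]
    exact abs_sub_comm _ _
  · simp
  · rw [abs_of_pos h]
    exact hg.integral_abs_shift_le_of_pos h

end IsWindow

/-- The Fourier transform of `t ↦ g (t / T)`. -/
def kernelCT (g : ℝ → ℝ) (T u : ℝ) : ℂ := ∫ t : ℝ, (g (t / T) : ℂ) * Complex.exp (-Complex.I * u * t)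

theorem norm_exp_neg_I_mul (u t : ℝ) : ‖Complex.exp (-Complex.I * u * t)‖ = 1 := by
  rw [show -Complex.I * u * t = ((-(u * t) : ℝ) : ℂ) * Complex.I by push_cast; ring,
    Complex.norm_exp_ofReal_mul_I]

theorem integrable_mul_exp {F : ℝ → ℂ} (hF : Integrable F) (u : ℝ) :
    Integrable fun t : ℝ => F t * Complex.exp (-Complex.I * u * t) :=
  hF.mul_bdd (c := 1) (by fun_prop) (Eventually.of_forall fun t => (norm_exp_neg_I_mul u t).le)

namespace IsWindow

variable {f g : ℝ → ℝ}

theorem continuous_kernelCT (hg : IsWindow g) {T : ℝ} (hT : 0 < T) : Continuous (kernelCT g T) := by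
  refine continuous_of_dominated (bound := fun t => ‖(g (t / T) : ℂ)‖) (fun u => ?_) (fun u => ?_)
    (hg.integrable_div hT).ofReal.norm (Eventually.of_forall fun t => by fun_prop)
  · exact (integrable_mul_exp (hg.integrable_div hT).ofReal u).aestronglyMeasurable
  · refine Eventually.of_forall fun t => ?_
    rw [norm_mul, norm_exp_neg_I_mul, mul_one]

theorem norm_kernelCT_le (hg : IsWindow g) {H : ℝ} (hH : ∀ t, |g t| ≤ H) {T : ℝ} (hT : 0 < T)
    (u : ℝ) : ‖kernelCT g T u‖ ≤ H * T := by
  have h1 : ‖kernelCT g T u‖ ≤ ∫ t, |g (t / T)| := by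
    refine norm_integral_le_of_norm_le (hg.integrable_div hT).abs (Eventually.of_forall fun t => ?_)
    rw [norm_mul, norm_exp_neg_I_mul, mul_one, Complex.norm_real, Real.norm_eq_abs]
  refine h1.trans ?_
  rw [Measure.integral_comp_div (fun t => |g t|), abs_of_pos hT, smul_eq_mul, mul_comm]
  gcongr
  have h2 : ∫ t, |g t| = ∫ t in Icc (0 : ℝ) 1, |g t| := by
    refine (setIntegral_eq_integral_of_forall_compl_eq_zero fun t ht => ?_).symm
    rw [hg.eq_zero t ht, abs_zero]
  rw [h2]
  refine (setIntegral_mono_on hg.integrable.abs.integrableOn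
    (integrableOn_const (C := H) (by simp) (by simp)) measurableSet_Icc fun t _ => hH t).trans_eq ?_
  simp

/-- Translation by the half period `a = π / u` flips the sign of the exponential, so `2 kernelCT`
is, up to sign, the transform of `g((t+a)/T) - g(t/T)`, whose `L¹` norm is at most `|a|` times the
variation. -/
theorem norm_kernelCT_mul_le (hg : IsWindow g) {T : ℝ} (hT : 0 < T) (u : ℝ) :
    ‖kernelCT g T u‖ * |u| ≤ Real.pi / 2 * (eVariationOn g univ).toReal := by
  have hpi := Real.pi_pos
  rcases eq_or_ne u 0 with rfl | hu
  · simp only [abs_zero, mul_zero]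
    positivity
  set a := Real.pi / u with ha
  have hF : Integrable fun t : ℝ => (g (t / T) : ℂ) := (hg.integrable_div hT).ofReal
  have h1 : kernelCT g T u =
      -∫ t : ℝ, (g ((t + a) / T) : ℂ) * Complex.exp (-Complex.I * u * t) := by
    rw [kernelCT, ← integral_add_right_eq_self _ a, ← integral_neg]
    refine integral_congr_ae (Eventually.of_forall fun t => ?_)
    have h2 : Complex.exp (-Complex.I * u * ((t + a : ℝ) : ℂ)) =
        -Complex.exp (-Complex.I * u * t) := by
      have h3 : (u : ℂ) * a = Real.pi := by
        rw [ha, ← Complex.ofReal_mul, mul_div_cancel₀ _ hu]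
      have h4 : -Complex.I * u * ((t + a : ℝ) : ℂ) =
          -Complex.I * u * t + -(Real.pi * Complex.I) := by
        rw [← h3]
        push_cast
        ring
      rw [h4, Complex.exp_add, Complex.exp_neg (Real.pi * Complex.I), Complex.exp_pi_mul_I]
      norm_num
    simp only [h2, mul_neg]
  have hF2 : Integrable fun t : ℝ => (g ((t + a) / T) : ℂ) := hF.comp_add_right a
  have h2 : 2 * kernelCT g T u = -∫ t : ℝ, ((g ((t + a) / T) : ℂ) - g (t / T)) *
      Complex.exp (-Complex.I * u * t) := by
    simp_rw [sub_mul]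
    rw [integral_sub (integrable_mul_exp hF2 u) (integrable_mul_exp hF u), two_mul]
    nth_rewrite 1 [h1]
    rw [kernelCT]
    ring
  have h3 : 2 * ‖kernelCT g T u‖ ≤ |a| * (eVariationOn g univ).toReal := by
    have h4 : 2 * ‖kernelCT g T u‖ = ‖2 * kernelCT g T u‖ := by simp
    rw [h4, h2, norm_neg]
    have hi : Integrable fun t : ℝ => |g ((t + a) / T) - g (t / T)| :=
      (((hg.integrable_div hT).comp_add_right a).sub (hg.integrable_div hT)).abs
    refine (norm_integral_le_of_norm_le hi (Eventually.of_forall fun t => ?_)).trans ?_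
    · rw [norm_mul, norm_exp_neg_I_mul, mul_one, ← Complex.ofReal_sub, Complex.norm_real,
        Real.norm_eq_abs]
    · simp_rw [add_div]
      rw [Measure.integral_comp_div (fun t => |g (t + a / T) - g t|), abs_of_pos hT, smul_eq_mul]
      calc _ ≤ T * (|a / T| * (eVariationOn g univ).toReal) := by
            gcongr
            exact hg.integral_abs_shift_le _
        _ = _ := by
            rw [abs_div, abs_of_pos hT]
            field_simp
  rw [ha, abs_div, abs_of_pos hpi] at h3
  have hu0 : 0 < |u| := abs_pos.2 hu
  calc ‖kernelCT g T u‖ * |u| = 2 * ‖kernelCT g T u‖ * (|u| / 2) := by ring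
    _ ≤ Real.pi / |u| * (eVariationOn g univ).toReal * (|u| / 2) := by gcongr
    _ = _ := by field_simp

theorem exists_enorm_kernelCT_le (hg : IsWindow g) : ∃ C : ℝ≥0∞, C ≠ ∞ ∧ ∀ T : ℝ, 0 < T → ∀ u,
    ‖kernelCT g T u‖ₑ ≤ C * majorant 0 T u := by
  obtain ⟨H, hH⟩ := hg.bounded
  refine ⟨ENNReal.ofReal (H + Real.pi / 2 * (eVariationOn g univ).toReal), ENNReal.ofReal_ne_top,
    fun T hT u => enorm_le_majorant hT (hg.norm_kernelCT_le hH hT u) ?_⟩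
  rw [AddCircle.norm_eq_of_zero]
  exact hg.norm_kernelCT_mul_le hT u

end IsWindow

open FourierTransform Convolution in
-- Fourier inversion at `0` for the convolution of `F` and `G`. Neither transform need be
-- integrable, but their product is, and the convolution is continuous at `0` because `G` is
-- bounded.
theorem integral_fourier_mul_fourier {F G : ℝ → ℂ} (hF : Integrable F) (hG : Integrable G) {C : ℝ}
    (hC : ∀ t, ‖G t‖ ≤ C) (hFG : Integrable fun w => 𝓕 F w * 𝓕 G w) :
    ∫ w, 𝓕 F w * 𝓕 G w = ∫ t, F (-t) * G t := by
  set S : ℝ → ℂ := F ⋆[ContinuousLinearMap.mul ℂ ℂ] G with hS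
  have hSv : ∀ v, S v = ∫ t, F (v - t) * G t := fun v => by
    rw [hS, convolution_eq_swap]
    rfl
  have hi : ∀ v, Integrable fun t => F (v - t) * G t := fun v =>
    (hF.comp_sub_left v).mul_bdd hG.aestronglyMeasurable (Eventually.of_forall hC)
  have hSi : Integrable S := hF.integrable_convolution _ hG
  have hSF : 𝓕 S = fun w => 𝓕 F w * 𝓕 G w := by
    ext w
    exact Real.fourier_mul_convolution_eq hF hG w
  have hS0 : ContinuousAt S 0 := by
    have h1 : Tendsto (fun v : ℝ => C * ∫ x, ‖F (x - -v) - F x‖) (𝓝 0) (𝓝 0) := by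
      have := ((tendsto_integral_norm_shift hF).comp
        (tendsto_neg (0 : ℝ) |>.mono_right (by rw [neg_zero]))).const_mul C
      simpa using this
    refine tendsto_iff_norm_sub_tendsto_zero.2 (squeeze_zero (fun _ => norm_nonneg _) (fun v => ?_) h1)
    rw [hSv, hSv, ← integral_sub (hi v) (hi 0), ← integral_neg_eq_self, ← integral_const_mul]
    refine norm_integral_le_of_norm_le (((hF.comp_sub_right (-v)).sub hF).norm.const_mul C)
      (Eventually.of_forall fun t => ?_)
    rw [← sub_mul, norm_mul, mul_comm]
    have : ‖F (v - -t) - F (0 - -t)‖ = ‖F (t - -v) - F t‖ := by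
      congr 3 <;> ring
    rw [this]
    gcongr
    exact hC _
  have h2 := hSi.fourierInv_fourier_eq (by rw [hSF]; exact hFG) hS0
  rw [hSv, Real.fourierInv_eq', hSF] at h2
  simpa using h2

open FourierTransform in
theorem kernelCT_sub_eq_fourier (g : ℝ → ℝ) (T a w : ℝ) :
    kernelCT g T (2 * Real.pi * w - a) =
      𝓕 (fun t : ℝ => (g (t / T) : ℂ) * Complex.exp (Complex.I * a * t)) w := by
  rw [Real.fourier_real_eq_integral_exp_smul, kernelCT]
  refine integral_congr_ae (Eventually.of_forall fun t => ?_)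
  simp only [smul_eq_mul]
  rw [mul_left_comm, ← Complex.exp_add]
  congr 2
  push_cast
  ring

open FourierTransform in
theorem kernelCT_sub_eq_fourier' (g : ℝ → ℝ) (T b w : ℝ) :
    kernelCT g T (b - 2 * Real.pi * w) =
      𝓕 (fun t : ℝ => (g (-t / T) : ℂ) * Complex.exp (Complex.I * b * t)) w := by
  rw [Real.fourier_real_eq_integral_exp_smul, kernelCT, ← integral_neg_eq_self]
  refine integral_congr_ae (Eventually.of_forall fun t => ?_)
  simp only [smul_eq_mul]
  rw [mul_left_comm, ← Complex.exp_add]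
  congr 2
  push_cast
  ring

theorem IsWindow.lintegral_enorm_kernelCT_rpow_lt_top {g : ℝ → ℝ} (hg : IsWindow g) {T : ℝ}
    (hT : 0 < T) {p : ℝ} (hp : 1 < p) : ∫⁻ u in freqCT, ‖kernelCT g T u‖ₑ ^ p < ∞ := by
  obtain ⟨C, hC, hle⟩ := hg.exists_enorm_kernelCT_le
  obtain ⟨D, hD, hD'⟩ := isFreqDomain_freqCT.lintegral_majorant_rpow_le hp
  have hp0 : 0 ≤ p := by linarith
  calc ∫⁻ u in freqCT, ‖kernelCT g T u‖ₑ ^ p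
      ≤ ∫⁻ u in freqCT, C ^ p * majorant 0 T u ^ p := by
        refine lintegral_mono fun u => ?_
        rw [← ENNReal.mul_rpow_of_nonneg _ _ hp0]
        exact ENNReal.rpow_le_rpow (hle T hT u) hp0
    _ = C ^ p * ∫⁻ u in freqCT, majorant 0 T u ^ p :=
        lintegral_const_mul _ ((measurable_majorant 0 T).pow_const _)
    _ ≤ C ^ p * (D * ENNReal.ofReal T ^ (p - 1)) := by gcongr; exact hD' T hT
    _ < ∞ := by
        have h1 := ENNReal.rpow_lt_top_of_nonneg hp0 hC
        have h2 := ENNReal.rpow_lt_top_of_nonneg (by linarith : 0 ≤ p - 1)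
          (ENNReal.ofReal_ne_top (r := T))
        exact ENNReal.mul_lt_top h1 (ENNReal.mul_lt_top hD.lt_top h2)

/-- The majorant puts each kernel in `L^(1 + 1/n)`, exactly what the Young type inequality for paths
asks for. -/
theorem integrable_prod_kernelCT {n : ℕ} {g : Fin (n + 1) → ℝ → ℝ} (hg : ∀ i, IsWindow (g i))
    {T : ℝ} (hT : 0 < T) (a b : ℝ) :
    Integrable (fun x : Fin n → ℝ => ∏ i, kernelCT (g i) T (-steps a b x i))
      (Measure.pi fun _ => volume.restrict freqCT) := by
  have hm : ∀ i, Measurable fun u => kernelCT (g i) T (-u) := fun i =>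
    ((hg i).continuous_kernelCT hT).measurable.comp measurable_neg
  refine ⟨(Finset.measurable_prod _ fun i _ =>
    (hm i).comp (measurable_steps_right a b i)).aestronglyMeasurable, ?_⟩
  rcases eq_or_ne n 0 with rfl | hn
  · rw [Measure.pi_of_empty, HasFiniteIntegral, lintegral_dirac]
    exact enorm_lt_top
  have hn' : 0 < (n : ℝ)⁻¹ := by positivity
  have hneg : ∀ i, ∫⁻ u in freqCT, ‖kernelCT (g i) T (-u)‖ₑ ^ (1 + (n : ℝ)⁻¹) < ∞ := fun i => by
    have := (hg i).lintegral_enorm_kernelCT_rpow_lt_top hT (p := 1 + (n : ℝ)⁻¹) (by linarith)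
    rw [freqCT, Measure.restrict_univ] at this ⊢
    rwa [lintegral_neg_eq_self (fun u => ‖kernelCT (g i) T u‖ₑ ^ (1 + (n : ℝ)⁻¹))]
  rw [HasFiniteIntegral]
  have h1 : ∀ x : Fin n → ℝ, ‖∏ i, kernelCT (g i) T (-steps a b x i)‖ₑ =
      ∏ i, ‖kernelCT (g i) T (-steps a b x i)‖ₑ := fun x => by
    simp [enorm_eq_nnnorm, nnnorm_prod]
  simp_rw [h1]
  refine (isFreqDomain_freqCT.lintegral_prod_steps_le hn (fun j => (hm j).enorm)
    (fun j u => by simp) a b).trans_lt ?_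
  exact ENNReal.sum_lt_top.2 fun i _ => ENNReal.prod_lt_top fun j _ => hneg _

open FourierTransform in
/-- The convolution of two kernels is a kernel. -/
theorem integral_kernelCT_mul_kernelCT {f g : ℝ → ℝ} (hf : IsWindow f) (hg : IsWindow g) {T : ℝ}
    (hT : 0 < T) (a b : ℝ) :
    ∫ y, kernelCT f T (y - a) * kernelCT g T (b - y) =
      2 * Real.pi * kernelCT (f * g) T (b - a) := by
  obtain ⟨H, hH⟩ := hg.bounded
  have hpi : (0 : ℝ) < 2 * Real.pi := Real.two_pi_pos
  set F : ℝ → ℂ := fun t => (f (t / T) : ℂ) * Complex.exp (Complex.I * a * t) with hF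
  set G : ℝ → ℂ := fun t => (g (-t / T) : ℂ) * Complex.exp (Complex.I * b * t) with hG
  have hexp : ∀ c t : ℝ, ‖Complex.exp (Complex.I * c * t)‖ = 1 := fun c t => by
    rw [show Complex.I * c * t = ((c * t : ℝ) : ℂ) * Complex.I by push_cast; ring,
      Complex.norm_exp_ofReal_mul_I]
  have hFi : Integrable F := (hf.integrable_div hT).ofReal.mul_bdd (c := 1) (by fun_prop)
    (Eventually.of_forall fun t => (hexp a t).le)
  have hGi : Integrable G := (hg.integrable_div hT).comp_neg.ofReal.mul_bdd (c := 1) (by fun_prop)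
    (Eventually.of_forall fun t => (hexp b t).le)
  have hprod : Integrable fun y => kernelCT f T (y - a) * kernelCT g T (b - y) := by
    -- Paths with a single intermediate vertex: both kernels are in `L²`.
    have h1 := integrable_prod_kernelCT (n := 1) (g := ![f, g])
      (Fin.forall_fin_two.2 ⟨hf, hg⟩) hT a b
    have h2 := (volume_preserving_funUnique (Fin 1) ℝ).symm
    rw [freqCT, Measure.restrict_univ, ← volume_pi] at h1
    refine ((h2.integrable_comp_emb (MeasurableEquiv.measurableEmbedding _)).2 h1).congr
      (Eventually.of_forall fun y => ?_)
    have h3 : (MeasurableEquiv.funUnique (Fin 1) ℝ).symm y =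
        (Fin.cons y (Fin.elim0 : Fin 0 → ℝ) : Fin 1 → ℝ) := by
      ext i
      obtain rfl : i = 0 := Subsingleton.elim _ _
      rfl
    rw [Function.comp_apply, h3, prod_steps_cons (fun i u => kernelCT ((![f, g] : Fin 2 → ℝ → ℝ) i) T (-u)),
      Fin.prod_univ_one, steps_fin_zero, neg_sub, neg_sub]
    rfl
  have hFG : Integrable fun w => 𝓕 F w * 𝓕 G w := by
    simp_rw [hF, hG, ← kernelCT_sub_eq_fourier, ← kernelCT_sub_eq_fourier']
    exact hprod.comp_mul_left' hpi.ne'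
  have h1 := integral_fourier_mul_fourier hFi hGi (C := H) (fun t => by
    rw [hG, norm_mul, hexp, mul_one, Complex.norm_real, Real.norm_eq_abs]
    exact hH _) hFG
  simp_rw [hF, hG, ← kernelCT_sub_eq_fourier, ← kernelCT_sub_eq_fourier'] at h1
  rw [Measure.integral_comp_mul_left (fun y => kernelCT f T (y - a) * kernelCT g T (b - y)),
    abs_of_pos (inv_pos.2 hpi), inv_smul_eq_iff₀ hpi.ne'] at h1
  rw [h1, kernelCT, ← integral_neg_eq_self, Complex.real_smul]
  push_cast
  congr 1
  refine integral_congr_ae (Eventually.of_forall fun t => ?_)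
  simp only [Pi.mul_apply]
  rw [mul_mul_mul_comm, ← Complex.exp_add, neg_neg]
  push_cast
  congr 2
  ring

/-- Each integration over a vertex convolves two kernels, hence multiplies their windows and
produces a factor `2π`. -/
theorem IsWindow.integral_prod_kernelCT {g : ℝ → ℝ} (hg : IsWindow g) {T : ℝ} (hT : 0 < T) {n : ℕ}
    (a b : ℝ) :
    ∫ x : Fin n → ℝ, ∏ i, kernelCT g T (-steps a b x i)
      ∂(Measure.pi fun _ => volume.restrict freqCT) =
      (2 * Real.pi) ^ n * kernelCT (g ^ (n + 1)) T (b - a) := by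
  induction n generalizing a with
  | zero =>
    rw [Measure.pi_of_empty, integral_dirac]
    simp [steps_fin_zero]
  | succ n ih =>
    rw [integral_pi_succ (integrable_prod_kernelCT (fun _ => hg) hT a b)]
    have h1 : ∀ (y : ℝ) (x : Fin n → ℝ),
        ∏ i, kernelCT g T (-steps a b (Fin.cons y x : Fin (n + 1) → ℝ) i) =
          kernelCT g T (y - a) * ∏ i : Fin (n + 1), kernelCT g T (-steps y b x i) := fun y x => by
      rw [prod_steps_cons (fun _ u => kernelCT g T (-u)), neg_sub]
    simp_rw [h1, integral_const_mul, ih]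
    rw [freqCT, Measure.restrict_univ]
    simp_rw [mul_left_comm _ ((2 * Real.pi : ℂ) ^ n)]
    rw [integral_const_mul, integral_kernelCT_mul_kernelCT hg (hg.pow_succ n) hT, ← _root_.pow_succ']
    ring

theorem IsWindow.kernelCT_zero {g : ℝ → ℝ} (hg : IsWindow g) {T : ℝ} (hT : 0 < T) (n : ℕ) :
    kernelCT (g ^ (n + 1)) T 0 = T * moment g (n + 1) := by
  have h1 : ∫ t, (g ^ (n + 1)) t = moment g (n + 1) := by
    rw [moment, intervalIntegral.integral_of_le zero_le_one, ← integral_Icc_eq_integral_Ioc]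
    refine (setIntegral_eq_integral_of_forall_compl_eq_zero fun t ht => ?_).symm
    exact (hg.pow_succ n).eq_zero t ht
  simp only [kernelCT, Complex.ofReal_zero, mul_zero, zero_mul, Complex.exp_zero, mul_one]
  rw [integral_complex_ofReal, Measure.integral_comp_div (g ^ (n + 1)), abs_of_pos hT, h1]
  simp

/-! ### Traces of products of integrals of rank one operators -/

section Hilbert

variable {H : Type u} [NormedAddCommGroup H] [InnerProductSpace ℂ H]

/-- Cauchy-Schwarz and Bessel. The bound is uniform in `s`, which yields absolute convergence of the
trace series. -/
theorem _root_.Orthonormal.sum_norm_inner_mul_norm_inner_le {ι : Type*} {v : ι → H}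
    (hv : Orthonormal ℂ v) (s : Finset ι) (x y : H) :
    ∑ i ∈ s, ‖inner ℂ x (v i)‖ * ‖inner ℂ (v i) y‖ ≤ ‖x‖ * ‖y‖ := by
  have h1 : ∑ i ∈ s, ‖inner ℂ x (v i)‖ ^ 2 ≤ ‖x‖ ^ 2 := by
    simp_rw [norm_inner_symm x]
    exact hv.sum_inner_products_le x
  have h2 : ∑ i ∈ s, ‖inner ℂ (v i) y‖ ^ 2 ≤ ‖y‖ ^ 2 := hv.sum_inner_products_le y
  refine abs_le_of_sq_le_sq' ?_ (by positivity) |>.2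
  calc _ ≤ (∑ i ∈ s, ‖inner ℂ x (v i)‖ ^ 2) * ∑ i ∈ s, ‖inner ℂ (v i) y‖ ^ 2 :=
        Finset.sum_mul_sq_le_sq_mul_sq _ _ _
    _ ≤ ‖x‖ ^ 2 * ‖y‖ ^ 2 := mul_le_mul h1 h2 (by positivity) (by positivity)
    _ = _ := (mul_pow _ _ _).symm

/-- Orthonormal vectors are at distance `√2`, so balls of radius `1/2` around them are disjoint.
Countability permits the exchange of sum and integral in `hasTrace_mul`. -/
theorem _root_.Orthonormal.countable_of_separableSpace [TopologicalSpace.SeparableSpace H] {ι : Type*} {v : ι → H}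
    (hv : Orthonormal ℂ v) : Countable ι := by
  refine Pairwise.countable_of_isOpen_disjoint (s := fun i => Metric.ball (v i) (1 / 2))
    (fun i j hij => Metric.ball_disjoint_ball ?_) (fun i => Metric.isOpen_ball)
    fun i => ⟨v i, Metric.mem_ball_self (by norm_num)⟩
  have h1 : ‖v i - v j‖ ^ 2 = 2 := by
    rw [@norm_sub_sq ℂ, hv.1 i, hv.1 j, hv.2 hij]
    norm_num
  rw [dist_eq_norm]
  nlinarith [norm_nonneg (v i - v j)]

variable {Λ : Set ℝ} {e : ℝ → H}

theorem inner_prod_eq_pathIntegral {k : ℝ → ℂ} (hk : Measurable k) {K : ℝ} (hK : ∀ u, ‖k u‖ ≤ K)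
    (he : ∀ a b, inner ℂ (e a) (e b) = k (a - b)) {n : ℕ} {ψ : Fin n → ℝ → ℝ}
    (hψ : ∀ i, IntegrableOn (ψ i) Λ) {A : Fin n → H →L[ℂ] H}
    (hA : ∀ i v w, inner ℂ v (A i w) =
      ∫ x in Λ, (ψ i x : ℂ) * (inner ℂ v (e x) * inner ℂ (e x) w)) (a b : ℝ) :
    inner ℂ (e a) ((List.ofFn A).prod (e b)) = pathIntegral Λ k ψ a b := by
  induction n generalizing a with
  | zero => simp [pathIntegral_zero, he]
  | succ n ih =>
    rw [List.ofFn_succ, List.prod_cons, mul_apply_eq_comp, hA,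
      pathIntegral_succ hk hK hψ]
    refine integral_congr_ae (Eventually.of_forall fun y => ?_)
    simp only
    rw [he, ih (fun i => hψ i.succ) fun i => hA i.succ, mul_assoc]

/-- For fixed `x`, Parseval sums `⟨bᵢ, e x⟩ ⟨e x, C bᵢ⟩ = ⟨bᵢ, e x⟩ ⟨C* e x, bᵢ⟩` to `⟨e x, C e x⟩`,
whatever the basis. The exchange with the integral rests on the uniform bound `‖C* e x‖ ‖e x‖ ≤ ‖C*‖
M²`. -/
theorem hasTrace_mul [CompleteSpace H] [TopologicalSpace.SeparableSpace H] {M : ℝ} (heM : ∀ x, ‖e x‖ ≤ M)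
    (hem : ∀ w, Measurable fun x => inner ℂ w (e x)) {ψ : ℝ → ℝ} (hψ : IntegrableOn ψ Λ)
    {A : H →L[ℂ] H} (hA : ∀ v w, inner ℂ v (A w) =
      ∫ x in Λ, (ψ x : ℂ) * (inner ℂ v (e x) * inner ℂ (e x) w)) (C : H →L[ℂ] H) :
    HasTrace (A * C) (∫ x in Λ, (ψ x : ℂ) * inner ℂ (e x) (C (e x))) := by
  intro ι b
  have := b.orthonormal.countable_of_separableSpace
  have hM : 0 ≤ M := (norm_nonneg _).trans (heM 0)
  have hem' : ∀ w, Measurable fun x => inner ℂ (e x) w := fun w => by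
    simp_rw [← inner_conj_symm _ w]
    exact Complex.continuous_conj.measurable.comp (hem w)
  set F : ι → ℝ → ℂ := fun i x => (ψ x : ℂ) * (inner ℂ (b i) (e x) * inner ℂ (e x) (C (b i))) with hF
  have hadj : ∀ x i, inner ℂ (e x) (C (b i)) = inner ℂ (C.adjoint (e x)) (b i) := fun x i =>
    (ContinuousLinearMap.adjoint_inner_left _ _ _).symm
  have hFn : ∀ i x, ‖F i x‖ = ‖ψ x‖ *
      (‖inner ℂ (C.adjoint (e x)) (b i)‖ * ‖inner ℂ (b i) (e x)‖) := fun i x => by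
    simp only [hF, hadj, norm_mul, Complex.norm_real]
    ring
  have hbound : ∀ x, ‖C.adjoint (e x)‖ * ‖e x‖ ≤ ‖C.adjoint‖ * M * M := fun x => by
    gcongr
    · exact (C.adjoint.le_opNorm _).trans (by gcongr; exact heM x)
    · exact heM x
  have hFs : ∀ (s : Finset ι) x, ∑ i ∈ s, ‖F i x‖ ≤ ‖ψ x‖ * (‖C.adjoint‖ * M * M) := fun s x => by
    simp_rw [hFn, ← Finset.mul_sum]
    gcongr
    exact (b.orthonormal.sum_norm_inner_mul_norm_inner_le s _ _).trans (hbound x)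
  have hFi : ∀ i, Integrable (F i) (volume.restrict Λ) := fun i => by
    refine hψ.ofReal.mul_bdd (c := ‖C.adjoint‖ * M * M)
      ((hem _).mul (hem' _)).aestronglyMeasurable (Eventually.of_forall fun x => ?_)
    have := b.orthonormal.sum_norm_inner_mul_norm_inner_le {i} (C.adjoint (e x)) (e x)
    rw [Finset.sum_singleton] at this
    rw [norm_mul, hadj, mul_comm]
    exact this.trans (hbound x)
  have h1 : HasSum (fun i => ∫ x in Λ, F i x) (∫ x in Λ, ∑' i, F i x) := by
    refine hasSum_integral_of_summable_integral_norm hFi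
      (summable_of_sum_le (fun i => integral_nonneg fun x => norm_nonneg _)
        (c := ∫ x in Λ, ‖ψ x‖ * (‖C.adjoint‖ * M * M)) fun s => ?_)
    rw [← integral_finsetSum _ fun i _ => (hFi i).norm]
    exact integral_mono (integrable_finsetSum _ fun i _ => (hFi i).norm) (hψ.norm.mul_const _)
      fun x => hFs s x
  convert h1 using 1
  · ext i
    exact hA _ _
  · refine integral_congr_ae (Eventually.of_forall fun x => ?_)
    simp only [hF]
    rw [tsum_mul_left, ← ContinuousLinearMap.adjoint_inner_left, ← b.tsum_inner_mul_inner]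
    simp_rw [hadj, mul_comm]

end Hilbert

/-! ### Wiener-Hopf operators as integrals of rank one operators -/

theorem integral_mul_integral_swap {α β : Type*} [MeasurableSpace α] [MeasurableSpace β]
    {μ : Measure α} {ν : Measure β} [SFinite μ] [SFinite ν] {F : α → ℂ} {G : β → ℂ}
    (hF : Integrable F μ) (hG : Integrable G ν) {θ : α → β → ℂ}
    (hθ : Measurable fun p : α × β => θ p.1 p.2) {C : ℝ} (hC : ∀ x y, ‖θ x y‖ ≤ C) :
    ∫ x, F x * ∫ y, θ x y * G y ∂ν ∂μ = ∫ y, G y * ∫ x, θ x y * F x ∂μ ∂ν := by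
  simp_rw [← integral_const_mul]
  rw [integral_integral_swap]
  · refine integral_congr_ae (Eventually.of_forall fun y => ?_)
    refine integral_congr_ae (Eventually.of_forall fun x => ?_)
    simp only
    ring
  · refine ((hF.mul_prod hG).mul_bdd (c := C) hθ.aestronglyMeasurable
      (Eventually.of_forall fun p => hC _ _)).congr (Eventually.of_forall fun p => ?_)
    simp only [Function.uncurry]
    ring

theorem norm_exp_I_mul (x t : ℝ) : ‖Complex.exp (Complex.I * x * t)‖ = 1 := by
  rw [show Complex.I * x * t = ((x * t : ℝ) : ℂ) * Complex.I by push_cast; ring,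
    Complex.norm_exp_ofReal_mul_I]

theorem conj_exp_I_mul (x t : ℝ) : starRingEnd ℂ (Complex.exp (Complex.I * x * t)) =
    Complex.exp (-Complex.I * x * t) := by
  rw [← Complex.exp_conj]
  simp

section

variable {h : ℝ → ℝ} (hh : IsTaper h) (T : ℝ)
include hh

theorem memLp_exp (x : ℝ) :
    MemLp (fun t : ℝ => Complex.exp (Complex.I * x * t)) 2 (taperMeasure h T) := by
  have := isFiniteMeasure_taperMeasure hh T
  exact MemLp.of_bound (by fun_prop) 1 (Eventually.of_forall fun t => (norm_exp_I_mul x t).le)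

/-- The character `t ↦ e^{ixt}` as a vector of `L²([0, T]; h_T)`. -/
def expLp (x : ℝ) : Lp ℂ 2 (taperMeasure h T) := (memLp_exp hh T x).toLp _

theorem inner_expLp_right (v : Lp ℂ 2 (taperMeasure h T)) (x : ℝ) :
    inner ℂ v (expLp hh T x) =
      ∫ t, Complex.exp (Complex.I * x * t) * starRingEnd ℂ (v t) ∂(taperMeasure h T) := by
  rw [L2.inner_def]
  refine integral_congr_ae ?_
  filter_upwards [(memLp_exp hh T x).coeFn_toLp] with t ht
  rw [expLp, ht, RCLike.inner_apply]

theorem inner_expLp_left (v : Lp ℂ 2 (taperMeasure h T)) (x : ℝ) :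
    inner ℂ (expLp hh T x) v =
      ∫ t, Complex.exp (-Complex.I * x * t) * v t ∂(taperMeasure h T) := by
  rw [L2.inner_def]
  refine integral_congr_ae ?_
  filter_upwards [(memLp_exp hh T x).coeFn_toLp] with t ht
  rw [expLp, ht, RCLike.inner_apply, conj_exp_I_mul, mul_comm]

theorem integral_taperMeasure (hT : 0 < T) (F : ℝ → ℂ) :
    ∫ t, F t ∂(taperMeasure h T) = ∫ t, (h (t / T) : ℂ) * F t := by
  have hm : Measurable fun t => h (t / T) := hh.isWindow.measurable.comp (by fun_prop)
  rw [taperMeasure, integral_withDensity_eq_integral_toReal_smul hm.ennreal_ofReal (by simp)]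
  simp_rw [ENNReal.toReal_ofReal (hh.nonneg _), Complex.real_smul]
  refine setIntegral_eq_integral_of_forall_compl_eq_zero fun t ht => ?_
  rw [hh.eq_zero _ fun h1 => ht ⟨?_, ?_⟩, Complex.ofReal_zero, zero_mul]
  · exact by simpa [hT.le, hT.ne'] using mul_nonneg h1.1 hT.le
  · exact (div_le_one hT).1 h1.2

theorem inner_expLp_expLp (hT : 0 < T) (a b : ℝ) :
    inner ℂ (expLp hh T a) (expLp hh T b) = kernelCT h T (a - b) := by
  rw [inner_expLp_left, kernelCT, ← integral_taperMeasure hh T hT]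
  refine integral_congr_ae ?_
  filter_upwards [(memLp_exp hh T b).coeFn_toLp] with t ht
  rw [expLp, ht, ← Complex.exp_add]
  congr 1
  push_cast
  ring

theorem measurable_inner_expLp (v : Lp ℂ 2 (taperMeasure h T)) :
    Measurable fun x => inner ℂ v (expLp hh T x) := by
  simp_rw [inner_expLp_right]
  refine Continuous.measurable (continuous_of_dominated (bound := fun t => ‖v t‖) (fun x => ?_)
    (fun x => Eventually.of_forall fun t => ?_) (integrable_coe_lp hh v).norm
    (Eventually.of_forall fun t => by fun_prop))
  · exact AEStronglyMeasurable.mul (by fun_prop)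
      (Complex.continuous_conj.comp_aestronglyMeasurable (Lp.aestronglyMeasurable v))
  · rw [norm_mul, norm_exp_I_mul, one_mul, RCLike.norm_conj]

/-- The weak form of `A = ∫ ψ(x) e_x ⊗ e_x* dx`: Fubini is used once to write `A w` as a
superposition of characters, and once to pair it with `v`. -/
theorem inner_wienerHopf {ψ : ℝ → ℝ} (hψ : Integrable ψ) (v w : Lp ℂ 2 (taperMeasure h T)) :
    inner ℂ v (wienerHopf hh hψ T w) = ∫ x in freqCT, (ψ x : ℂ) *
      (inner ℂ v (expLp hh T x) * inner ℂ (expLp hh T x) w) := by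
  have := isFiniteMeasure_taperMeasure hh T
  rw [freqCT, Measure.restrict_univ]
  have hv : Integrable (fun t => starRingEnd ℂ (v t)) (taperMeasure h T) :=
    (integrable_coe_lp hh v).norm.mono'
      (Complex.continuous_conj.comp_aestronglyMeasurable (Lp.aestronglyMeasurable v))
      (Eventually.of_forall fun t => by rw [RCLike.norm_conj])
  have hw := integrable_coe_lp hh w
  set c : ℝ → ℂ := fun x => inner ℂ (expLp hh T x) w with hc
  have hcn : ∀ x, ‖c x‖ ≤ ∫ t, ‖w t‖ ∂(taperMeasure h T) := fun x => by
    simp only [hc, inner_expLp_left]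
    refine norm_integral_le_of_norm_le hw.norm (Eventually.of_forall fun t => ?_)
    rw [norm_mul, norm_exp_neg_I_mul, one_mul]
  have hcm : Measurable c := by
    simp_rw [hc, ← inner_conj_symm _ w]
    exact Complex.continuous_conj.measurable.comp (measurable_inner_expLp hh T w)
  have hψc : Integrable fun x => (ψ x : ℂ) * c x :=
    hψ.ofReal.mul_bdd hcm.aestronglyMeasurable (Eventually.of_forall hcn)
  have h1 : ∀ t, wienerHopfFun h ψ T w t =
      ∫ x : ℝ, Complex.exp (Complex.I * x * t) * ((ψ x : ℂ) * c x) := fun t => by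
    have h2 := integral_mul_integral_swap (θ := fun s x : ℝ => Complex.exp (-Complex.I * x * s)) hw
      ((hψ.ofReal (𝕜 := ℂ)).bdd_mul (c := 1) (f := fun x : ℝ => Complex.exp (Complex.I * x * t))
        (by fun_prop) (Eventually.of_forall fun x => (norm_exp_I_mul x t).le))
      (by fun_prop) (C := 1) fun s x => (norm_exp_neg_I_mul x s).le
    calc wienerHopfFun h ψ T w t
        = ∫ s, w s * (∫ x : ℝ, Complex.exp (-Complex.I * x * s) *
            (Complex.exp (Complex.I * x * t) * (ψ x : ℂ))) ∂(taperMeasure h T) := by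
          rw [wienerHopfFun]
          refine integral_congr_ae (Eventually.of_forall fun s => ?_)
          simp only
          rw [fourierHat, freqCT, Measure.restrict_univ, mul_comm]
          congr 1
          refine integral_congr_ae (Eventually.of_forall fun x => ?_)
          simp only
          rw [← mul_assoc, ← Complex.exp_add]
          congr 2
          push_cast
          ring
      _ = _ := h2
      _ = _ := by
          refine integral_congr_ae (Eventually.of_forall fun x => ?_)
          simp only
          rw [mul_assoc]
          simp only [hc]
          rw [inner_expLp_left]
          rfl
  calc inner ℂ v (wienerHopf hh hψ T w)
      = ∫ t, starRingEnd ℂ (v t) *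
          (∫ x : ℝ, Complex.exp (Complex.I * x * t) * ((ψ x : ℂ) * c x)) ∂(taperMeasure h T) := by
        rw [L2.inner_def]
        refine integral_congr_ae ?_
        filter_upwards [(memLp_wienerHopfFun hh hψ T w).coeFn_toLp] with t ht
        rw [← h1, ← ht, RCLike.inner_apply, mul_comm]
        rfl
    _ = ∫ x, ((ψ x : ℂ) * c x) *
          (∫ t : ℝ, Complex.exp (Complex.I * x * t) * starRingEnd ℂ (v t) ∂(taperMeasure h T)) :=
        integral_mul_integral_swap (θ := fun t x : ℝ => Complex.exp (Complex.I * x * t)) hv hψc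
          (by fun_prop) fun t x => (norm_exp_I_mul x t).le
    _ = _ := by
        refine integral_congr_ae (Eventually.of_forall fun x => ?_)
        simp only
        rw [inner_expLp_right, hc]
        ring

theorem hasTrace_prod_wienerHopf (hT : 0 < T) {n : ℕ} {ψ : Fin (n + 1) → ℝ → ℝ}
    (hψ : ∀ i, Integrable (ψ i)) :
    HasTrace (List.ofFn fun i => wienerHopf hh (hψ i) T).prod
      (∫ x in freqCT, (ψ 0 x : ℂ) * pathIntegral freqCT (kernelCT h T) (fun i => ψ i.succ) x x) := by
  have := isFiniteMeasure_taperMeasure hh T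
  obtain ⟨H, hH⟩ := hh.isWindow.bounded
  have hK : ∀ u, ‖kernelCT h T u‖ ≤ H * T := hh.isWindow.norm_kernelCT_le hH hT
  -- `‖e_x‖²` is the kernel at `0`.
  have he : ∀ x, ‖expLp hh T x‖ ≤ √(H * T) := fun x => by
    refine Real.le_sqrt_of_sq_le ?_
    have h1 := hK (x - x)
    rwa [← inner_expLp_expLp hh T hT, inner_self_eq_norm_sq_to_K, norm_pow, RCLike.norm_ofReal,
      abs_norm] at h1
  have : Fact ((2 : ℝ≥0∞) ≠ ∞) := ⟨by simp⟩
  have hψ' : ∀ i, IntegrableOn (ψ i) freqCT := fun i => (hψ i).integrableOn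
  rw [List.ofFn_succ, List.prod_cons]
  simp_rw [← inner_prod_eq_pathIntegral (hh.isWindow.continuous_kernelCT hT).measurable hK
    (inner_expLp_expLp hh T hT) (fun i => hψ' i.succ)
    (A := fun i => wienerHopf hh (hψ i.succ) T) (fun i => inner_wienerHopf hh T (hψ i.succ))]
  exact hasTrace_mul he (measurable_inner_expLp hh T) (hψ' 0) (inner_wienerHopf hh T (hψ 0)) _

end

/-! ### Limits in continuous time. -/

theorem ConvolutionCondition.integrableOn_prod {Λ : Set ℝ} {n : ℕ} {ψ : Fin (n + 1) → ℝ → ℝ}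
    (h : ConvolutionCondition Λ ψ) : IntegrableOn (fun x => ∏ i, ψ i x) Λ := by
  refine h.2.1.congr (Eventually.of_forall fun x => ?_)
  simp [shiftedProduct, Fin.prod_univ_succ]

theorem tendsto_trace_wienerHopf {h : ℝ → ℝ} (hh : IsTaper h) {n : ℕ} {ψ : Fin (n + 1) → ℝ → ℝ}
    (hψ : ∀ i, Integrable (ψ i)) (hconv : ConvolutionCondition freqCT ψ) :
    Tendsto (fun T : ℝ => (1 / (T : ℂ)) * ∫ x in freqCT, (ψ 0 x : ℂ) *
        pathIntegral freqCT (kernelCT h T) (fun i => ψ i.succ) x x) atTop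
      (𝓝 (((2 * Real.pi) ^ n * moment h (n + 1) * ∫ x in freqCT, ∏ i, ψ i x : ℝ) : ℂ)) := by
  obtain ⟨C, hC, hkC⟩ := hh.isWindow.exists_enorm_kernelCT_le
  -- Replacing `T` by `max T 1` makes the kernel estimates available for every `T`, and does not
  -- affect the limit.
  have hpos : ∀ᶠ T : ℝ in atTop, max T 1 = T :=
    (eventually_ge_atTop 1).mono fun T hT => max_eq_left hT
  have hmax : ∀ T : ℝ, 0 < max T 1 := fun T => by positivity
  have hlim : Tendsto (fun T : ℝ => max T 1) atTop atTop :=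
    tendsto_atTop_mono (fun T => le_max_left T 1) tendsto_id
  have h1 := isFreqDomain_freqCT.tendsto_integral_mul_pathIntegral (fun i x => by simp)
    (fun i => (hψ i).integrableOn) hconv hlim
    (k := fun T => kernelCT h (max T 1))
    (fun T => (hh.isWindow.continuous_kernelCT (hmax T)).measurable) (fun T u => by simp) hC
    (fun T _ u => hkC _ (hmax T) u) (M := (2 * Real.pi) ^ n * moment h (n + 1)) ?_
  · rw [Complex.ofReal_mul]
    push_cast at h1 ⊢
    refine h1.congr' (hpos.mono fun T hT => ?_)
    simp only
    rw [hT]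
  · refine tendsto_const_nhds.congr fun T => ?_
    have hne : ((max T 1 : ℝ) : ℂ) ≠ 0 := Complex.ofReal_ne_zero.2 (hmax T).ne'
    rw [hh.isWindow.integral_prod_kernelCT (hmax T), sub_zero, hh.isWindow.kernelCT_zero (hmax T)]
    field_simp

end TaperedToeplitz

end

/-! ### The theorem: reduction of (C1) to (C2) in both settings. -/

theorem mainTheorem9 {h : ℝ → ℝ} (hh : TaperedToeplitz.IsTaper h) (n : ℕ)
    (ψ : Fin (n + 1) → ℝ → ℝ) (hsymm : ∀ i, Function.Even (ψ i)) :
    ((∀ i, Function.Periodic (ψ i) (2 * Real.pi)) →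
      (∀ i, IntegrableOn (ψ i) TaperedToeplitz.freqDT) →
      (TaperedToeplitz.HolderCondition TaperedToeplitz.freqDT ψ ∨
        TaperedToeplitz.ConvolutionCondition TaperedToeplitz.freqDT ψ) →
      IntegrableOn (fun x => ∏ i, ψ i x) TaperedToeplitz.freqDT ∧
      Tendsto
        (fun T : ℕ => (1 / (T : ℂ)) *
          (List.ofFn fun i => TaperedToeplitz.toeplitz h (ψ i) T).prod.trace)
        atTop
        (𝓝 (((2 * Real.pi) ^ n * TaperedToeplitz.moment h (n + 1) *
          ∫ x in TaperedToeplitz.freqDT, ∏ i, ψ i x : ℝ) : ℂ)) ∧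
      Tendsto
        (fun T : ℕ => (1 / (T : ℂ)) *
          (List.ofFn fun i => TaperedToeplitz.toeplitzTwoSided h (ψ i) T).prod.trace)
        atTop
        (𝓝 (((2 * Real.pi) ^ n * TaperedToeplitz.moment h (2 * (n + 1)) *
          ∫ x in TaperedToeplitz.freqDT, ∏ i, ψ i x : ℝ) : ℂ))) ∧
    (∀ hint : ∀ i, Integrable (ψ i),
      (TaperedToeplitz.HolderCondition TaperedToeplitz.freqCT ψ ∨
        TaperedToeplitz.ConvolutionCondition TaperedToeplitz.freqCT ψ) →
      IntegrableOn (fun x => ∏ i, ψ i x) TaperedToeplitz.freqCT ∧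
      ∃ τ : ℝ → ℂ,
        (∀ T : ℝ, 0 < T → TaperedToeplitz.HasTrace
          (List.ofFn fun i => TaperedToeplitz.wienerHopf hh (hint i) T).prod (τ T)) ∧
        Tendsto (fun T : ℝ => (1 / (T : ℂ)) * τ T) atTop
          (𝓝 (((2 * Real.pi) ^ n * TaperedToeplitz.moment h (n + 1) *
            ∫ x in TaperedToeplitz.freqCT, ∏ i, ψ i x : ℝ) : ℂ))) := by
  refine ⟨fun hper hψ hcond => ?_, fun hψ hcond => ?_⟩
  · have hconv : TaperedToeplitz.ConvolutionCondition TaperedToeplitz.freqDT ψ := hcond.elim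
      (TaperedToeplitz.isFreqDomain_freqDT.convolutionCondition_of_holderCondition hper hψ) id
    obtain ⟨H, -, hH⟩ := hh.exists_abs_bound
    exact ⟨hconv.integrableOn_prod,
      TaperedToeplitz.tendsto_trace_toeplitz hh.continuousOn hH hh.boundedVariation hper hψ hconv,
      TaperedToeplitz.tendsto_trace_toeplitzTwoSided hh hper hψ hconv⟩
  · have hconv : TaperedToeplitz.ConvolutionCondition TaperedToeplitz.freqCT ψ := hcond.elim
      (TaperedToeplitz.isFreqDomain_freqCT.convolutionCondition_of_holderCondition
        (fun i x => by simp) fun i => (hψ i).integrableOn) id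
    exact ⟨hconv.integrableOn_prod, _,
      fun T hT => TaperedToeplitz.hasTrace_prod_wienerHopf hh T hT hψ,
      TaperedToeplitz.tendsto_trace_wienerHopf hh hψ hconv⟩
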